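/- Let $\mathbf k$ be a field. Let $\mathrm{UCob}_2$ be the skeletal symmetric monoidal category of unoriented two-dimensional cobordisms: its objects are the natural numbers ($n$ stands for the disjoint union of $n$ circles), and it is the strict symmetric monoidal category generated by the circle $A=1$ with multiplication $m:A\otimes A\to A$, unit $u:\mathbb 1\to A$, comultiplication $\Delta:A\to A\otimes A$, counit $\varepsilon:A\to\mathbb 1$, involution $\phi:A\to A$ and crosscap $\theta:\mathbb 1\to A$, subject to the relations of an extended Frobenius algebra: $(A,m,u,\Delta,\varepsilon)$ is a commutative Frobenius algebra, $\phi$ is an involutive automorphism of it, $\phi\, m(\theta\otimes \mathrm{id})=m(\theta\otimes \mathrm{id})$, and $m(\phi\otimes\mathrm{id})\Delta u=m(\theta\otimes\theta)$. Let $x=m\Delta: A\to A$ be the handle endomorphism. Let $\alpha,\beta,\gamma$ be sequences in $\mathbf k$ whose generating functions are $Z_\alpha=p_\alpha/q$, $Z_\beta=p_\beta/q$, $Z_\gamma=p_\gamma/q$ with polynomials $p_\alpha,p_\beta,p_\gamma,q\in\mathbf k[T]$ such that $\gcd(p_\alpha,q)=1$, $q(0)=1$ and $\deg p_\beta,\deg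 p_\gamma<K:=\max(\deg p_\alpha+1,\deg q)$ (constant polynomials, including $0$, have degree $0$). We call such a triple $(\alpha,\beta,\gamma)$ admissible, and call $m_\alpha(T)=T^Kq(1/T)$ its handle polynomial. The category $\mathrm{VUCob}_{\alpha,\beta,\gamma}$ is the quotient of the $\mathbf k$-linearization of $\mathrm{UCob}_2$ by the tensor ideal generated by $\varepsilon x^g u-\alpha_g$, $\varepsilon x^g\theta-\beta_g$, $\varepsilon x^g m(\theta\otimes\theta)-\gamma_g$ for $g\ge 0$; the category $\mathrm{SUCob}_{\alpha,\beta,\gamma}$ is the quotient of $\mathrm{VUCob}_{\alpha,\beta,\gamma}$ by the tensor ideal generated by $m_\alpha(x)$; and $\mathrm{UCob}_{\alpha,\beta,\gamma}$ is the pseudo-abelian envelope (the idempotent completion of the additive envelope) of $\mathrm{SUCob}_{\alpha,\beta,\gamma}$. For $\mathbf k$-linear symmetric monoidal categories $\mathcal C,\mathcal D$, let $\mathcal C\boxtimes\mathcal D$ be the pseudo-abelian envelope of $\mathcal C\otimes_{\mathbf k}\mathcal D$, whose objects are pairs of objects and whose morphism spaces are tensor products over $\mathbf k$ of morphism spaces.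 Let $(\alpha',\beta',\gamma')$ and $(\alpha'',\beta'',\gamma'')$ be admissible triples with coprime handle polynomials $m'(T)$ and $m''(T)$, let $\alpha=\alpha'+\alpha''$, $\beta=\beta'+\beta''$, $\gamma=\gamma'+\gamma''$, and suppose that $(\alpha,\beta,\gamma)$ is admissible with handle polynomial $m_\alpha(T)=\mathrm{lcm}(m'(T),m''(T))=m'(T)m''(T)$. Let $A,A',A''$ be the circle objects of $\mathrm{UCob}_{\alpha,\beta,\gamma}$, $\mathrm{UCob}'=\mathrm{UCob}_{\alpha',\beta',\gamma'}$ and $\mathrm{UCob}''=\mathrm{UCob}_{\alpha'',\beta'',\gamma''}$. Then there is a $\mathbf k$-linear symmetric monoidal functor $$F:\mathrm{UCob}_{\alpha,\beta,\gamma}\longrightarrow \mathrm{UCob}'\boxtimes\mathrm{UCob}''$$ which is an equivalence of categories and sends $A$, with all its structure maps $m,u,\Delta,\varepsilon,\phi,\theta$, to an object isomorphic to $(A'\boxtimes\mathbb 1)\oplus(\mathbb 1\boxtimes A'')$ with the componentwise structure maps. -/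

import Mathlib

open CategoryTheory MonoidalCategory

noncomputable section

universe v v' u u' w

/-- A symmetric monoidal category from a natural family of morphisms which satisfies one hexagon identity and
is its own inverse. -/
abbrev symmetricOfHexagon {C : Type u} [Category.{v} C] [MonoidalCategory C]
    (b : ∀ X Y : C, X ⊗ Y ⟶ Y ⊗ X)
    (natural : ∀ {X X' Y Y' : C} (f : X ⟶ X') (g : Y ⟶ Y'), (f ⊗ₘ g) ≫ b X' Y' = b X Y ≫ (g ⊗ₘ f))
    (hexagon : ∀ X Y Z : C, (α_ X Y Z).hom ≫ b X (Y ⊗ Z) ≫ (α_ Y Z X).hom =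
      (b X Y ⊗ₘ 𝟙 Z) ≫ (α_ Y X Z).hom ≫ (𝟙 Y ⊗ₘ b X Z))
    (symm : ∀ X Y : C, b X Y ≫ b Y X = 𝟙 (X ⊗ Y)) : SymmetricCategory C where
  braiding X Y := ⟨b X Y, b Y X, symm X Y, symm Y X⟩
  braiding_naturality_right X _ _ f := by simpa using natural (𝟙 X) f
  braiding_naturality_left f X := by simpa using natural f (𝟙 X)
  hexagon_forward X Y Z := by simpa using hexagon X Y Z
  hexagon_reverse X Y Z := by
    let B : ∀ X Y : C, X ⊗ Y ≅ Y ⊗ X := fun X Y => ⟨b X Y, b Y X, symm X Y, symm Y X⟩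
    have h : α_ Z X Y ≪≫ B Z (X ⊗ Y) ≪≫ α_ X Y Z =
        whiskerRightIso (B Z X) Y ≪≫ α_ X Z Y ≪≫ whiskerLeftIso X (B Z Y) := by
      ext; simpa [B] using hexagon Z X Y
    simpa [B] using congrArg Iso.inv h
  symmetry X Y := symm X Y

/-! ### Unoriented two-dimensional cobordisms, by generators and relations -/

/-- The objects of the skeletal category of unoriented two-dimensional cobordisms:
`⟨n⟩` is the disjoint union of `n` circles. -/
structure UCob : Type where
  circles : ℕ

namespace UCob

/-- Words in the generating cobordisms: cylinders, gluing, disjoint union, permutations of circles,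
reverse pair of pants, cup, pair of pants, cap, orientation reversing cylinder `φ`,
and crosscap `θ` (the once punctured projective plane). -/
inductive Word : ℕ → ℕ → Type
  | id (a : ℕ) : Word a a
  | comp {a b c : ℕ} : Word a b → Word b c → Word a c
  | tensor {a b c d : ℕ} : Word a b → Word c d → Word (a + c) (b + d)
  | braid (a b : ℕ) : Word (a + b) (b + a)
  | mul : Word (1 + 1) 1
  | one : Word 0 1
  | comul : Word 1 (1 + 1)
  | counit : Word 1 0
  | phi : Word 1 1
  | theta : Word 0 1

namespace Word

/-- The identity cylinders, for two expressions of the same number of circles. -/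
def cast {a b : ℕ} (h : a = b) : Word a b := h ▸ Word.id a

/-- The relations between words: those of a strict symmetric monoidal category, and those of an
extended Frobenius algebra (commutative Frobenius algebra with an involution `φ` and a crosscap
`θ`). -/
inductive Rel : ∀ {a b : ℕ}, Word a b → Word a b → Prop
  -- congruence
  | refl {a b : ℕ} (f : Word a b) : Rel f f
  | symm {a b : ℕ} {f g : Word a b} : Rel f g → Rel g f
  | trans {a b : ℕ} {f g h : Word a b} : Rel f g → Rel g h → Rel f h
  | comp_congr {a b c : ℕ} {f f' : Word a b} {g g' : Word b c} :
      Rel f f' → Rel g g' → Rel (comp f g) (comp f' g')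
  | tensor_congr {a b c d : ℕ} {f f' : Word a b} {g g' : Word c d} :
      Rel f f' → Rel g g' → Rel (tensor f g) (tensor f' g')
  -- category
  | id_comp {a b : ℕ} (f : Word a b) : Rel (comp (id a) f) f
  | comp_id {a b : ℕ} (f : Word a b) : Rel (comp f (id b)) f
  | assoc {a b c d : ℕ} (f : Word a b) (g : Word b c) (h : Word c d) :
      Rel (comp (comp f g) h) (comp f (comp g h))
  -- strict monoidal category
  | tensor_id (a b : ℕ) : Rel (tensor (id a) (id b)) (id (a + b))
  | tensor_comp {a b c a' b' c' : ℕ} (f : Word a b) (f' : Word a' b') (g : Word b c)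
      (g' : Word b' c') :
      Rel (comp (tensor f f') (tensor g g')) (tensor (comp f g) (comp f' g'))
  | tensor_assoc {a b a' b' a'' b'' : ℕ} (f : Word a b) (f' : Word a' b') (f'' : Word a'' b'') :
      Rel (comp (tensor (tensor f f') f'') (cast (Nat.add_assoc b b' b'')))
        (comp (cast (Nat.add_assoc a a' a'')) (tensor f (tensor f' f'')))
  | zero_tensor {a b : ℕ} (f : Word a b) :
      Rel (comp (tensor (id 0) f) (cast (Nat.zero_add b))) (comp (cast (Nat.zero_add a)) f)
  | tensor_zero {a b : ℕ} (f : Word a b) :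
      Rel (comp (tensor f (id 0)) (cast (Nat.add_zero b))) (comp (cast (Nat.add_zero a)) f)
  -- symmetry
  | braid_natural {a b c d : ℕ} (f : Word a b) (g : Word c d) :
      Rel (comp (tensor f g) (braid b d)) (comp (braid a c) (tensor g f))
  | braid_braid (a b : ℕ) : Rel (comp (braid a b) (braid b a)) (id (a + b))
  | hexagon (a b c : ℕ) :
      Rel (comp (cast (Nat.add_assoc a b c)) (comp (braid a (b + c)) (cast (Nat.add_assoc b c a))))
        (comp (tensor (braid a b) (id c)) (comp (cast (Nat.add_assoc b a c))
          (tensor (id b) (braid a c))))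
  -- commutative Frobenius algebra
  | mul_assoc : Rel (comp (tensor mul (id 1)) mul)
      (comp (cast (Nat.add_assoc 1 1 1)) (comp (tensor (id 1) mul) mul))
  | one_mul : Rel (comp (tensor one (id 1)) mul) (cast (Nat.zero_add 1))
  | mul_one : Rel (comp (tensor (id 1) one) mul) (cast (Nat.add_zero 1))
  | comul_assoc : Rel (comp comul (comp (tensor comul (id 1)) (cast (Nat.add_assoc 1 1 1))))
      (comp comul (tensor (id 1) comul))
  | counit_comul : Rel (comp comul (comp (tensor counit (id 1)) (cast (Nat.zero_add 1)))) (id 1)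
  | comul_counit : Rel (comp comul (comp (tensor (id 1) counit) (cast (Nat.add_zero 1)))) (id 1)
  | mul_comm : Rel (comp (braid 1 1) mul) mul
  | comul_comm : Rel (comp comul (braid 1 1)) comul
  | frobenius_left :
      Rel (comp (tensor comul (id 1)) (comp (cast (Nat.add_assoc 1 1 1)) (tensor (id 1) mul)))
        (comp mul comul)
  | frobenius_right :
      Rel (comp (tensor (id 1) comul) (comp (cast (Nat.add_assoc 1 1 1).symm) (tensor mul (id 1))))
        (comp mul comul)
  -- the orientation reversing cylinder and the crosscap
  | phi_phi : Rel (comp phi phi) (id 1)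
  | mul_phi : Rel (comp (tensor phi phi) mul) (comp mul phi)
  | phi_comul : Rel (comp phi comul) (comp comul (tensor phi phi))
  | one_phi : Rel (comp one phi) one
  | phi_counit : Rel (comp phi counit) counit
  | theta_phi : Rel (comp (tensor theta (id 1)) (comp mul phi)) (comp (tensor theta (id 1)) mul)
  | klein : Rel (comp one (comp comul (comp (tensor phi (id 1)) mul)))
      (comp (cast (Nat.zero_add 0).symm) (comp (tensor theta theta) mul))

/-- Words modulo the relations. -/
instance setoid (a b : ℕ) : Setoid (Word a b) := ⟨Rel, .refl, .symm, .trans⟩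

end Word

instance : Category UCob where
  Hom X Y := Quotient (Word.setoid X.circles Y.circles)
  id X := Quotient.mk _ (.id X.circles)
  comp := Quotient.map₂ Word.comp fun _ _ h _ _ h' => .comp_congr h h'
  id_comp := by rintro _ _ ⟨f⟩; exact Quotient.sound (.id_comp f)
  comp_id := by rintro _ _ ⟨f⟩; exact Quotient.sound (.comp_id f)
  assoc := by rintro _ _ _ _ ⟨f⟩ ⟨g⟩ ⟨h⟩; exact Quotient.sound (.assoc f g h)

/-- The cobordism represented by a word. -/
def ofWord {a b : ℕ} (f : Word a b) : (⟨a⟩ : UCob) ⟶ ⟨b⟩ := Quotient.mk _ f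

theorem ofWord_eq {a b : ℕ} {f g : Word a b} (h : Word.Rel f g) : ofWord f = ofWord g :=
  Quotient.sound h

/-- The identity cylinders, for two expressions of the same number of circles. -/
def castIso {a b : ℕ} (h : a = b) : (⟨a⟩ : UCob) ≅ ⟨b⟩ where
  hom := ofWord (.cast h)
  inv := ofWord (.cast h.symm)
  hom_inv_id := by subst h; exact ofWord_eq (.id_comp _)
  inv_hom_id := by subst h; exact ofWord_eq (.id_comp _)

theorem castIso_comp {a b c : ℕ} (h : a = b) (h' : b = c) :
    (castIso h).hom ≫ (castIso h').hom = (castIso (h.trans h')).hom := by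
  subst h h'; exact ofWord_eq (.id_comp _)

instance : MonoidalCategoryStruct UCob where
  tensorObj X Y := ⟨X.circles + Y.circles⟩
  tensorUnit := ⟨0⟩
  tensorHom := Quotient.map₂ Word.tensor fun _ _ h _ _ h' => .tensor_congr h h'
  whiskerLeft X _ _ := Quotient.map (Word.tensor (.id X.circles)) fun _ _ h =>
    .tensor_congr (.refl _) h
  whiskerRight f X := Quotient.map (fun f => Word.tensor f (.id X.circles))
    (fun _ _ h => .tensor_congr h (.refl _)) f
  associator X Y Z := castIso (Nat.add_assoc X.circles Y.circles Z.circles)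
  leftUnitor X := castIso (Nat.zero_add X.circles)
  rightUnitor X := castIso (Nat.add_zero X.circles)

theorem castIso_tensor {a b c d : ℕ} (h : a = b) (h' : c = d) :
    (castIso h).hom ⊗ₘ (castIso h').hom =
      (castIso (congrArg₂ (· + ·) h h') : (⟨a + c⟩ : UCob) ≅ ⟨b + d⟩).hom := by
  subst h h'; exact ofWord_eq (.tensor_id _ _)

theorem castIso_refl {a : ℕ} (h : a = a) : (castIso h).hom = 𝟙 (⟨a⟩ : UCob) := rfl

instance : MonoidalCategory UCob :=
  .ofTensorHom
    (id_tensorHom_id := fun X Y => ofWord_eq (.tensor_id X.circles Y.circles))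
    (id_tensorHom := by rintro X _ _ ⟨f⟩; rfl)
    (tensorHom_id := by rintro _ _ ⟨f⟩ X; rfl)
    (tensorHom_comp_tensorHom := by
      rintro _ _ _ _ _ _ ⟨f⟩ ⟨f'⟩ ⟨g⟩ ⟨g'⟩; exact ofWord_eq (.tensor_comp f f' g g'))
    (associator_naturality := by
      rintro _ _ _ _ _ _ ⟨f⟩ ⟨g⟩ ⟨h⟩; exact ofWord_eq (.tensor_assoc f g h))
    (leftUnitor_naturality := by rintro _ _ ⟨f⟩; exact ofWord_eq (.zero_tensor f))
    (rightUnitor_naturality := by rintro _ _ ⟨f⟩; exact ofWord_eq (.tensor_zero f))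
    (pentagon := fun W X Y Z => by
      change ((castIso _).hom ⊗ₘ (castIso rfl).hom) ≫ (castIso _).hom ≫
        ((castIso rfl).hom ⊗ₘ (castIso _).hom) = (castIso _).hom ≫ (castIso _).hom
      rw [castIso_tensor, castIso_tensor]
      erw [castIso_comp, castIso_comp, castIso_comp])
    (triangle := fun X Y => by
      change (castIso _).hom ≫ ((castIso rfl).hom ⊗ₘ (castIso _).hom) =
        ((castIso _).hom ⊗ₘ (castIso rfl).hom)
      rw [castIso_tensor, castIso_tensor]
      erw [castIso_comp])

instance : SymmetricCategory UCob :=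
  symmetricOfHexagon (fun X Y => ofWord (.braid X.circles Y.circles))
    (natural := by rintro _ _ _ _ ⟨f⟩ ⟨g⟩; exact ofWord_eq (.braid_natural f g))
    (hexagon := fun X Y Z => ofWord_eq (.hexagon X.circles Y.circles Z.circles))
    (symm := fun X Y => ofWord_eq (.braid_braid X.circles Y.circles))

end UCob
namespace MonoidalAux

variable {C : Type u} [Category.{v} C] [MonoidalCategory C]

theorem leftUnitor_natural {X Y : C} (f : X ⟶ Y) :
    (𝟙 (𝟙_ C) ⊗ₘ f) ≫ (λ_ Y).hom = (λ_ X).hom ≫ f := by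
  rw [id_tensorHom, leftUnitor_naturality]

theorem rightUnitor_natural {X Y : C} (f : X ⟶ Y) :
    (f ⊗ₘ 𝟙 (𝟙_ C)) ≫ (ρ_ Y).hom = (ρ_ X).hom ≫ f := by
  rw [tensorHom_id, rightUnitor_naturality]

theorem pentagon_tensor (W X Y Z : C) :
    ((α_ W X Y).hom ⊗ₘ 𝟙 Z) ≫ (α_ W (X ⊗ Y) Z).hom ≫ (𝟙 W ⊗ₘ (α_ X Y Z).hom) =
      (α_ (W ⊗ X) Y Z).hom ≫ (α_ W X (Y ⊗ Z)).hom := by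
  simp

theorem triangle_tensor (X Y : C) :
    (α_ X (𝟙_ C) Y).hom ≫ (𝟙 X ⊗ₘ (λ_ Y).hom) = ((ρ_ X).hom ⊗ₘ 𝟙 Y) := by
  simp

theorem hexagon_tensor [BraidedCategory C] (X Y Z : C) :
    (α_ X Y Z).hom ≫ (β_ X (Y ⊗ Z)).hom ≫ (α_ Y Z X).hom =
      ((β_ X Y).hom ⊗ₘ 𝟙 Z) ≫ (α_ Y X Z).hom ≫ (𝟙 Y ⊗ₘ (β_ X Z).hom) := by
  simp

variable [Preadditive C] [MonoidalPreadditive C]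

theorem tensor_zero {X Y X' Y' : C} (f : X ⟶ Y) : f ⊗ₘ (0 : X' ⟶ Y') = 0 := by
  rw [MonoidalCategory.tensorHom_def, MonoidalPreadditive.whiskerLeft_zero, Limits.comp_zero]

theorem zero_tensor {X Y X' Y' : C} (g : X' ⟶ Y') : (0 : X ⟶ Y) ⊗ₘ g = 0 := by
  rw [MonoidalCategory.tensorHom_def, MonoidalPreadditive.zero_whiskerRight, Limits.zero_comp]

end MonoidalAux

/-! ### Linearization of a symmetric monoidal category -/

/-- The `k`-linearization of a category: same objects, morphisms are formal `k`-linear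
combinations of morphisms. -/
structure Lin (k : Type w) (C : Type u) where
  of : C

namespace Lin

/-- The bilinear map with prescribed values on pairs of basis vectors. -/
def bilinear (k : Type w) [CommRing k] {A B M : Type*} [AddCommGroup M] [Module k M]
    (t : A → B → M) : (A →₀ k) →ₗ[k] (B →₀ k) →ₗ[k] M :=
  Finsupp.lsum k fun a => LinearMap.toSpanSingleton k _ (Finsupp.lsum k fun b =>
    LinearMap.toSpanSingleton k _ (t a b))

theorem bilinear_single {k : Type w} [CommRing k] {A B M : Type*} [AddCommGroup M] [Module k M]
    (t : A → B → M) (a : A) (b : B) :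
    bilinear k t (Finsupp.single a 1) (Finsupp.single b 1) = t a b := by
  simp [bilinear]

theorem finsupp_induction {k : Type w} [CommRing k] {A : Type*} {P : (A →₀ k) → Prop} (f : A →₀ k)
    (zero : P 0) (add : ∀ f g, P f → P g → P (f + g))
    (smul : ∀ (r : k) (a : A), P (r • Finsupp.single a 1)) : P f :=
  Finsupp.induction_linear f zero (fun f g => add f g) fun a r => by
    simpa using smul r a

variable {k : Type w} [CommRing k] {C : Type u} [Category.{v} C]

/-- Bilinear extension of the composition of `C`. -/
def compHom (X Y Z : C) : ((X ⟶ Y) →₀ k) →ₗ[k] ((Y ⟶ Z) →₀ k) →ₗ[k] ((X ⟶ Z) →₀ k) :=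
  bilinear k fun f g => Finsupp.single (f ≫ g) 1

theorem compHom_single {X Y Z : C} (f : X ⟶ Y) (g : Y ⟶ Z) :
    compHom X Y Z (Finsupp.single f (1 : k)) (Finsupp.single g 1) = Finsupp.single (f ≫ g) 1 :=
  bilinear_single _ f g

instance : Category (Lin k C) where
  Hom X Y := (X.of ⟶ Y.of) →₀ k
  id X := Finsupp.single (𝟙 X.of) 1
  comp f g := compHom _ _ _ f g
  id_comp f := by
    induction f using finsupp_induction with
    | zero => rw [map_zero]
    | add f g hf hg => rw [map_add, hf, hg]
    | smul r f => rw [map_smul, compHom_single, Category.id_comp]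
  comp_id f := by
    induction f using finsupp_induction with
    | zero => rw [LinearMap.map_zero₂]
    | add f g hf hg => rw [LinearMap.map_add₂, hf, hg]
    | smul r f => rw [LinearMap.map_smul₂, compHom_single, Category.comp_id]
  assoc f g h := by
    induction f using finsupp_induction with
    | zero => simp only [LinearMap.map_zero₂]
    | add f g hf hg => simp only [LinearMap.map_add₂, hf, hg]
    | smul r f =>
    induction g using finsupp_induction with
    | zero => simp only [map_zero, LinearMap.zero_apply]
    | add f g hf hg => simp only [map_add, LinearMap.add_apply, hf, hg]
    | smul r g =>
    induction h using finsupp_induction with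
    | zero => simp only [map_zero]
    | add f g hf hg => simp only [map_add, hf, hg]
    | smul r h =>
      simp only [map_smul, LinearMap.smul_apply, compHom_single, Category.assoc]

instance : Preadditive (Lin k C) where
  homGroup X Y := inferInstanceAs (AddCommGroup ((X.of ⟶ Y.of) →₀ k))
  add_comp X Y Z f f' g := (compHom X.of Y.of Z.of).map_add₂ f f' g
  comp_add X Y Z f g g' := (compHom X.of Y.of Z.of f).map_add g g'

instance : Linear k (Lin k C) where
  homModule X Y := inferInstanceAs (Module k ((X.of ⟶ Y.of) →₀ k))
  smul_comp X Y Z r f g := (compHom X.of Y.of Z.of).map_smul₂ r f g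
  comp_smul X Y Z f r g := (compHom X.of Y.of Z.of f).map_smul r g

/-- A morphism of `C` as a morphism of its linearization. -/
def single {X Y : Lin k C} (f : X.of ⟶ Y.of) : X ⟶ Y := Finsupp.single f (1 : k)

theorem single_comp {X Y Z : Lin k C} (f : X.of ⟶ Y.of) (g : Y.of ⟶ Z.of) :
    single f ≫ single g = (single (f ≫ g) : X ⟶ Z) :=
  compHom_single f g

theorem single_id (X : Lin k C) : single (𝟙 X.of) = 𝟙 X := rfl

theorem hom_induction {X Y : Lin k C} {P : (X ⟶ Y) → Prop} (f : X ⟶ Y)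
    (zero : P 0) (add : ∀ f g, P f → P g → P (f + g))
    (smul : ∀ (r : k) (f : X.of ⟶ Y.of), P (r • single f)) : P f :=
  finsupp_induction (k := k) (P := P) f zero add smul

/-- An isomorphism of `C` as an isomorphism of its linearization. -/
def singleIso {X Y : Lin k C} (f : X.of ≅ Y.of) : X ≅ Y where
  hom := single f.hom
  inv := single f.inv
  hom_inv_id := by rw [single_comp, f.hom_inv_id, single_id]
  inv_hom_id := by rw [single_comp, f.inv_hom_id, single_id]

/-- The functor from a category to its linearization. -/
def embedding (k : Type w) [CommRing k] (C : Type u) [Category.{v} C] : C ⥤ Lin k C where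
  obj X := ⟨X⟩
  map f := single f
  map_id _ := rfl
  map_comp f g := (single_comp (k := k) (X := ⟨_⟩) (Y := ⟨_⟩) (Z := ⟨_⟩) f g).symm

variable [MonoidalCategory C]

instance : MonoidalCategoryStruct (Lin k C) where
  tensorObj X Y := ⟨X.of ⊗ Y.of⟩
  tensorUnit := ⟨𝟙_ C⟩
  tensorHom {X Y X' Y'} f g :=
    bilinear k (fun (f : X.of ⟶ Y.of) (g : X'.of ⟶ Y'.of) => Finsupp.single (f ⊗ₘ g) (1 : k)) f g
  whiskerLeft X X' Y' g :=
    bilinear k (fun (f : X.of ⟶ X.of) (g : X'.of ⟶ Y'.of) => Finsupp.single (f ⊗ₘ g) (1 : k)) (𝟙 X) g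
  whiskerRight {X Y} f X' :=
    bilinear k (fun (f : X.of ⟶ Y.of) (g : X'.of ⟶ X'.of) => Finsupp.single (f ⊗ₘ g) (1 : k)) f (𝟙 X')
  associator X Y Z := singleIso (α_ X.of Y.of Z.of)
  leftUnitor X := singleIso (λ_ X.of)
  rightUnitor X := singleIso (ρ_ X.of)

theorem add_tensor {X Y X' Y' : Lin k C} (f f' : X ⟶ Y) (g : X' ⟶ Y') :
    (f + f') ⊗ₘ g = (f ⊗ₘ g) + (f' ⊗ₘ g) := LinearMap.map_add₂ _ f f' g

theorem tensor_add {X Y X' Y' : Lin k C} (f : X ⟶ Y) (g g' : X' ⟶ Y') :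
    f ⊗ₘ (g + g') = (f ⊗ₘ g) + (f ⊗ₘ g') := LinearMap.map_add _ g g'

theorem smul_tensor {X Y X' Y' : Lin k C} (r : k) (f : X ⟶ Y) (g : X' ⟶ Y') :
    (r • f) ⊗ₘ g = r • (f ⊗ₘ g) := LinearMap.map_smul₂ _ r f g

theorem tensor_smul {X Y X' Y' : Lin k C} (r : k) (f : X ⟶ Y) (g : X' ⟶ Y') :
    f ⊗ₘ (r • g) = r • (f ⊗ₘ g) := LinearMap.map_smul _ r g

theorem zero_tensor {X Y X' Y' : Lin k C} (g : X' ⟶ Y') :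
    (0 : X ⟶ Y) ⊗ₘ g = 0 := LinearMap.map_zero₂ _ g

theorem tensor_zero {X Y X' Y' : Lin k C} (f : X ⟶ Y) :
    f ⊗ₘ (0 : X' ⟶ Y') = 0 := LinearMap.map_zero _

theorem single_tensor {X Y X' Y' : Lin k C} (f : X.of ⟶ Y.of) (g : X'.of ⟶ Y'.of) :
    (single f : X ⟶ Y) ⊗ₘ (single g : X' ⟶ Y') = (single (f ⊗ₘ g) : X ⊗ X' ⟶ Y ⊗ Y') :=
  bilinear_single _ f g

theorem associator_hom (X Y Z : Lin k C) : (α_ X Y Z).hom = single (α_ X.of Y.of Z.of).hom := rfl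
theorem leftUnitor_hom (X : Lin k C) : (λ_ X).hom = single (λ_ X.of).hom := rfl
theorem rightUnitor_hom (X : Lin k C) : (ρ_ X).hom = single (ρ_ X.of).hom := rfl
theorem tensor_of (X Y : Lin k C) : (X ⊗ Y).of = X.of ⊗ Y.of := rfl
theorem unit_of : (𝟙_ (Lin k C)).of = 𝟙_ C := rfl

instance : MonoidalCategory (Lin k C) :=
  .ofTensorHom
    (id_tensorHom_id := fun X Y => by
      rw [← single_id, ← single_id, single_tensor, id_tensorHom_id]; rfl)
    (id_tensorHom := fun _ _ _ _ => rfl)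
    (tensorHom_id := fun _ _ => rfl)
    (tensorHom_comp_tensorHom := fun f₁ f₂ g₁ g₂ => by
      induction f₁ using hom_induction with
      | zero => simp only [zero_tensor, Limits.zero_comp]
      | add a b ha hb => simp only [add_tensor, Preadditive.add_comp, ha, hb]
      | smul r₁ a =>
      induction f₂ using hom_induction with
      | zero => simp only [tensor_zero, Limits.zero_comp]
      | add a b ha hb => simp only [tensor_add, Preadditive.add_comp, ha, hb]
      | smul r₂ b =>
      induction g₁ using hom_induction with
      | zero => simp only [zero_tensor, Limits.comp_zero]
      | add a b ha hb => simp only [add_tensor, Preadditive.comp_add, ha, hb]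
      | smul r₃ c =>
      induction g₂ using hom_induction with
      | zero => simp only [tensor_zero, Limits.comp_zero]
      | add a b ha hb => simp only [tensor_add, Preadditive.comp_add, ha, hb]
      | smul r₄ d =>
      simp only [smul_tensor, tensor_smul, Linear.smul_comp, Linear.comp_smul, single_tensor,
        single_comp, tensor_of, tensorHom_comp_tensorHom]
      rw [smul_comm r₂ r₃])
    (associator_naturality := fun f₁ f₂ f₃ => by
      induction f₁ using hom_induction with
      | zero => simp only [zero_tensor, Limits.comp_zero, Limits.zero_comp]
      | add a b ha hb => simp only [add_tensor, Preadditive.add_comp, Preadditive.comp_add, ha, hb]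
      | smul r a =>
      induction f₂ using hom_induction with
      | zero => simp only [tensor_zero, zero_tensor, Limits.comp_zero, Limits.zero_comp]
      | add a b ha hb =>
        simp only [tensor_add, add_tensor, Preadditive.add_comp, Preadditive.comp_add, ha, hb]
      | smul r b =>
      induction f₃ using hom_induction with
      | zero => simp only [tensor_zero, Limits.comp_zero, Limits.zero_comp]
      | add a b ha hb => simp only [tensor_add, Preadditive.add_comp, Preadditive.comp_add, ha, hb]
      | smul r c =>
      simp only [smul_tensor, tensor_smul, Linear.smul_comp, Linear.comp_smul, single_tensor,
        associator_hom, single_comp, tensor_of, associator_naturality])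
    (leftUnitor_naturality := fun {X Y} f => by
      induction f using hom_induction with
      | zero => simp only [tensor_zero, Limits.comp_zero, Limits.zero_comp]
      | add a b ha hb => simp only [tensor_add, Preadditive.add_comp, Preadditive.comp_add, ha, hb]
      | smul r a =>
      simp only [tensor_smul, Linear.smul_comp, Linear.comp_smul, ← single_id, single_tensor,
        leftUnitor_hom, single_comp, tensor_of, unit_of, id_tensorHom, leftUnitor_naturality])
    (rightUnitor_naturality := fun {X Y} f => by
      induction f using hom_induction with
      | zero => simp only [zero_tensor, Limits.comp_zero, Limits.zero_comp]
      | add a b ha hb => simp only [add_tensor, Preadditive.add_comp, Preadditive.comp_add, ha, hb]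
      | smul r a =>
      simp only [smul_tensor, Linear.smul_comp, Linear.comp_smul, ← single_id, single_tensor,
        rightUnitor_hom, single_comp, tensor_of, unit_of, tensorHom_id, rightUnitor_naturality])
    (pentagon := fun W X Y Z => by
      simp only [associator_hom, ← single_id, single_tensor, single_comp, tensor_of,
        id_tensorHom, tensorHom_id, pentagon])
    (triangle := fun X Y => by
      simp only [associator_hom, leftUnitor_hom, rightUnitor_hom, ← single_id, single_tensor,
        single_comp, tensor_of, unit_of, id_tensorHom, tensorHom_id, triangle])

instance : MonoidalPreadditive (Lin k C) where
  whiskerLeft_zero := tensor_zero _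
  zero_whiskerRight := zero_tensor _
  whiskerLeft_add := tensor_add _
  add_whiskerRight f g := add_tensor f g _

instance : MonoidalLinear k (Lin k C) where
  whiskerLeft_smul _ _ _ r f := tensor_smul r _ f
  smul_whiskerRight r _ _ f _ := smul_tensor r f _

instance [SymmetricCategory C] : SymmetricCategory (Lin k C) :=
  symmetricOfHexagon (fun X Y => single (β_ X.of Y.of).hom)
    (natural := fun f g => by
      induction f using hom_induction with
      | zero => simp only [zero_tensor, tensor_zero, Limits.comp_zero, Limits.zero_comp]
      | add a b ha hb =>
        simp only [tensor_add, add_tensor, Preadditive.add_comp, Preadditive.comp_add, ha, hb]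
      | smul r a =>
      induction g using hom_induction with
      | zero => simp only [zero_tensor, tensor_zero, Limits.comp_zero, Limits.zero_comp]
      | add a b ha hb =>
        simp only [tensor_add, add_tensor, Preadditive.add_comp, Preadditive.comp_add, ha, hb]
      | smul s b =>
      simp only [smul_tensor, tensor_smul, Linear.smul_comp, Linear.comp_smul, single_tensor,
        single_comp, tensor_of, BraidedCategory.braiding_naturality]
      rw [smul_comm r s])
    (hexagon := fun X Y Z => by
      simp only [associator_hom, ← single_id, single_tensor, single_comp, tensor_of,
        id_tensorHom, tensorHom_id, BraidedCategory.hexagon_forward])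
    (symm := fun X Y => by
      simp only [single_comp, tensor_of, SymmetricCategory.symmetry, ← single_id])

instance : (embedding k C).Monoidal :=
  Functor.CoreMonoidal.toMonoidal
    { εIso := Iso.refl _
      μIso := fun X Y => Iso.refl _
      μIso_hom_natural_left := fun {X Y} f Z => by
        refine (Category.comp_id _).trans (Eq.trans ?_ (Category.id_comp _).symm)
        rw [← tensorHom_id, ← tensorHom_id]
        exact single_tensor (X := ⟨X⟩) (Y := ⟨Y⟩) (X' := ⟨Z⟩) (Y' := ⟨Z⟩) f (𝟙 Z)
      μIso_hom_natural_right := fun {X Y} Z f => by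
        refine (Category.comp_id _).trans (Eq.trans ?_ (Category.id_comp _).symm)
        rw [← id_tensorHom, ← id_tensorHom]
        exact single_tensor (X := ⟨Z⟩) (Y := ⟨Z⟩) (X' := ⟨X⟩) (Y' := ⟨Y⟩) (𝟙 Z) f
      associativity := fun X Y Z => by
        change (𝟙 ((⟨X⟩ : Lin k C) ⊗ ⟨Y⟩) ▷ ⟨Z⟩) ≫ 𝟙 _ ≫ (α_ (⟨X⟩ : Lin k C) ⟨Y⟩ ⟨Z⟩).hom =
          (α_ (⟨X⟩ : Lin k C) ⟨Y⟩ ⟨Z⟩).hom ≫ (⟨X⟩ ◁ 𝟙 ((⟨Y⟩ : Lin k C) ⊗ ⟨Z⟩)) ≫ 𝟙 _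
        simp
      left_unitality := fun X => by
        change (λ_ (⟨X⟩ : Lin k C)).hom = (𝟙 (𝟙_ (Lin k C)) ▷ ⟨X⟩) ≫ 𝟙 _ ≫ (λ_ (⟨X⟩ : Lin k C)).hom
        simp
      right_unitality := fun X => by
        change (ρ_ (⟨X⟩ : Lin k C)).hom = (⟨X⟩ ◁ 𝟙 (𝟙_ (Lin k C))) ≫ 𝟙 _ ≫ (ρ_ (⟨X⟩ : Lin k C)).hom
        simp }

end Lin
/-! ### Tensor ideals and quotients -/

/-- A tensor ideal of a `k`-linear monoidal category: subspaces of the morphism spaces, stable under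
composition and tensor product with arbitrary morphisms. -/
structure TensorIdeal (k : Type w) [CommRing k] (C : Type u) [Category.{v} C] [Preadditive C]
    [Linear k C] [MonoidalCategory C] where
  carrier (X Y : C) : Submodule k (X ⟶ Y)
  mem_comp {X Y Z : C} {f : X ⟶ Y} (hf : f ∈ carrier X Y) (g : Y ⟶ Z) : f ≫ g ∈ carrier X Z
  comp_mem {X Y Z : C} (f : X ⟶ Y) {g : Y ⟶ Z} (hg : g ∈ carrier Y Z) : f ≫ g ∈ carrier X Z
  mem_tensor {X Y Z W : C} {f : X ⟶ Y} (hf : f ∈ carrier X Y) (g : Z ⟶ W) :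
    f ⊗ₘ g ∈ carrier (X ⊗ Z) (Y ⊗ W)
  tensor_mem {X Y Z W : C} (f : X ⟶ Y) {g : Z ⟶ W} (hg : g ∈ carrier Z W) :
    f ⊗ₘ g ∈ carrier (X ⊗ Z) (Y ⊗ W)

namespace TensorIdeal

variable {k : Type w} [CommRing k] {C : Type u} [Category.{v} C] [Preadditive C] [Linear k C]
  [MonoidalCategory C]

variable (k) in
/-- The tensor ideal generated by a family of morphisms: the smallest one which contains it. -/
def span (S : ∀ X Y : C, Set (X ⟶ Y)) : TensorIdeal k C where
  carrier X Y := ⨅ (J : TensorIdeal k C) (_ : ∀ X Y, S X Y ⊆ J.carrier X Y), J.carrier X Y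
  mem_comp hf g := by
    simp only [Submodule.mem_iInf] at hf ⊢
    exact fun J hJ => J.mem_comp (hf J hJ) g
  comp_mem f _ hg := by
    simp only [Submodule.mem_iInf] at hg ⊢
    exact fun J hJ => J.comp_mem f (hg J hJ)
  mem_tensor hf g := by
    simp only [Submodule.mem_iInf] at hf ⊢
    exact fun J hJ => J.mem_tensor (hf J hJ) g
  tensor_mem f _ hg := by
    simp only [Submodule.mem_iInf] at hg ⊢
    exact fun J hJ => J.tensor_mem f (hg J hJ)

/-- The quotient of a `k`-linear monoidal category by a tensor ideal (objects). -/
structure QuotCat (I : TensorIdeal k C) where of ::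
  as : C

namespace QuotCat

variable {I : TensorIdeal k C}

/-- Composition in the quotient. -/
def comp {X Y Z : C} (f : (X ⟶ Y) ⧸ I.carrier X Y) (g : (Y ⟶ Z) ⧸ I.carrier Y Z) :
    (X ⟶ Z) ⧸ I.carrier X Z :=
  Quotient.liftOn₂' f g (fun f g => Submodule.Quotient.mk (f ≫ g)) fun f g f' g' hf hg => by
    rw [Submodule.quotientRel_def] at hf hg
    rw [Submodule.Quotient.eq]
    have : f ≫ g - f' ≫ g' = (f - f') ≫ g + f' ≫ (g - g') := by simp
    exact this ▸ add_mem (I.mem_comp hf g) (I.comp_mem f' hg)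

instance : Category (QuotCat I) where
  Hom X Y := (X.as ⟶ Y.as) ⧸ I.carrier X.as Y.as
  id X := Submodule.Quotient.mk (𝟙 X.as)
  comp f g := comp f g
  id_comp := by rintro _ _ ⟨f⟩; exact congrArg Submodule.Quotient.mk (Category.id_comp f)
  comp_id := by rintro _ _ ⟨f⟩; exact congrArg Submodule.Quotient.mk (Category.comp_id f)
  assoc := by
    rintro _ _ _ _ ⟨f⟩ ⟨g⟩ ⟨h⟩; exact congrArg Submodule.Quotient.mk (Category.assoc f g h)

/-- The class of a morphism in the quotient. -/
def mk {X Y : QuotCat I} (f : X.as ⟶ Y.as) : X ⟶ Y := Submodule.Quotient.mk (p := I.carrier _ _) f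

theorem mk_surjective {X Y : QuotCat I} (f : X ⟶ Y) : ∃ g : X.as ⟶ Y.as, mk g = f :=
  Submodule.Quotient.mk_surjective _ f

theorem mk_comp {X Y Z : QuotCat I} (f : X.as ⟶ Y.as) (g : Y.as ⟶ Z.as) :
    mk f ≫ mk g = (mk (f ≫ g) : X ⟶ Z) := rfl

theorem mk_id (X : QuotCat I) : mk (𝟙 X.as) = 𝟙 X := rfl

instance (X Y : QuotCat I) : AddCommGroup (X ⟶ Y) :=
  inferInstanceAs (AddCommGroup ((X.as ⟶ Y.as) ⧸ I.carrier X.as Y.as))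

instance (X Y : QuotCat I) : Module k (X ⟶ Y) :=
  inferInstanceAs (Module k ((X.as ⟶ Y.as) ⧸ I.carrier X.as Y.as))

theorem mk_add {X Y : QuotCat I} (f g : X.as ⟶ Y.as) : (mk f + mk g : X ⟶ Y) = mk (f + g) := rfl

theorem mk_smul {X Y : QuotCat I} (r : k) (f : X.as ⟶ Y.as) : (r • mk f : X ⟶ Y) = mk (r • f) := rfl

theorem mk_zero {X Y : QuotCat I} : (0 : X ⟶ Y) = mk 0 := rfl

instance : Preadditive (QuotCat I) where
  add_comp _ _ _ f f' g := by
    obtain ⟨f, rfl⟩ := mk_surjective f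
    obtain ⟨f', rfl⟩ := mk_surjective f'
    obtain ⟨g, rfl⟩ := mk_surjective g
    simp only [mk_add, mk_comp, Preadditive.add_comp]
  comp_add _ _ _ f g g' := by
    obtain ⟨f, rfl⟩ := mk_surjective f
    obtain ⟨g, rfl⟩ := mk_surjective g
    obtain ⟨g', rfl⟩ := mk_surjective g'
    simp only [mk_add, mk_comp, Preadditive.comp_add]

instance : Linear k (QuotCat I) where
  smul_comp _ _ _ r f g := by
    obtain ⟨f, rfl⟩ := mk_surjective f
    obtain ⟨g, rfl⟩ := mk_surjective g
    simp only [mk_smul, mk_comp, Linear.smul_comp]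
  comp_smul _ _ _ f r g := by
    obtain ⟨f, rfl⟩ := mk_surjective f
    obtain ⟨g, rfl⟩ := mk_surjective g
    simp only [mk_smul, mk_comp, Linear.comp_smul]

/-- An isomorphism as an isomorphism of the quotient. -/
def mkIso {X Y : QuotCat I} (f : X.as ≅ Y.as) : X ≅ Y where
  hom := mk f.hom
  inv := mk f.inv
  hom_inv_id := by rw [mk_comp, f.hom_inv_id, mk_id]
  inv_hom_id := by rw [mk_comp, f.inv_hom_id, mk_id]

variable (I) in
/-- The quotient functor. -/
def functor : C ⥤ QuotCat I where
  obj X := ⟨X⟩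
  map f := mk f
  map_id _ := rfl
  map_comp _ _ := rfl

instance : (functor I).Additive where
  map_add := rfl

variable [MonoidalPreadditive C]

/-- Tensor product of morphisms in the quotient. -/
def tensor {X Y Z W : C} (f : (X ⟶ Y) ⧸ I.carrier X Y) (g : (Z ⟶ W) ⧸ I.carrier Z W) :
    (X ⊗ Z ⟶ Y ⊗ W) ⧸ I.carrier (X ⊗ Z) (Y ⊗ W) :=
  Quotient.liftOn₂' f g (fun f g => Submodule.Quotient.mk (f ⊗ₘ g)) fun f g f' g' hf hg => by
    rw [Submodule.quotientRel_def] at hf hg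
    rw [Submodule.Quotient.eq]
    have : (f ⊗ₘ g) - (f' ⊗ₘ g') = ((f - f') ⊗ₘ g) + (f' ⊗ₘ (g - g')) := by
      have h₁ := MonoidalPreadditive.add_tensor (f - f') f' g
      have h₂ := MonoidalPreadditive.tensor_add f' (g - g') g'
      rw [sub_add_cancel] at h₁ h₂
      rw [h₁, h₂, ← add_assoc, add_sub_cancel_right]
    exact this ▸ add_mem (I.mem_tensor hf g) (I.tensor_mem f' hg)

instance : MonoidalCategoryStruct (QuotCat I) where
  tensorObj X Y := ⟨X.as ⊗ Y.as⟩
  tensorUnit := ⟨𝟙_ C⟩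
  tensorHom f g := tensor f g
  whiskerLeft X _ _ g := tensor (mk (𝟙 X.as) : X ⟶ X) g
  whiskerRight f X := tensor f (mk (𝟙 X.as) : X ⟶ X)
  associator X Y Z := mkIso (α_ X.as Y.as Z.as)
  leftUnitor X := mkIso (λ_ X.as)
  rightUnitor X := mkIso (ρ_ X.as)

theorem mk_tensor {X Y Z W : QuotCat I} (f : X.as ⟶ Y.as) (g : Z.as ⟶ W.as) :
    (mk f : X ⟶ Y) ⊗ₘ (mk g : Z ⟶ W) = (mk (f ⊗ₘ g) : X ⊗ Z ⟶ Y ⊗ W) := rfl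

theorem associator_hom (X Y Z : QuotCat I) : (α_ X Y Z).hom = mk (α_ X.as Y.as Z.as).hom := rfl
theorem leftUnitor_hom (X : QuotCat I) : (λ_ X).hom = mk (λ_ X.as).hom := rfl
theorem rightUnitor_hom (X : QuotCat I) : (ρ_ X).hom = mk (ρ_ X.as).hom := rfl
theorem tensor_as (X Y : QuotCat I) : (X ⊗ Y).as = X.as ⊗ Y.as := rfl
theorem unit_as : (𝟙_ (QuotCat I)).as = 𝟙_ C := rfl

instance : MonoidalCategory (QuotCat I) :=
  .ofTensorHom
    (id_tensorHom_id := fun X Y => by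
      rw [← mk_id, ← mk_id, mk_tensor, id_tensorHom_id]; rfl)
    (id_tensorHom := fun _ _ _ _ => rfl)
    (tensorHom_id := fun _ _ => rfl)
    (tensorHom_comp_tensorHom := fun f₁ f₂ g₁ g₂ => by
      obtain ⟨f₁, rfl⟩ := mk_surjective f₁
      obtain ⟨f₂, rfl⟩ := mk_surjective f₂
      obtain ⟨g₁, rfl⟩ := mk_surjective g₁
      obtain ⟨g₂, rfl⟩ := mk_surjective g₂
      simp only [mk_tensor, mk_comp, tensor_as, tensorHom_comp_tensorHom])
    (associator_naturality := fun f₁ f₂ f₃ => by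
      obtain ⟨f₁, rfl⟩ := mk_surjective f₁
      obtain ⟨f₂, rfl⟩ := mk_surjective f₂
      obtain ⟨f₃, rfl⟩ := mk_surjective f₃
      simp only [mk_tensor, mk_comp, tensor_as, associator_hom, associator_naturality])
    (leftUnitor_naturality := fun f => by
      obtain ⟨f, rfl⟩ := mk_surjective f
      simp only [← mk_id, mk_tensor, mk_comp, tensor_as, unit_as, leftUnitor_hom, id_tensorHom,
        leftUnitor_naturality])
    (rightUnitor_naturality := fun f => by
      obtain ⟨f, rfl⟩ := mk_surjective f
      simp only [← mk_id, mk_tensor, mk_comp, tensor_as, unit_as, rightUnitor_hom, tensorHom_id,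
        rightUnitor_naturality])
    (pentagon := fun W X Y Z => by
      simp only [associator_hom, ← mk_id, mk_tensor, mk_comp, tensor_as, id_tensorHom,
        tensorHom_id, pentagon])
    (triangle := fun X Y => by
      simp only [associator_hom, leftUnitor_hom, rightUnitor_hom, ← mk_id, mk_tensor, mk_comp,
        tensor_as, unit_as, id_tensorHom, tensorHom_id, triangle])

theorem whiskerLeft_mk (X : QuotCat I) {Y Z : QuotCat I} (f : Y.as ⟶ Z.as) :
    X ◁ (mk f : Y ⟶ Z) = (mk (X.as ◁ f) : X ⊗ Y ⟶ X ⊗ Z) := by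
  rw [← id_tensorHom, ← id_tensorHom, ← mk_id, mk_tensor]

theorem mk_whiskerRight {Y Z : QuotCat I} (f : Y.as ⟶ Z.as) (X : QuotCat I) :
    (mk f : Y ⟶ Z) ▷ X = (mk (f ▷ X.as) : Y ⊗ X ⟶ Z ⊗ X) := by
  rw [← tensorHom_id, ← tensorHom_id, ← mk_id, mk_tensor]

instance : MonoidalPreadditive (QuotCat I) where
  whiskerLeft_zero := by
    intros; simp only [mk_zero, whiskerLeft_mk, MonoidalPreadditive.whiskerLeft_zero]
  zero_whiskerRight := by
    intros; simp only [mk_zero, mk_whiskerRight, MonoidalPreadditive.zero_whiskerRight]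
  whiskerLeft_add f g := by
    obtain ⟨f, rfl⟩ := mk_surjective f
    obtain ⟨g, rfl⟩ := mk_surjective g
    simp only [mk_add, whiskerLeft_mk, MonoidalPreadditive.whiskerLeft_add, tensor_as]
  add_whiskerRight f g := by
    obtain ⟨f, rfl⟩ := mk_surjective f
    obtain ⟨g, rfl⟩ := mk_surjective g
    simp only [mk_add, mk_whiskerRight, MonoidalPreadditive.add_whiskerRight, tensor_as]

instance [MonoidalLinear k C] : MonoidalLinear k (QuotCat I) where
  whiskerLeft_smul _ _ _ r f := by
    obtain ⟨f, rfl⟩ := mk_surjective f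
    simp only [mk_smul, whiskerLeft_mk, MonoidalLinear.whiskerLeft_smul, tensor_as]
  smul_whiskerRight r _ _ f _ := by
    obtain ⟨f, rfl⟩ := mk_surjective f
    simp only [mk_smul, mk_whiskerRight, MonoidalLinear.smul_whiskerRight, tensor_as]

instance [SymmetricCategory C] : SymmetricCategory (QuotCat I) :=
  symmetricOfHexagon (fun X Y => mk (β_ X.as Y.as).hom)
    (natural := fun f g => by
      obtain ⟨f, rfl⟩ := mk_surjective f
      obtain ⟨g, rfl⟩ := mk_surjective g
      simp only [mk_tensor, mk_comp, tensor_as, BraidedCategory.braiding_naturality])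
    (hexagon := fun X Y Z => by
      simp only [associator_hom, ← mk_id, mk_tensor, mk_comp, tensor_as,
        id_tensorHom, tensorHom_id, BraidedCategory.hexagon_forward])
    (symm := fun X Y => by
      simp only [mk_comp, tensor_as, SymmetricCategory.symmetry, ← mk_id])

instance : (functor I).Monoidal :=
  Functor.CoreMonoidal.toMonoidal
    { εIso := Iso.refl _
      μIso := fun X Y => Iso.refl _
      μIso_hom_natural_left := fun {X Y} f Z =>
        (Category.comp_id _).trans ((mk_whiskerRight (I := I) (Y := ⟨X⟩) (Z := ⟨Y⟩) f ⟨Z⟩).trans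
          (Category.id_comp _).symm)
      μIso_hom_natural_right := fun {X Y} Z f =>
        (Category.comp_id _).trans ((whiskerLeft_mk (I := I) ⟨Z⟩ (Y := ⟨X⟩) (Z := ⟨Y⟩) f).trans
          (Category.id_comp _).symm)
      associativity := fun X Y Z => by
        change (𝟙 ((⟨X⟩ : QuotCat I) ⊗ ⟨Y⟩) ▷ ⟨Z⟩) ≫ 𝟙 _ ≫ (α_ (⟨X⟩ : QuotCat I) ⟨Y⟩ ⟨Z⟩).hom =
          (α_ (⟨X⟩ : QuotCat I) ⟨Y⟩ ⟨Z⟩).hom ≫ (⟨X⟩ ◁ 𝟙 ((⟨Y⟩ : QuotCat I) ⊗ ⟨Z⟩)) ≫ 𝟙 _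
        simp
      left_unitality := fun X => by
        change (λ_ (⟨X⟩ : QuotCat I)).hom = (𝟙 (𝟙_ (QuotCat I)) ▷ ⟨X⟩) ≫ 𝟙 _ ≫ (λ_ (⟨X⟩ : QuotCat I)).hom
        simp
      right_unitality := fun X => by
        change (ρ_ (⟨X⟩ : QuotCat I)).hom = (⟨X⟩ ◁ 𝟙 (𝟙_ (QuotCat I))) ≫ 𝟙 _ ≫ (ρ_ (⟨X⟩ : QuotCat I)).hom
        simp }

end QuotCat

end TensorIdeal
/-! ### Tensor product of linear categories -/

/-- The tensor product `C ⊗ₖ D` of two `k`-linear categories: objects are pairs of objects,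
and morphism spaces are tensor products of morphism spaces. -/
structure LinProd (k : Type w) (C : Type u) (D : Type u') where
  fst : C
  snd : D

namespace LinProd

open scoped TensorProduct

variable {k : Type w} [CommRing k] {C : Type u} [Category.{v} C] [Preadditive C] [Linear k C]
  {D : Type u'} [Category.{v'} D] [Preadditive D] [Linear k D]

/-- Componentwise composition. -/
def compHom (X Y Z : LinProd k C D) :
    ((X.fst ⟶ Y.fst) ⊗[k] (X.snd ⟶ Y.snd)) →ₗ[k] ((Y.fst ⟶ Z.fst) ⊗[k] (Y.snd ⟶ Z.snd)) →ₗ[k]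
      ((X.fst ⟶ Z.fst) ⊗[k] (X.snd ⟶ Z.snd)) :=
  TensorProduct.map₂ (Linear.comp X.fst Y.fst Z.fst) (Linear.comp X.snd Y.snd Z.snd)

theorem compHom_tmul {X Y Z : LinProd k C D} (f : X.fst ⟶ Y.fst) (g : X.snd ⟶ Y.snd)
    (f' : Y.fst ⟶ Z.fst) (g' : Y.snd ⟶ Z.snd) :
    compHom X Y Z (f ⊗ₜ g) (f' ⊗ₜ g') = (f ≫ f') ⊗ₜ[k] (g ≫ g') := rfl

instance : Category (LinProd k C D) where
  Hom X Y := (X.fst ⟶ Y.fst) ⊗[k] (X.snd ⟶ Y.snd)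
  id X := 𝟙 X.fst ⊗ₜ[k] 𝟙 X.snd
  comp {X Y Z} f g := compHom X Y Z f g
  id_comp f := by
    induction f using TensorProduct.induction_on with
    | zero => rw [map_zero]
    | add f g hf hg => rw [map_add, hf, hg]
    | tmul f g => rw [compHom_tmul, Category.id_comp, Category.id_comp]
  comp_id f := by
    induction f using TensorProduct.induction_on with
    | zero => rw [LinearMap.map_zero₂]
    | add f g hf hg => rw [LinearMap.map_add₂, hf, hg]
    | tmul f g => rw [compHom_tmul, Category.comp_id, Category.comp_id]
  assoc f g h := by
    induction f using TensorProduct.induction_on with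
    | zero => simp only [LinearMap.map_zero₂]
    | add f g hf hg => simp only [LinearMap.map_add₂, hf, hg]
    | tmul f₁ f₂ =>
    induction g using TensorProduct.induction_on with
    | zero => simp only [map_zero, LinearMap.zero_apply]
    | add f g hf hg => simp only [map_add, LinearMap.add_apply, hf, hg]
    | tmul g₁ g₂ =>
    induction h using TensorProduct.induction_on with
    | zero => simp only [map_zero]
    | add f g hf hg => simp only [map_add, hf, hg]
    | tmul h₁ h₂ => simp only [compHom_tmul, Category.assoc]

instance : Preadditive (LinProd k C D) where
  homGroup X Y := inferInstanceAs (AddCommGroup ((X.fst ⟶ Y.fst) ⊗[k] (X.snd ⟶ Y.snd)))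
  add_comp X Y Z f f' g := (compHom X Y Z).map_add₂ f f' g
  comp_add X Y Z f g g' := (compHom X Y Z f).map_add g g'

instance : Linear k (LinProd k C D) where
  homModule X Y := inferInstanceAs (Module k ((X.fst ⟶ Y.fst) ⊗[k] (X.snd ⟶ Y.snd)))
  smul_comp X Y Z r f g := (compHom X Y Z).map_smul₂ r f g
  comp_smul X Y Z f r g := (compHom X Y Z f).map_smul r g

/-- The morphism `f ⊠ g`. -/
def box {X Y : LinProd k C D} (f : X.fst ⟶ Y.fst) (g : X.snd ⟶ Y.snd) : X ⟶ Y := f ⊗ₜ[k] g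

theorem box_comp {X Y Z : LinProd k C D} (f : X.fst ⟶ Y.fst) (g : X.snd ⟶ Y.snd)
    (f' : Y.fst ⟶ Z.fst) (g' : Y.snd ⟶ Z.snd) :
    (box f g : X ⟶ Y) ≫ (box f' g' : Y ⟶ Z) = (box (f ≫ f') (g ≫ g') : X ⟶ Z) := rfl

theorem box_id (X : LinProd k C D) : box (𝟙 X.fst) (𝟙 X.snd) = 𝟙 X := rfl

theorem hom_induction {X Y : LinProd k C D} {P : (X ⟶ Y) → Prop} (f : X ⟶ Y)
    (zero : P 0) (add : ∀ f g, P f → P g → P (f + g))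
    (box : ∀ (f : X.fst ⟶ Y.fst) (g : X.snd ⟶ Y.snd), P (box f g)) : P f :=
  TensorProduct.induction_on f zero box add

/-- The isomorphism `f ⊠ g`. -/
def boxIso {X Y : LinProd k C D} (f : X.fst ≅ Y.fst) (g : X.snd ≅ Y.snd) : X ≅ Y where
  hom := box f.hom g.hom
  inv := box f.inv g.inv
  hom_inv_id := by rw [box_comp, f.hom_inv_id, g.hom_inv_id, box_id]
  inv_hom_id := by rw [box_comp, f.inv_hom_id, g.inv_hom_id, box_id]

variable [MonoidalCategory C] [MonoidalPreadditive C] [MonoidalLinear k C]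
  [MonoidalCategory D] [MonoidalPreadditive D] [MonoidalLinear k D]

/-- The tensor product of morphisms, as a bilinear map. -/
def tensorBilin {E : Type u} [Category.{v} E] [Preadditive E] [Linear k E] [MonoidalCategory E]
    [MonoidalPreadditive E] [MonoidalLinear k E] (X Y X' Y' : E) :
    (X ⟶ Y) →ₗ[k] (X' ⟶ Y') →ₗ[k] (X ⊗ X' ⟶ Y ⊗ Y') :=
  LinearMap.mk₂ k (fun f g => f ⊗ₘ g)
    (fun f f' g => MonoidalPreadditive.add_tensor f f' g)
    (fun r f g => by simp only [MonoidalCategory.tensorHom_def, MonoidalLinear.smul_whiskerRight, Linear.smul_comp])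
    (fun f g g' => MonoidalPreadditive.tensor_add f g g')
    (fun r f g => by simp only [MonoidalCategory.tensorHom_def, MonoidalLinear.whiskerLeft_smul, Linear.comp_smul])

/-- Componentwise tensor product of morphisms, as a bilinear map. -/
def tensorBox (X Y X' Y' : LinProd k C D) :
    ((X.fst ⟶ Y.fst) ⊗[k] (X.snd ⟶ Y.snd)) →ₗ[k] ((X'.fst ⟶ Y'.fst) ⊗[k] (X'.snd ⟶ Y'.snd)) →ₗ[k]
      ((X.fst ⊗ X'.fst ⟶ Y.fst ⊗ Y'.fst) ⊗[k] (X.snd ⊗ X'.snd ⟶ Y.snd ⊗ Y'.snd)) :=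
  TensorProduct.map₂ (tensorBilin X.fst Y.fst X'.fst Y'.fst) (tensorBilin X.snd Y.snd X'.snd Y'.snd)

instance : MonoidalCategoryStruct (LinProd k C D) where
  tensorObj X Y := ⟨X.fst ⊗ Y.fst, X.snd ⊗ Y.snd⟩
  tensorUnit := ⟨𝟙_ C, 𝟙_ D⟩
  tensorHom {X Y X' Y'} f g := tensorBox X Y X' Y' f g
  whiskerLeft X X' Y' g := tensorBox X X X' Y' (𝟙 X) g
  whiskerRight {X Y} f X' := tensorBox X Y X' X' f (𝟙 X')
  associator X Y Z := boxIso (α_ X.fst Y.fst Z.fst) (α_ X.snd Y.snd Z.snd)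
  leftUnitor X := boxIso (λ_ X.fst) (λ_ X.snd)
  rightUnitor X := boxIso (ρ_ X.fst) (ρ_ X.snd)

theorem add_tensor {X Y X' Y' : LinProd k C D} (f f' : X ⟶ Y) (g : X' ⟶ Y') :
    (f + f') ⊗ₘ g = (f ⊗ₘ g) + (f' ⊗ₘ g) := (tensorBox X Y X' Y').map_add₂ f f' g

theorem tensor_add {X Y X' Y' : LinProd k C D} (f : X ⟶ Y) (g g' : X' ⟶ Y') :
    f ⊗ₘ (g + g') = (f ⊗ₘ g) + (f ⊗ₘ g') := (tensorBox X Y X' Y' f).map_add g g'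

theorem smul_tensor {X Y X' Y' : LinProd k C D} (r : k) (f : X ⟶ Y) (g : X' ⟶ Y') :
    (r • f) ⊗ₘ g = r • (f ⊗ₘ g) := (tensorBox X Y X' Y').map_smul₂ r f g

theorem tensor_smul {X Y X' Y' : LinProd k C D} (r : k) (f : X ⟶ Y) (g : X' ⟶ Y') :
    f ⊗ₘ (r • g) = r • (f ⊗ₘ g) := (tensorBox X Y X' Y' f).map_smul r g

theorem zero_tensor {X Y X' Y' : LinProd k C D} (g : X' ⟶ Y') :
    (0 : X ⟶ Y) ⊗ₘ g = 0 := (tensorBox X Y X' Y').map_zero₂ g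

theorem tensor_zero {X Y X' Y' : LinProd k C D} (f : X ⟶ Y) :
    f ⊗ₘ (0 : X' ⟶ Y') = 0 := (tensorBox X Y X' Y' f).map_zero

theorem box_tensor {X Y X' Y' : LinProd k C D} (f : X.fst ⟶ Y.fst) (g : X.snd ⟶ Y.snd)
    (f' : X'.fst ⟶ Y'.fst) (g' : X'.snd ⟶ Y'.snd) :
    (box f g : X ⟶ Y) ⊗ₘ (box f' g' : X' ⟶ Y') =
      (box (f ⊗ₘ f') (g ⊗ₘ g') : X ⊗ X' ⟶ Y ⊗ Y') := rfl

theorem associator_hom (X Y Z : LinProd k C D) :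
    (α_ X Y Z).hom = box (α_ X.fst Y.fst Z.fst).hom (α_ X.snd Y.snd Z.snd).hom := rfl
theorem leftUnitor_hom (X : LinProd k C D) : (λ_ X).hom = box (λ_ X.fst).hom (λ_ X.snd).hom := rfl
theorem rightUnitor_hom (X : LinProd k C D) : (ρ_ X).hom = box (ρ_ X.fst).hom (ρ_ X.snd).hom := rfl
theorem tensor_fst (X Y : LinProd k C D) : (X ⊗ Y).fst = X.fst ⊗ Y.fst := rfl
theorem tensor_snd (X Y : LinProd k C D) : (X ⊗ Y).snd = X.snd ⊗ Y.snd := rfl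
theorem unit_fst : (𝟙_ (LinProd k C D)).fst = 𝟙_ C := rfl
theorem unit_snd : (𝟙_ (LinProd k C D)).snd = 𝟙_ D := rfl

instance : MonoidalCategory (LinProd k C D) :=
  .ofTensorHom
    (id_tensorHom_id := fun X Y => by
      rw [← box_id, ← box_id, box_tensor, id_tensorHom_id, id_tensorHom_id]; rfl)
    (id_tensorHom := fun _ _ _ _ => rfl)
    (tensorHom_id := fun _ _ => rfl)
    (tensorHom_comp_tensorHom := fun f₁ f₂ g₁ g₂ => by
      induction f₁ using hom_induction with
      | zero => simp only [zero_tensor, Limits.zero_comp]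
      | add a b ha hb => simp only [add_tensor, Preadditive.add_comp, ha, hb]
      | box a a' =>
      induction f₂ using hom_induction with
      | zero => simp only [tensor_zero, Limits.zero_comp]
      | add a b ha hb => simp only [tensor_add, Preadditive.add_comp, ha, hb]
      | box b b' =>
      induction g₁ using hom_induction with
      | zero => simp only [zero_tensor, Limits.comp_zero]
      | add a b ha hb => simp only [add_tensor, Preadditive.comp_add, ha, hb]
      | box c c' =>
      induction g₂ using hom_induction with
      | zero => simp only [tensor_zero, Limits.comp_zero]
      | add a b ha hb => simp only [tensor_add, Preadditive.comp_add, ha, hb]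
      | box d d' =>
      simp only [box_tensor, box_comp, tensor_fst, tensor_snd, tensorHom_comp_tensorHom])
    (associator_naturality := fun f₁ f₂ f₃ => by
      induction f₁ using hom_induction with
      | zero => simp only [zero_tensor, Limits.comp_zero, Limits.zero_comp]
      | add a b ha hb => simp only [add_tensor, Preadditive.add_comp, Preadditive.comp_add, ha, hb]
      | box a a' =>
      induction f₂ using hom_induction with
      | zero => simp only [tensor_zero, zero_tensor, Limits.comp_zero, Limits.zero_comp]
      | add a b ha hb =>
        simp only [tensor_add, add_tensor, Preadditive.add_comp, Preadditive.comp_add, ha, hb]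
      | box b b' =>
      induction f₃ using hom_induction with
      | zero => simp only [tensor_zero, Limits.comp_zero, Limits.zero_comp]
      | add a b ha hb => simp only [tensor_add, Preadditive.add_comp, Preadditive.comp_add, ha, hb]
      | box c c' =>
      simp only [box_tensor, associator_hom, box_comp, tensor_fst, tensor_snd,
        associator_naturality])
    (leftUnitor_naturality := fun {X Y} f => by
      induction f using hom_induction with
      | zero => simp only [tensor_zero, Limits.comp_zero, Limits.zero_comp]
      | add a b ha hb => simp only [tensor_add, Preadditive.add_comp, Preadditive.comp_add, ha, hb]
      | box a a' =>
      simp only [← box_id, box_tensor, leftUnitor_hom, box_comp, tensor_fst, tensor_snd, unit_fst,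
        unit_snd, id_tensorHom, leftUnitor_naturality])
    (rightUnitor_naturality := fun {X Y} f => by
      induction f using hom_induction with
      | zero => simp only [zero_tensor, Limits.comp_zero, Limits.zero_comp]
      | add a b ha hb => simp only [add_tensor, Preadditive.add_comp, Preadditive.comp_add, ha, hb]
      | box a a' =>
      simp only [← box_id, box_tensor, rightUnitor_hom, box_comp, tensor_fst, tensor_snd, unit_fst,
        unit_snd, tensorHom_id, rightUnitor_naturality])
    (pentagon := fun W X Y Z => by
      simp only [associator_hom, ← box_id, box_tensor, box_comp, tensor_fst, tensor_snd,
        id_tensorHom, tensorHom_id, pentagon])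
    (triangle := fun X Y => by
      simp only [associator_hom, leftUnitor_hom, rightUnitor_hom, ← box_id, box_tensor, box_comp,
        tensor_fst, tensor_snd, unit_fst, unit_snd, id_tensorHom, tensorHom_id, triangle])

instance : MonoidalPreadditive (LinProd k C D) where
  whiskerLeft_zero := tensor_zero _
  zero_whiskerRight := zero_tensor _
  whiskerLeft_add := tensor_add _
  add_whiskerRight f g := add_tensor f g _

instance : MonoidalLinear k (LinProd k C D) where
  whiskerLeft_smul _ _ _ r f := tensor_smul r _ f
  smul_whiskerRight r _ _ f _ := smul_tensor r f _

instance [SymmetricCategory C] [SymmetricCategory D] : SymmetricCategory (LinProd k C D) :=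
  symmetricOfHexagon (fun X Y => box (β_ X.fst Y.fst).hom (β_ X.snd Y.snd).hom)
    (natural := fun f g => by
      induction f using hom_induction with
      | zero => simp only [zero_tensor, tensor_zero, Limits.comp_zero, Limits.zero_comp]
      | add a b ha hb =>
        simp only [tensor_add, add_tensor, Preadditive.add_comp, Preadditive.comp_add, ha, hb]
      | box a a' =>
      induction g using hom_induction with
      | zero => simp only [zero_tensor, tensor_zero, Limits.comp_zero, Limits.zero_comp]
      | add a b ha hb =>
        simp only [tensor_add, add_tensor, Preadditive.add_comp, Preadditive.comp_add, ha, hb]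
      | box b b' =>
      simp only [box_tensor, box_comp, tensor_fst, tensor_snd,
        BraidedCategory.braiding_naturality])
    (hexagon := fun X Y Z => by
      simp only [associator_hom, ← box_id, box_tensor, box_comp, tensor_fst, tensor_snd,
        id_tensorHom, tensorHom_id, BraidedCategory.hexagon_forward])
    (symm := fun X Y => by
      simp only [box_comp, tensor_fst, tensor_snd, SymmetricCategory.symmetry, ← box_id])

end LinProd

/-! ### The additive envelope as a linear symmetric monoidal category -/

namespace CategoryTheory.Mat_

variable {C : Type u} [Category.{v} C] [Preadditive C]

section Linear

variable {k : Type w} [CommRing k] [Linear k C]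

instance (M N : Mat_ C) : Module k (M ⟶ N) :=
  inferInstanceAs (Module k (∀ (i : M.ι) (j : N.ι), M.X i ⟶ N.X j))

theorem smul_apply {M N : Mat_ C} (r : k) (f : M ⟶ N) (i : M.ι) (j : N.ι) :
    (r • f) i j = r • f i j := rfl

instance : Linear k (Mat_ C) where
  smul_comp M N K r f g := by
    ext i j
    simp only [comp_apply, smul_apply, Linear.smul_comp, Finset.smul_sum]
  comp_smul M N K f r g := by
    ext i j
    simp only [comp_apply, smul_apply, Linear.comp_smul, Finset.smul_sum]

end Linear

open scoped Classical in
/-- The matrix whose only nonzero entries are `φ i` at the places `(i, e i)`. -/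
def diag {M N : Mat_ C} (e : M.ι → N.ι) (φ : ∀ i, M.X i ⟶ N.X (e i)) : M ⟶ N :=
  fun i j => if h : e i = j then φ i ≫ eqToHom (congrArg N.X h) else 0

theorem diag_apply_self {M N : Mat_ C} (e : M.ι → N.ι) (φ : ∀ i, M.X i ⟶ N.X (e i)) (i : M.ι) :
    diag e φ i (e i) = φ i := by
  simp [diag]

theorem diag_apply_of_ne {M N : Mat_ C} (e : M.ι → N.ι) (φ : ∀ i, M.X i ⟶ N.X (e i)) {i : M.ι}
    {j : N.ι} (h : e i ≠ j) : diag e φ i j = 0 := by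
  simp [diag, h]

theorem id_eq_diag (M : Mat_ C) : 𝟙 M = diag id fun i => 𝟙 (M.X i) := by
  ext i j
  by_cases h : i = j
  · subst h
    exact (id_apply_self M i).trans (diag_apply_self (M := M) (N := M) id (fun i => 𝟙 (M.X i)) i).symm
  · exact (id_apply_of_ne M i j h).trans (diag_apply_of_ne (M := M) (N := M) id _ h).symm

theorem diag_comp_apply {M N K : Mat_ C} (e : M.ι → N.ι) (φ : ∀ i, M.X i ⟶ N.X (e i)) (g : N ⟶ K)
    (i : M.ι) (j : K.ι) : (diag e φ ≫ g) i j = φ i ≫ g (e i) j := by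
  rw [comp_apply, Finset.sum_eq_single (e i), diag_apply_self]
  · intro b _ hb
    rw [diag_apply_of_ne _ _ hb.symm, Limits.zero_comp]
  · intro h; exact absurd (Finset.mem_univ _) h

theorem comp_diag_apply {M N K : Mat_ C} (f : M ⟶ N) (e : N.ι → K.ι) (he : Function.Injective e)
    (φ : ∀ i, N.X i ⟶ K.X (e i)) (i : M.ι) (j : N.ι) :
    (f ≫ diag e φ) i (e j) = f i j ≫ φ j := by
  rw [comp_apply, Finset.sum_eq_single j, diag_apply_self]
  · intro b _ hb
    rw [diag_apply_of_ne _ _ (fun h => hb (he h)), Limits.comp_zero]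
  · intro h; exact absurd (Finset.mem_univ _) h

theorem diag_comp_diag {M N K : Mat_ C} (e : M.ι → N.ι) (φ : ∀ i, M.X i ⟶ N.X (e i))
    (e' : N.ι → K.ι) (φ' : ∀ i, N.X i ⟶ K.X (e' i)) :
    diag e φ ≫ diag e' φ' = diag (fun i => e' (e i)) fun i => φ i ≫ φ' (e i) := by
  ext i j
  rw [diag_comp_apply]
  by_cases h : e' (e i) = j
  · subst h
    rw [diag_apply_self]
    exact (diag_apply_self (M := M) (N := K) (fun i => e' (e i)) (fun i => φ i ≫ φ' (e i)) i).symm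
  · rw [diag_apply_of_ne _ _ h, Limits.comp_zero]
    exact (diag_apply_of_ne (M := M) (N := K) (fun i => e' (e i)) _ h).symm

theorem diag_eq_id {M : Mat_ C} (φ : ∀ i, M.X i ⟶ M.X i) (h : ∀ i, φ i = 𝟙 _) :
    diag (M := M) (N := M) (fun i => i) φ = 𝟙 M := by
  rw [id_eq_diag]
  exact congrArg (diag (M := M) (N := M) _) (funext h)

theorem diag_congr {M N : Mat_ C} (e : M.ι → N.ι) {φ ψ : ∀ i, M.X i ⟶ N.X (e i)}
    (h : ∀ i, φ i = ψ i) : diag e φ = diag e ψ :=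
  congrArg (diag e) (funext h)

/-- A square with two parallel diagonal sides commutes if it does so entrywise. -/
theorem comp_diag_eq {M N K L : Mat_ C} (f : M ⟶ N) (e : N.ι → L.ι) (φ : ∀ i, N.X i ⟶ L.X (e i))
    (he : Function.Bijective e) (e' : M.ι → K.ι) (φ' : ∀ i, M.X i ⟶ K.X (e' i)) (g : K ⟶ L)
    (h : ∀ i j, f i j ≫ φ j = φ' i ≫ g (e' i) (e j)) : f ≫ diag e φ = diag e' φ' ≫ g := by
  ext i j
  obtain ⟨j, rfl⟩ := he.2 j
  rw [comp_diag_apply f e he.1 φ, diag_comp_apply, h]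

/-- A one-by-one matrix is diagonal. -/
theorem embedding_map_eq_diag {X Y : C} (f : X ⟶ Y) :
    (embedding C).map f =
      diag (M := (embedding C).obj X) (N := (embedding C).obj Y) (fun i => i) fun _ => f :=
  hom_ext (M := (embedding C).obj X) (N := (embedding C).obj Y) _ _ fun i _ =>
    (diag_apply_self (M := (embedding C).obj X) (N := (embedding C).obj Y) (fun i => i)
      (fun _ => f) i).symm

variable [MonoidalCategory C]

/-- The tensor product of objects: all the tensor products of the summands. -/
def tensor (M N : Mat_ C) : Mat_ C := ⟨M.ι × N.ι, fun p => M.X p.1 ⊗ N.X p.2⟩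

/-- The unit object, as an object of the additive envelope. -/
def unit : Mat_ C := ⟨PUnit, fun _ => 𝟙_ C⟩

instance : MonoidalCategoryStruct (Mat_ C) where
  tensorObj M N := tensor M N
  tensorUnit := unit
  tensorHom f g := fun p q => f p.1 q.1 ⊗ₘ g p.2 q.2
  whiskerLeft M _ _ g := fun p q => (𝟙 M : M ⟶ M) p.1 q.1 ⊗ₘ g p.2 q.2
  whiskerRight f M := fun p q => f p.1 q.1 ⊗ₘ (𝟙 M : M ⟶ M) p.2 q.2
  associator M N K :=
    { hom := diag (M := tensor (tensor M N) K) (N := tensor M (tensor N K))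
        (fun p => (p.1.1, (p.1.2, p.2))) fun p => (α_ (M.X p.1.1) (N.X p.1.2) (K.X p.2)).hom
      inv := diag (M := tensor M (tensor N K)) (N := tensor (tensor M N) K)
        (fun p => ((p.1, p.2.1), p.2.2)) fun p => (α_ (M.X p.1) (N.X p.2.1) (K.X p.2.2)).inv
      hom_inv_id := (diag_comp_diag _ _ _ _).trans (diag_eq_id _ fun _ => Iso.hom_inv_id _)
      inv_hom_id := (diag_comp_diag _ _ _ _).trans (diag_eq_id _ fun _ => Iso.inv_hom_id _) }
  leftUnitor M :=
    { hom := diag (M := tensor unit M) (N := M) (fun p => p.2) fun p => (λ_ (M.X p.2)).hom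
      inv := diag (M := M) (N := tensor unit M) (fun p => (⟨⟩, p)) fun p => (λ_ (M.X p)).inv
      hom_inv_id := (diag_comp_diag _ _ _ _).trans (diag_eq_id _ fun _ => Iso.hom_inv_id _)
      inv_hom_id := (diag_comp_diag _ _ _ _).trans (diag_eq_id _ fun _ => Iso.inv_hom_id _) }
  rightUnitor M :=
    { hom := diag (M := tensor M unit) (N := M) (fun p => p.1) fun p => (ρ_ (M.X p.1)).hom
      inv := diag (M := M) (N := tensor M unit) (fun p => (p, ⟨⟩)) fun p => (ρ_ (M.X p)).inv
      hom_inv_id := (diag_comp_diag _ _ _ _).trans (diag_eq_id _ fun _ => Iso.hom_inv_id _)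
      inv_hom_id := (diag_comp_diag _ _ _ _).trans (diag_eq_id _ fun _ => Iso.inv_hom_id _) }

theorem tensorHom_apply {M N M' N' : Mat_ C} (f : M ⟶ N) (g : M' ⟶ N') (i : M.ι) (i' : M'.ι)
    (j : N.ι) (j' : N'.ι) :
    (show tensor M M' ⟶ tensor N N' from f ⊗ₘ g) (i, i') (j, j') = f i j ⊗ₘ g i' j' := rfl

theorem associator_hom (M N K : Mat_ C) : (α_ M N K).hom =
    diag (M := tensor (tensor M N) K) (N := tensor M (tensor N K))
      (fun p => (p.1.1, (p.1.2, p.2))) fun p => (α_ (M.X p.1.1) (N.X p.1.2) (K.X p.2)).hom := rfl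

theorem leftUnitor_hom (M : Mat_ C) : (λ_ M).hom =
    diag (M := tensor unit M) (N := M) (fun p => p.2) fun p => (λ_ (M.X p.2)).hom := rfl

theorem rightUnitor_hom (M : Mat_ C) : (ρ_ M).hom =
    diag (M := tensor M unit) (N := M) (fun p => p.1) fun p => (ρ_ (M.X p.1)).hom := rfl

variable [MonoidalPreadditive C]

theorem diag_tensor_diag {M N M' N' : Mat_ C} (e : M.ι → N.ι) (φ : ∀ i, M.X i ⟶ N.X (e i))
    (e' : M'.ι → N'.ι) (φ' : ∀ i, M'.X i ⟶ N'.X (e' i)) :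
    diag e φ ⊗ₘ diag e' φ' = diag (M := tensor M M') (N := tensor N N')
      (fun p => (e p.1, e' p.2)) fun p => φ p.1 ⊗ₘ φ' p.2 := by
  refine hom_ext (M := tensor M M') (N := tensor N N') _ _ ?_
  rintro ⟨i, i'⟩ ⟨j, j'⟩
  refine (tensorHom_apply _ _ _ _ _ _).trans ?_
  by_cases h : e i = j
  · by_cases h' : e' i' = j'
    · subst h h'
      rw [diag_apply_self, diag_apply_self]
      exact (diag_apply_self (M := tensor M M') (N := tensor N N')
        (fun p => (e p.1, e' p.2)) (fun p => φ p.1 ⊗ₘ φ' p.2) (i, i')).symm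
    · rw [diag_apply_of_ne _ _ h', MonoidalAux.tensor_zero]
      exact (diag_apply_of_ne (M := tensor M M') (N := tensor N N')
        (fun p => (e p.1, e' p.2)) (fun p => φ p.1 ⊗ₘ φ' p.2) (i := (i, i')) (j := (j, j'))
        (fun H => h' (Prod.ext_iff.1 H).2)).symm
  · rw [diag_apply_of_ne _ _ h, MonoidalAux.zero_tensor]
    exact (diag_apply_of_ne (M := tensor M M') (N := tensor N N')
        (fun p => (e p.1, e' p.2)) (fun p => φ p.1 ⊗ₘ φ' p.2) (i := (i, i')) (j := (j, j'))
        (fun H => h (Prod.ext_iff.1 H).1)).symm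

instance : MonoidalCategory (Mat_ C) :=
  .ofTensorHom
    (id_tensorHom_id := fun M N => by
      rw [id_eq_diag, id_eq_diag, diag_tensor_diag]
      exact diag_eq_id (M := tensor M N) _ fun p => id_tensorHom_id _ _)
    (id_tensorHom := fun _ _ _ _ => rfl)
    (tensorHom_id := fun _ _ => rfl)
    (tensorHom_comp_tensorHom := fun {M₁ N₁ K₁ M₂ N₂ K₂} f₁ f₂ g₁ g₂ => by
      refine hom_ext (M := tensor M₁ M₂) (N := tensor K₁ K₂) _ _ ?_
      rintro ⟨i, i'⟩ ⟨j, j'⟩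
      change ∑ p : N₁.ι × N₂.ι, (f₁ i p.1 ⊗ₘ f₂ i' p.2) ≫ (g₁ p.1 j ⊗ₘ g₂ p.2 j') =
        (∑ a, f₁ i a ≫ g₁ a j) ⊗ₘ (∑ b, f₂ i' b ≫ g₂ b j')
      simp only [sum_tensor, tensor_sum, tensorHom_comp_tensorHom, Fintype.sum_prod_type]
      exact Finset.sum_comm)
    (associator_naturality := fun {X₁ X₂ X₃ Y₁ Y₂ Y₃} f₁ f₂ f₃ => by
      refine comp_diag_eq (M := tensor (tensor X₁ X₂) X₃) (N := tensor (tensor Y₁ Y₂) Y₃)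
        (K := tensor X₁ (tensor X₂ X₃)) (L := tensor Y₁ (tensor Y₂ Y₃)) _ _ _
        (Equiv.prodAssoc _ _ _).bijective _ _ _ fun p q => associator_naturality _ _ _)
    (leftUnitor_naturality := fun {X Y} f => by
      refine comp_diag_eq (M := tensor unit X) (N := tensor unit Y)
        (K := X) (L := Y) _ _ _ (Equiv.punitProd _).bijective _ _ _ fun p q => ?_
      exact (congrArg (fun t => (t ⊗ₘ f p.2 q.2) ≫ (λ_ (Y.X q.2)).hom)
        (id_apply_self (unit : Mat_ C) PUnit.unit)).trans
        (MonoidalAux.leftUnitor_natural _))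
    (rightUnitor_naturality := fun {X Y} f => by
      refine comp_diag_eq (M := tensor X unit) (N := tensor Y unit)
        (K := X) (L := Y) _ _ _ (Equiv.prodPUnit _).bijective _ _ _ fun p q => ?_
      exact (congrArg (fun t => (f p.1 q.1 ⊗ₘ t) ≫ (ρ_ (Y.X q.1)).hom)
        (id_apply_self (unit : Mat_ C) PUnit.unit)).trans
        (MonoidalAux.rightUnitor_natural _))
    (pentagon := fun W X Y Z => by
      rw [id_eq_diag Z, id_eq_diag W]
      refine (congrArg₂ (· ≫ ·) (diag_tensor_diag _ _ _ _)
        ((congrArg₂ (· ≫ ·) rfl (diag_tensor_diag _ _ _ _)).trans (diag_comp_diag _ _ _ _))).trans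
        ((diag_comp_diag _ _ _ _).trans (Eq.trans ?_ (diag_comp_diag _ _ _ _).symm))
      exact diag_congr (M := tensor (tensor (tensor W X) Y) Z)
        (N := tensor W (tensor X (tensor Y Z))) _ fun _ =>
          MonoidalAux.pentagon_tensor _ _ _ _)
    (triangle := fun X Y => by
      rw [id_eq_diag X, id_eq_diag Y]
      refine ((congrArg₂ (· ≫ ·) rfl (diag_tensor_diag _ _ _ _)).trans
        (diag_comp_diag _ _ _ _)).trans (Eq.trans ?_ (diag_tensor_diag _ _ _ _).symm)
      exact diag_congr (M := tensor (tensor X unit) Y) (N := tensor X Y) _ fun _ =>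
          MonoidalAux.triangle_tensor _ _)

instance : MonoidalPreadditive (Mat_ C) where
  whiskerLeft_zero {X Y Z} :=
    hom_ext (M := tensor X Y) (N := tensor X Z) _ _ fun _ _ => MonoidalAux.tensor_zero _
  zero_whiskerRight {X Y Z} :=
    hom_ext (M := tensor Y X) (N := tensor Z X) _ _ fun _ _ => MonoidalAux.zero_tensor _
  whiskerLeft_add {X Y Z} _ _ :=
    hom_ext (M := tensor X Y) (N := tensor X Z) _ _ fun _ _ => MonoidalPreadditive.tensor_add _ _ _
  add_whiskerRight {X Y Z} _ _ :=
    hom_ext (M := tensor Y X) (N := tensor Z X) _ _ fun _ _ => MonoidalPreadditive.add_tensor _ _ _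

instance {k : Type w} [CommRing k] [Linear k C] [MonoidalLinear k C] :
    MonoidalLinear k (Mat_ C) where
  whiskerLeft_smul X {Y Z} r f :=
    hom_ext (M := tensor X Y) (N := tensor X Z) _ _ fun p q =>
      ((LinProd.tensorBilin (k := k) _ _ _ _ ((𝟙 X : Mat_.Hom X X) p.1 q.1)).map_smul r
        (f p.2 q.2) :)
  smul_whiskerRight r {Y Z} f X :=
    hom_ext (M := tensor Y X) (N := tensor Z X) _ _ fun p q =>
      (LinProd.tensorBilin (k := k) _ _ _ _).map_smul₂ r (f p.1 q.1)
        ((𝟙 X : Mat_.Hom X X) p.2 q.2)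

instance [SymmetricCategory C] : SymmetricCategory (Mat_ C) :=
  symmetricOfHexagon
    (fun X Y => diag (M := tensor X Y) (N := tensor Y X) (fun p => (p.2, p.1))
      fun p => (β_ (X.X p.1) (Y.X p.2)).hom)
    (natural := fun {X X' Y Y'} f g =>
      comp_diag_eq (M := tensor X Y) (N := tensor X' Y') (K := tensor Y X) (L := tensor Y' X')
        _ _ _ (Equiv.prodComm _ _).bijective _ _ _ fun _ _ =>
          BraidedCategory.braiding_naturality _ _)
    (hexagon := fun X Y Z => by
      rw [id_eq_diag Y, id_eq_diag Z]
      refine ((congrArg₂ (· ≫ ·) rfl (diag_comp_diag _ _ _ _)).trans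
        (diag_comp_diag _ _ _ _)).trans (Eq.trans ?_ (congrArg₂ (· ≫ ·) (diag_tensor_diag _ _ _ _)
        ((congrArg₂ (· ≫ ·) rfl (diag_tensor_diag _ _ _ _)).trans (diag_comp_diag _ _ _ _))).symm)
      refine Eq.trans ?_ (diag_comp_diag _ _ _ _).symm
      exact diag_congr (M := tensor (tensor X Y) Z) (N := tensor Y (tensor Z X)) _ fun _ =>
          MonoidalAux.hexagon_tensor _ _ _)
    (symm := fun X Y => (diag_comp_diag _ _ _ _).trans
      (diag_eq_id (M := tensor X Y) _ fun _ => SymmetricCategory.symmetry _ _))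

/-- Compatibility of the embedding of `C` in its additive envelope with tensor products. -/
def embeddingμ (X Y : C) :
    (embedding C).obj X ⊗ (embedding C).obj Y ≅ (embedding C).obj (X ⊗ Y) where
  hom := diag (M := tensor ((embedding C).obj X) ((embedding C).obj Y))
    (N := (embedding C).obj (X ⊗ Y)) (fun _ => PUnit.unit) fun _ => 𝟙 _
  inv := diag (M := (embedding C).obj (X ⊗ Y))
    (N := tensor ((embedding C).obj X) ((embedding C).obj Y)) (fun _ => (PUnit.unit, PUnit.unit))
    fun _ => 𝟙 _
  hom_inv_id := (diag_comp_diag _ _ _ _).trans (diag_eq_id _ fun _ => Category.id_comp _)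
  inv_hom_id := (diag_comp_diag _ _ _ _).trans (diag_eq_id _ fun _ => Category.id_comp _)

instance : (embedding C).Monoidal :=
  Functor.CoreMonoidal.toMonoidal
    { εIso := Iso.refl _
      μIso := embeddingμ
      μIso_hom_natural_left := fun {X Y} f Z => by
        rw [embedding_map_eq_diag, embedding_map_eq_diag, ← tensorHom_id, ← tensorHom_id,
          id_eq_diag]
        refine (congrArg₂ (· ≫ ·) (diag_tensor_diag _ _ _ _) rfl).trans
          ((diag_comp_diag _ _ _ _).trans (Eq.trans ?_ (diag_comp_diag _ _ _ _).symm))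
        exact diag_congr (M := tensor ((embedding C).obj X) ((embedding C).obj Z))
          (N := (embedding C).obj (Y ⊗ Z)) _ fun _ =>
            (Category.comp_id _).trans (Category.id_comp _).symm
      μIso_hom_natural_right := fun {X Y} Z f => by
        rw [embedding_map_eq_diag, embedding_map_eq_diag, ← id_tensorHom, ← id_tensorHom,
          id_eq_diag]
        refine (congrArg₂ (· ≫ ·) (diag_tensor_diag _ _ _ _) rfl).trans
          ((diag_comp_diag _ _ _ _).trans (Eq.trans ?_ (diag_comp_diag _ _ _ _).symm))
        exact diag_congr (M := tensor ((embedding C).obj Z) ((embedding C).obj X))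
          (N := (embedding C).obj (Z ⊗ Y)) _ fun _ =>
            (Category.comp_id _).trans (Category.id_comp _).symm
      associativity := fun X Y Z => by
        rw [embedding_map_eq_diag, ← tensorHom_id, ← id_tensorHom, id_eq_diag, id_eq_diag]
        refine (congrArg₂ (· ≫ ·) (diag_tensor_diag _ _ _ _) (diag_comp_diag _ _ _ _)).trans
          ((diag_comp_diag _ _ _ _).trans (Eq.trans ?_ (congrArg₂ (· ≫ ·) rfl
            ((congrArg₂ (· ≫ ·) (diag_tensor_diag _ _ _ _) rfl).trans
              (diag_comp_diag _ _ _ _))).symm))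
        refine Eq.trans ?_ (diag_comp_diag _ _ _ _).symm
        refine diag_congr (M := tensor (tensor ((embedding C).obj X) ((embedding C).obj Y))
          ((embedding C).obj Z)) (N := (embedding C).obj (X ⊗ (Y ⊗ Z))) _ fun _ => ?_
        change (𝟙 (X ⊗ Y) ⊗ₘ 𝟙 Z) ≫ 𝟙 ((X ⊗ Y) ⊗ Z) ≫ (α_ X Y Z).hom =
          (α_ X Y Z).hom ≫ (𝟙 X ⊗ₘ 𝟙 (Y ⊗ Z)) ≫ 𝟙 (X ⊗ (Y ⊗ Z))
        simp
      left_unitality := fun X => by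
        rw [embedding_map_eq_diag, ← tensorHom_id]
        refine Eq.trans ?_ (congrArg₂ (· ≫ ·)
          (id_tensorHom_id ((embedding C).obj (𝟙_ C)) ((embedding C).obj X))
          (diag_comp_diag _ _ _ _)).symm
        refine Eq.trans ?_ (Category.id_comp _).symm
        exact diag_congr (M := tensor ((embedding C).obj (𝟙_ C)) ((embedding C).obj X))
          (N := (embedding C).obj X) _ fun _ => (Category.id_comp _).symm
      right_unitality := fun X => by
        rw [embedding_map_eq_diag, ← id_tensorHom]
        refine Eq.trans ?_ (congrArg₂ (· ≫ ·)
          (id_tensorHom_id ((embedding C).obj X) ((embedding C).obj (𝟙_ C)))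
          (diag_comp_diag _ _ _ _)).symm
        refine Eq.trans ?_ (Category.id_comp _).symm
        exact diag_congr (M := tensor ((embedding C).obj X) ((embedding C).obj (𝟙_ C)))
          (N := (embedding C).obj X) _ fun _ => (Category.id_comp _).symm }

end CategoryTheory.Mat_

/-! ### The idempotent completion as a linear symmetric monoidal category -/

namespace CategoryTheory.Idempotents.Karoubi

variable {C : Type u} [Category.{v} C]

section Linear

variable [Preadditive C] {k : Type w} [CommRing k] [Linear k C]

instance (P Q : Karoubi C) : SMul k (P ⟶ Q) where
  smul r f := ⟨r • f.f, by rw [Linear.smul_comp, Linear.comp_smul, f.comm]⟩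

theorem smul_f {P Q : Karoubi C} (r : k) (f : P ⟶ Q) : (r • f).f = r • f.f := rfl

instance (P Q : Karoubi C) : Module k (P ⟶ Q) where
  one_smul f := hom_ext _ _ (one_smul k f.f)
  mul_smul r s f := hom_ext _ _ (mul_smul r s f.f)
  smul_zero r := hom_ext _ _ (smul_zero r)
  smul_add r f g := hom_ext _ _ (smul_add r f.f g.f)
  add_smul r s f := hom_ext _ _ (add_smul r s f.f)
  zero_smul f := hom_ext _ _ (zero_smul k f.f)

instance : Linear k (Karoubi C) where
  smul_comp _ _ _ r f g := hom_ext _ _ (Linear.smul_comp _ _ _ r f.f g.f)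
  comp_smul _ _ _ f r g := hom_ext _ _ (Linear.comp_smul _ _ _ f.f r g.f)

end Linear

/-- The morphisms of `C` which are compatible with the given idempotents. -/
abbrev Compat (P Q : Karoubi C) := {φ : P.X ⟶ Q.X // P.p ≫ φ = φ ≫ Q.p}

/-- A compatible morphism of `C` as a morphism of the idempotent completion. -/
def homOf {P Q : Karoubi C} (φ : Compat P Q) : P ⟶ Q :=
  ⟨P.p ≫ φ.1, by rw [Category.assoc, ← φ.2, P.idem_assoc, P.idem_assoc]⟩

theorem homOf_f {P Q : Karoubi C} (φ : Compat P Q) : (homOf φ).f = P.p ≫ φ.1 := rfl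

theorem homOf_comp {P Q R : Karoubi C} (φ : Compat P Q) (ψ : Compat Q R) :
    homOf φ ≫ homOf ψ = homOf (⟨φ.1 ≫ ψ.1, by
      rw [← Category.assoc, φ.2, Category.assoc, ψ.2, Category.assoc]⟩ : Compat P R) :=
  hom_ext _ _ (by
    change (P.p ≫ φ.1) ≫ Q.p ≫ ψ.1 = P.p ≫ φ.1 ≫ ψ.1
    rw [Category.assoc, ← reassoc_of% φ.2, P.idem_assoc])

theorem homOf_congr {P Q : Karoubi C} {φ ψ : Compat P Q} (e : φ.1 = ψ.1) : homOf φ = homOf ψ :=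
  congrArg homOf (Subtype.ext e)

theorem id_eq_homOf (P : Karoubi C) :
    𝟙 P = homOf (⟨𝟙 P.X, (Category.comp_id _).trans (Category.id_comp _).symm⟩ : Compat P P) :=
  hom_ext _ _ (Category.comp_id _).symm

theorem homOf_eq_id {P : Karoubi C} {φ : Compat P P} (e : φ.1 = 𝟙 P.X) : homOf φ = 𝟙 P :=
  (homOf_congr e).trans (id_eq_homOf P).symm

theorem comp_homOf_eq {P Q R S : Karoubi C} (f : P ⟶ Q) (φ : Compat Q S) (ψ : Compat P R)
    (g : R ⟶ S) (H : f.f ≫ φ.1 = ψ.1 ≫ g.f) : f ≫ homOf φ = homOf ψ ≫ g :=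
  hom_ext _ _ (by
    rw [comp_f, comp_f, homOf_f, homOf_f, comp_p_assoc, ψ.2, Category.assoc, p_comp, H])

/-- An isomorphism of `C` which is compatible with the given idempotents. -/
def isoOf {P Q : Karoubi C} (φ : P.X ≅ Q.X) (h : P.p ≫ φ.hom = φ.hom ≫ Q.p) : P ≅ Q where
  hom := homOf ⟨φ.hom, h⟩
  inv := homOf ⟨φ.inv, by rw [Iso.comp_inv_eq, Category.assoc, h, Iso.inv_hom_id_assoc]⟩
  hom_inv_id := (homOf_comp _ _).trans (homOf_eq_id φ.hom_inv_id)
  inv_hom_id := (homOf_comp _ _).trans (homOf_eq_id φ.inv_hom_id)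

variable [MonoidalCategory C]

/-- The tensor product of objects. -/
def tensor (P Q : Karoubi C) : Karoubi C :=
  ⟨P.X ⊗ Q.X, P.p ⊗ₘ Q.p, by rw [tensorHom_comp_tensorHom, P.idem, Q.idem]⟩

/-- The tensor product of morphisms. -/
def tensorMap {P Q P' Q' : Karoubi C} (f : P ⟶ Q) (g : P' ⟶ Q') : tensor P P' ⟶ tensor Q Q' :=
  ⟨f.f ⊗ₘ g.f, by
    change (P.p ⊗ₘ P'.p) ≫ (f.f ⊗ₘ g.f) ≫ (Q.p ⊗ₘ Q'.p) = f.f ⊗ₘ g.f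
    rw [tensorHom_comp_tensorHom, tensorHom_comp_tensorHom, f.comm, g.comm]⟩

/-- The unit object, as an object of the idempotent completion. -/
def unit : Karoubi C := ⟨𝟙_ C, 𝟙 _, Category.comp_id _⟩

instance : MonoidalCategoryStruct (Karoubi C) where
  tensorObj P Q := tensor P Q
  tensorUnit := unit
  tensorHom f g := tensorMap f g
  whiskerLeft P _ _ g := tensorMap (𝟙 P) g
  whiskerRight f P := tensorMap f (𝟙 P)
  associator P Q R := isoOf (P := tensor (tensor P Q) R) (Q := tensor P (tensor Q R))
    (α_ P.X Q.X R.X) (associator_naturality P.p Q.p R.p)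
  leftUnitor P := isoOf (P := tensor unit P) (Q := P) (λ_ P.X)
    (MonoidalAux.leftUnitor_natural P.p)
  rightUnitor P := isoOf (P := tensor P unit) (Q := P) (ρ_ P.X)
    (MonoidalAux.rightUnitor_natural P.p)

theorem homOf_tensor {P Q P' Q' : Karoubi C} (φ : Compat P Q) (φ' : Compat P' Q') :
    homOf φ ⊗ₘ homOf φ' = homOf (⟨φ.1 ⊗ₘ φ'.1, by
      change (P.p ⊗ₘ P'.p) ≫ _ = _ ≫ (Q.p ⊗ₘ Q'.p)
      rw [tensorHom_comp_tensorHom, tensorHom_comp_tensorHom, φ.2, φ'.2]⟩ :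
        Compat (tensor P P') (tensor Q Q')) :=
  hom_ext _ _ (tensorHom_comp_tensorHom _ _ _ _).symm

instance : MonoidalCategory (Karoubi C) :=
  .ofTensorHom
    (id_tensorHom_id := fun _ _ => rfl)
    (id_tensorHom := fun _ _ _ _ => rfl)
    (tensorHom_id := fun _ _ => rfl)
    (tensorHom_comp_tensorHom := fun _ _ _ _ => hom_ext _ _ (tensorHom_comp_tensorHom _ _ _ _))
    (associator_naturality := fun f₁ f₂ f₃ =>
      comp_homOf_eq _ _ _ _ (associator_naturality f₁.f f₂.f f₃.f))
    (leftUnitor_naturality := fun f =>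
      comp_homOf_eq _ _ _ _ (MonoidalAux.leftUnitor_natural f.f))
    (rightUnitor_naturality := fun f =>
      comp_homOf_eq _ _ _ _ (MonoidalAux.rightUnitor_natural f.f))
    (pentagon := fun W X Y Z => by
      rw [id_eq_homOf Z, id_eq_homOf W]
      refine (congrArg₂ (· ≫ ·) (homOf_tensor _ _)
        ((congrArg₂ (· ≫ ·) rfl (homOf_tensor _ _)).trans (homOf_comp _ _))).trans
        ((homOf_comp _ _).trans (Eq.trans ?_ (homOf_comp _ _).symm))
      exact homOf_congr (P := tensor (tensor (tensor W X) Y) Z)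
        (Q := tensor W (tensor X (tensor Y Z))) (MonoidalAux.pentagon_tensor _ _ _ _))
    (triangle := fun X Y => by
      rw [id_eq_homOf X, id_eq_homOf Y]
      refine ((congrArg₂ (· ≫ ·) rfl (homOf_tensor _ _)).trans
        (homOf_comp _ _)).trans (Eq.trans ?_ (homOf_tensor _ _).symm)
      exact homOf_congr (P := tensor (tensor X unit) Y) (Q := tensor X Y)
        (MonoidalAux.triangle_tensor _ _))

instance [Preadditive C] [MonoidalPreadditive C] : MonoidalPreadditive (Karoubi C) where
  whiskerLeft_zero := hom_ext _ _ (MonoidalAux.tensor_zero _)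
  zero_whiskerRight := hom_ext _ _ (MonoidalAux.zero_tensor _)
  whiskerLeft_add _ _ := hom_ext _ _ (MonoidalPreadditive.tensor_add _ _ _)
  add_whiskerRight _ _ := hom_ext _ _ (MonoidalPreadditive.add_tensor _ _ _)

instance [Preadditive C] [MonoidalPreadditive C] {k : Type w} [CommRing k] [Linear k C]
    [MonoidalLinear k C] : MonoidalLinear k (Karoubi C) where
  whiskerLeft_smul X _ _ r f :=
    hom_ext _ _ ((LinProd.tensorBilin (k := k) _ _ _ _ X.p).map_smul r f.f)
  smul_whiskerRight r _ _ f X :=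
    hom_ext _ _ ((LinProd.tensorBilin (k := k) _ _ _ _).map_smul₂ r f.f X.p)

instance [SymmetricCategory C] : SymmetricCategory (Karoubi C) :=
  symmetricOfHexagon
    (fun X Y => homOf (P := tensor X Y) (Q := tensor Y X)
      ⟨(β_ X.X Y.X).hom, BraidedCategory.braiding_naturality X.p Y.p⟩)
    (natural := fun f g =>
      comp_homOf_eq _ _ _ _ (BraidedCategory.braiding_naturality f.f g.f))
    (hexagon := fun X Y Z => by
      rw [id_eq_homOf Y, id_eq_homOf Z]
      refine ((congrArg₂ (· ≫ ·) rfl (homOf_comp _ _)).trans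
        (homOf_comp _ _)).trans (Eq.trans ?_ (congrArg₂ (· ≫ ·) (homOf_tensor _ _)
        ((congrArg₂ (· ≫ ·) rfl (homOf_tensor _ _)).trans (homOf_comp _ _))).symm)
      refine Eq.trans ?_ (homOf_comp _ _).symm
      exact homOf_congr (P := tensor (tensor X Y) Z) (Q := tensor Y (tensor Z X))
        (MonoidalAux.hexagon_tensor _ _ _))
    (symm := fun X Y => (homOf_comp _ _).trans
      (homOf_eq_id (P := tensor X Y) (SymmetricCategory.symmetry _ _)))

/-- Compatibility of the embedding of `C` in its idempotent completion with tensor products. -/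
def toKaroubiμ (X Y : C) :
    (toKaroubi C).obj X ⊗ (toKaroubi C).obj Y ≅ (toKaroubi C).obj (X ⊗ Y) :=
  isoOf (P := tensor ((toKaroubi C).obj X) ((toKaroubi C).obj Y))
    (Q := (toKaroubi C).obj (X ⊗ Y)) (Iso.refl (X ⊗ Y)) (by
      change (𝟙 X ⊗ₘ 𝟙 Y) ≫ 𝟙 (X ⊗ Y) = 𝟙 (X ⊗ Y) ≫ 𝟙 (X ⊗ Y)
      rw [id_tensorHom_id])

instance : (toKaroubi C).Monoidal :=
  Functor.CoreMonoidal.toMonoidal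
    { εIso := Iso.refl _
      μIso := toKaroubiμ
      μIso_hom_natural_left := fun {X Y} f Z => by
        refine comp_homOf_eq _ _ _ _ ?_
        change (f ⊗ₘ 𝟙 Z) ≫ 𝟙 (Y ⊗ Z) = 𝟙 (X ⊗ Z) ≫ (f ▷ Z)
        simp
      μIso_hom_natural_right := fun {X Y} Z f => by
        refine comp_homOf_eq _ _ _ _ ?_
        change (𝟙 Z ⊗ₘ f) ≫ 𝟙 (Z ⊗ Y) = 𝟙 (Z ⊗ X) ≫ (Z ◁ f)
        simp
      associativity := fun X Y Z => hom_ext _ _ (by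
        change ((((𝟙 X ⊗ₘ 𝟙 Y) ≫ 𝟙 _) ⊗ₘ 𝟙 Z)) ≫ ((𝟙 (X ⊗ Y) ⊗ₘ 𝟙 Z) ≫ 𝟙 ((X ⊗ Y) ⊗ Z)) ≫
          (α_ X Y Z).hom = (((𝟙 X ⊗ₘ 𝟙 Y) ⊗ₘ 𝟙 Z) ≫ (α_ X Y Z).hom) ≫
          (𝟙 X ⊗ₘ ((𝟙 Y ⊗ₘ 𝟙 Z) ≫ 𝟙 (Y ⊗ Z))) ≫ (𝟙 X ⊗ₘ 𝟙 (Y ⊗ Z)) ≫ 𝟙 (X ⊗ (Y ⊗ Z))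
        simp)
      left_unitality := fun X => hom_ext _ _ (by
        change (𝟙 (𝟙_ C) ⊗ₘ 𝟙 X) ≫ (λ_ X).hom =
          (𝟙 (𝟙_ C) ⊗ₘ 𝟙 X) ≫ ((𝟙 (𝟙_ C) ⊗ₘ 𝟙 X) ≫ 𝟙 _) ≫ (λ_ X).hom
        simp)
      right_unitality := fun X => hom_ext _ _ (by
        change (𝟙 X ⊗ₘ 𝟙 (𝟙_ C)) ≫ (ρ_ X).hom =
          (𝟙 X ⊗ₘ 𝟙 (𝟙_ C)) ≫ ((𝟙 X ⊗ₘ 𝟙 (𝟙_ C)) ≫ 𝟙 _) ≫ (ρ_ X).hom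
        simp) }

end CategoryTheory.Idempotents.Karoubi

/-! ### Pseudo-abelian envelopes and external tensor products -/

/-- The pseudo-abelian envelope of a preadditive category: the idempotent completion of its additive
envelope. -/
abbrev PsAb (C : Type u) [Category.{v} C] [Preadditive C] := Idempotents.Karoubi (Mat_ C)

/-- The embedding of a preadditive category in its pseudo-abelian envelope. -/
abbrev PsAb.embedding (C : Type u) [Category.{v} C] [Preadditive C] : C ⥤ PsAb C :=
  Mat_.embedding C ⋙ Idempotents.toKaroubi (Mat_ C)

instance (C : Type u) [Category.{v} C] [Preadditive C] : Limits.HasBinaryBiproducts (PsAb C) :=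
  Limits.hasBinaryBiproducts_of_finite_biproducts _

/-- The external tensor product `C ⊠ D` of `k`-linear categories: the pseudo-abelian envelope of
`C ⊗ₖ D`. -/
abbrev ExtProd (k : Type w) [CommRing k] (C : Type u) [Category.{v} C] [Preadditive C] [Linear k C]
    (D : Type u') [Category.{v'} D] [Preadditive D] [Linear k D] :=
  PsAb (LinProd k C D)

/-! ### Extended Frobenius algebras -/

/-- The structure maps of an extended Frobenius algebra: an object with multiplication, unit,
comultiplication, counit, involution and crosscap. -/
structure ExtFrobData (C : Type u) [Category.{v} C] [MonoidalCategory C] where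
  X : C
  mul : X ⊗ X ⟶ X
  one : 𝟙_ C ⟶ X
  comul : X ⟶ X ⊗ X
  counit : X ⟶ 𝟙_ C
  phi : X ⟶ X
  theta : 𝟙_ C ⟶ X

namespace ExtFrobData

section

variable {C : Type u} [Category.{v} C] [MonoidalCategory C] (A : ExtFrobData C)

/-- The handle endomorphism `x`. -/
def handle : End A.X := A.comul ≫ A.mul

/-- The power `x ^ g` of the handle endomorphism, as a morphism. -/
def handlePow (g : ℕ) : A.X ⟶ A.X := A.handle ^ g

/-- The connected closed surface of genus `g` with no crosscaps. -/
def surface (g : ℕ) : 𝟙_ C ⟶ 𝟙_ C := A.one ≫ A.handlePow g ≫ A.counit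

/-- The connected closed surface with `g` handles and one crosscap. -/
def surfaceOne (g : ℕ) : 𝟙_ C ⟶ 𝟙_ C := A.theta ≫ A.handlePow g ≫ A.counit

/-- The connected closed surface with `g` handles and two crosscaps. -/
def surfaceTwo (g : ℕ) : 𝟙_ C ⟶ 𝟙_ C :=
  (λ_ (𝟙_ C)).inv ≫ (A.theta ⊗ₘ A.theta) ≫ A.mul ≫ A.handlePow g ≫ A.counit

/-- Compatibility of a morphism with all the structure maps. -/
structure IsHom (A B : ExtFrobData C) (f : A.X ⟶ B.X) : Prop where
  mul : A.mul ≫ f = (f ⊗ₘ f) ≫ B.mul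
  one : A.one ≫ f = B.one
  comul : A.comul ≫ (f ⊗ₘ f) = f ≫ B.comul
  counit : f ≫ B.counit = A.counit
  phi : A.phi ≫ f = f ≫ B.phi
  theta : A.theta ≫ f = B.theta

/-- The image under a monoidal functor. -/
def map {D : Type u'} [Category.{v'} D] [MonoidalCategory D] (F : C ⥤ D) [F.Monoidal] :
    ExtFrobData D where
  X := F.obj A.X
  mul := Functor.LaxMonoidal.μ F A.X A.X ≫ F.map A.mul
  one := Functor.LaxMonoidal.ε F ≫ F.map A.one
  comul := F.map A.comul ≫ Functor.OplaxMonoidal.δ F A.X A.X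
  counit := F.map A.counit ≫ Functor.OplaxMonoidal.η F
  phi := F.map A.phi
  theta := Functor.LaxMonoidal.ε F ≫ F.map A.theta

variable (C) in
/-- The unit object, with identities as structure maps. -/
def unit : ExtFrobData C where
  X := 𝟙_ C
  mul := (λ_ (𝟙_ C)).hom
  one := 𝟙 _
  comul := (λ_ (𝟙_ C)).inv
  counit := 𝟙 _
  phi := 𝟙 _
  theta := 𝟙 _

open Limits in
/-- The direct sum. -/
def oplus [Preadditive C] [HasBinaryBiproducts C] (A B : ExtFrobData C) : ExtFrobData C where
  X := A.X ⊞ B.X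
  mul := (biprod.fst ⊗ₘ biprod.fst) ≫ A.mul ≫ biprod.inl +
    (biprod.snd ⊗ₘ biprod.snd) ≫ B.mul ≫ biprod.inr
  one := A.one ≫ biprod.inl + B.one ≫ biprod.inr
  comul := biprod.fst ≫ A.comul ≫ (biprod.inl ⊗ₘ biprod.inl) +
    biprod.snd ≫ B.comul ≫ (biprod.inr ⊗ₘ biprod.inr)
  counit := biprod.fst ≫ A.counit + biprod.snd ≫ B.counit
  phi := biprod.fst ≫ A.phi ≫ biprod.inl + biprod.snd ≫ B.phi ≫ biprod.inr
  theta := A.theta ≫ biprod.inl + B.theta ≫ biprod.inr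

end

/-- The object `A ⊠ B` of `C ⊗ₖ D`, with componentwise structure maps. -/
def box (k : Type w) [CommRing k] {C : Type u} [Category.{v} C] [Preadditive C] [Linear k C]
    [MonoidalCategory C] [MonoidalPreadditive C] [MonoidalLinear k C]
    {D : Type u'} [Category.{v'} D] [Preadditive D] [Linear k D]
    [MonoidalCategory D] [MonoidalPreadditive D] [MonoidalLinear k D]
    (A : ExtFrobData C) (B : ExtFrobData D) : ExtFrobData (LinProd k C D) where
  X := ⟨A.X, B.X⟩
  mul := LinProd.box A.mul B.mul
  one := LinProd.box A.one B.one
  comul := LinProd.box A.comul B.comul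
  counit := LinProd.box A.counit B.counit
  phi := LinProd.box A.phi B.phi
  theta := LinProd.box A.theta B.theta

/-- The direct sum `(A ⊠ 𝟙) ⊕ (𝟙 ⊠ B)` in the external tensor product. -/
def extSum (k : Type w) [CommRing k] {C : Type u} [Category.{v} C] [Preadditive C] [Linear k C]
    [MonoidalCategory C] [MonoidalPreadditive C] [MonoidalLinear k C]
    {D : Type u'} [Category.{v'} D] [Preadditive D] [Linear k D]
    [MonoidalCategory D] [MonoidalPreadditive D] [MonoidalLinear k D]
    (A : ExtFrobData C) (B : ExtFrobData D) : ExtFrobData (ExtProd k C D) :=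
  oplus ((box k A (unit D)).map (PsAb.embedding (LinProd k C D)))
    ((box k (unit C) B).map (PsAb.embedding (LinProd k C D)))

end ExtFrobData

/-- The circle, with the generating cobordisms as structure maps. -/
def UCob.circle : ExtFrobData UCob where
  X := ⟨1⟩
  mul := ofWord .mul
  one := ofWord .one
  comul := ofWord .comul
  counit := ofWord .counit
  phi := ofWord .phi
  theta := ofWord .theta

/-! ### Skein categories of unoriented cobordisms -/

open Polynomial in
/-- Three sequences with rational generating functions `pα / q`, `pβ / q`, `pγ / q`, where `pα / q` is
in lowest terms, `q` has constant term `1`, and the degrees of `pβ` and `pγ` are smaller than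
`max (deg pα + 1) (deg q)`. -/
structure SkeinTriple (k : Type w) [Field k] where
  α : ℕ → k
  β : ℕ → k
  γ : ℕ → k
  pα : k[X]
  pβ : k[X]
  pγ : k[X]
  q : k[X]
  coprime : IsCoprime pα q
  q_zero : q.coeff 0 = 1
  gen_α : PowerSeries.mk α * (q : PowerSeries k) = pα
  gen_β : PowerSeries.mk β * (q : PowerSeries k) = pβ
  gen_γ : PowerSeries.mk γ * (q : PowerSeries k) = pγ
  degree_β : pβ.natDegree < max (pα.natDegree + 1) q.natDegree
  degree_γ : pγ.natDegree < max (pα.natDegree + 1) q.natDegree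

namespace SkeinTriple

variable {k : Type w} [Field k] (T : SkeinTriple k)

open Polynomial in
/-- The handle polynomial `T ^ K * q (1 / T)`, for `K = max (deg pα + 1) (deg q)`: with
`q = 1 + a₁ T + a₂ T² + ⋯`, it is `T ^ K + a₁ T ^ (K - 1) + a₂ T ^ (K - 2) + ⋯`. -/
def handlePoly : k[X] := T.q.reflect (max (T.pα.natDegree + 1) T.q.natDegree)

/-- The relations which evaluate connected closed surfaces with `0`, `1` and `2` crosscaps to the
sequences `α`, `β`, `γ`. -/
inductive EvalRel : ∀ X Y : Lin k UCob, (X ⟶ Y) → Prop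
  | zero (g : ℕ) : EvalRel (𝟙_ _) (𝟙_ _)
      ((UCob.circle.map (Lin.embedding k UCob)).surface g - T.α g • 𝟙 _)
  | one (g : ℕ) : EvalRel (𝟙_ _) (𝟙_ _)
      ((UCob.circle.map (Lin.embedding k UCob)).surfaceOne g - T.β g • 𝟙 _)
  | two (g : ℕ) : EvalRel (𝟙_ _) (𝟙_ _)
      ((UCob.circle.map (Lin.embedding k UCob)).surfaceTwo g - T.γ g • 𝟙 _)

/-- The tensor ideal generated by the evaluation relations. -/
def evalIdeal : TensorIdeal k (Lin k UCob) := .span k fun X Y => {f | T.EvalRel X Y f}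

/-- The category `VUCob` of viewable cobordisms: linear combinations of cobordisms, where closed
components are evaluated by `α`, `β`, `γ`. -/
abbrev VUCob := T.evalIdeal.QuotCat

/-- The circle, as an object of `VUCob`. -/
def circleV : ExtFrobData T.VUCob :=
  (UCob.circle.map (Lin.embedding k UCob)).map (TensorIdeal.QuotCat.functor T.evalIdeal)

/-- The handle relation: the handle polynomial, evaluated at the handle endomorphism. -/
inductive HandleRel : ∀ X Y : T.VUCob, (X ⟶ Y) → Prop
  | handle : HandleRel T.circleV.X T.circleV.X (Polynomial.aeval T.circleV.handle T.handlePoly)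

/-- The tensor ideal generated by the handle relation. -/
def handleIdeal : TensorIdeal k T.VUCob := .span k fun X Y => {f | T.HandleRel X Y f}

/-- The skein category `SUCob`: the quotient of `VUCob` by the handle relation. -/
abbrev SUCob := T.handleIdeal.QuotCat

/-- The pseudo-abelian envelope of the skein category. -/
abbrev PsUCob := PsAb T.SUCob

/-- The circle, as an object of the pseudo-abelian envelope of the skein category. -/
def circle : ExtFrobData T.PsUCob :=
  (T.circleV.map (TensorIdeal.QuotCat.functor T.handleIdeal)).map (PsAb.embedding T.SUCob)

end SkeinTriple

end

/-! The category `T.PsUCob` has a universal property. A linear symmetric monoidal functor from it to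
an idempotent complete linear symmetric monoidal category with finite biproducts is determined, up
to natural isomorphism, by the image of the circle. Every extended Frobenius algebra there whose
closed surfaces have the prescribed values, and whose handle endomorphism is killed by the handle
polynomial, occurs as such an image (`SkeinTriple.exists_functor`,
`SkeinTriple.nonempty_iso_of_isomorphic`). Both directions of the equivalence come from this
property, and so do the two isomorphisms showing that they are mutually inverse.

The functor `F`. A connected closed surface evaluated in a direct sum of algebras is the sum of its
values in the summands, because a product of elements from different summands vanishes. The
polynomial `m' m''` kills the handle on both summands. So `(A' ⊠ 𝟙) ⊕ (𝟙 ⊠ A'')` satisfies the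
relations of the sum triple (`Evaluates.of_isDirectSum`), and the universal property gives `F`.

The functor `G` in the other direction. Write `a m' + b m'' = 1`. In the source category the handle
polynomial `m' m''` kills `x`, so `(b m'')(x)` and `(a m')(x)` are complementary orthogonal
idempotents of the circle. By the Frobenius relations the handle commutes with multiplication and
comultiplication, and it commutes with the involution because that is an automorphism. So the images
of these idempotents are again extended Frobenius algebras (`IsExtFrob.isCentral_polyHandle`,
`IsCentral.isExtFrob_retract`). Multiples of the handle polynomial of a triple are annihilated by
the functionals `X ^ g ↦ α g, β g, γ g` of that triple: this is the linear recurrence satisfied by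
the coefficients of a rational function (`evalSeq_reflect_mul`). Since `b m''` is `1` modulo `m'`
and `0` modulo `m''`, the first image evaluates closed surfaces by the first triple, and
symmetrically for the second (`Evaluates.of_retract`). The universal properties of `UCob'` and
`UCob''` then give `G₁` and `G₂`, and `G` extends `X ⊠ Y ↦ G₁ X ⊗ G₂ Y`.

Comparison. `F` followed by `G` sends the circle to the sum of the two images, which is the circle
itself, so this composite is isomorphic to the identity. For the other composite it is enough to
compare on external products `X ⊠ Y`, hence on each factor, hence on the circles `A'` and `A''`.
There one needs that the summands of a direct sum can be recovered from it; they can, because each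
is cut out by a fixed polynomial in the handle (`Evaluates.isomorphic_left`). -/

noncomputable section

universe w'

namespace ExtFrobData

/-! ### Extended Frobenius algebras and their isomorphisms. -/

section Axioms

variable {C : Type u} [Category.{v} C] [MonoidalCategory C]

/-- The axioms of an extended Frobenius algebra: a commutative Frobenius algebra with an involutive
automorphism `φ` and a crosscap `θ`. -/
structure IsExtFrob [BraidedCategory C] (A : ExtFrobData C) : Prop where
  mul_assoc : A.mul ▷ A.X ≫ A.mul = (α_ A.X A.X A.X).hom ≫ A.X ◁ A.mul ≫ A.mul
  one_mul : A.one ▷ A.X ≫ A.mul = (λ_ A.X).hom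
  mul_one : A.X ◁ A.one ≫ A.mul = (ρ_ A.X).hom
  comul_assoc : A.comul ≫ A.comul ▷ A.X ≫ (α_ A.X A.X A.X).hom = A.comul ≫ A.X ◁ A.comul
  counit_comul : A.comul ≫ A.counit ▷ A.X ≫ (λ_ A.X).hom = 𝟙 A.X
  comul_counit : A.comul ≫ A.X ◁ A.counit ≫ (ρ_ A.X).hom = 𝟙 A.X
  mul_comm : (β_ A.X A.X).hom ≫ A.mul = A.mul
  comul_comm : A.comul ≫ (β_ A.X A.X).hom = A.comul
  frobenius_left : A.comul ▷ A.X ≫ (α_ A.X A.X A.X).hom ≫ A.X ◁ A.mul = A.mul ≫ A.comul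
  frobenius_right : A.X ◁ A.comul ≫ (α_ A.X A.X A.X).inv ≫ A.mul ▷ A.X = A.mul ≫ A.comul
  phi_phi : A.phi ≫ A.phi = 𝟙 A.X
  mul_phi : (A.phi ⊗ₘ A.phi) ≫ A.mul = A.mul ≫ A.phi
  phi_comul : A.phi ≫ A.comul = A.comul ≫ (A.phi ⊗ₘ A.phi)
  one_phi : A.one ≫ A.phi = A.one
  phi_counit : A.phi ≫ A.counit = A.counit
  theta_phi : A.theta ▷ A.X ≫ A.mul ≫ A.phi = A.theta ▷ A.X ≫ A.mul
  klein : A.one ≫ A.comul ≫ A.phi ▷ A.X ≫ A.mul =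
    (λ_ (𝟙_ C)).inv ≫ (A.theta ⊗ₘ A.theta) ≫ A.mul

/-- Isomorphism of objects with the structure maps of an extended Frobenius algebra. -/
def Isomorphic (A B : ExtFrobData C) : Prop := ∃ e : A.X ≅ B.X, IsHom A B e.hom

theorem IsHom.id (A : ExtFrobData C) : IsHom A A (𝟙 A.X) := by constructor <;> simp

theorem IsHom.comp {A B D : ExtFrobData C} {f : A.X ⟶ B.X} {g : B.X ⟶ D.X} (hf : IsHom A B f)
    (hg : IsHom B D g) : IsHom A D (f ≫ g) where
  mul := by rw [reassoc_of% hf.mul, hg.mul, tensorHom_comp_tensorHom_assoc]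
  one := by rw [reassoc_of% hf.one, hg.one]
  comul := by rw [← tensorHom_comp_tensorHom, reassoc_of% hf.comul, hg.comul, Category.assoc]
  counit := by rw [Category.assoc, hg.counit, hf.counit]
  phi := by rw [reassoc_of% hf.phi, hg.phi, Category.assoc]
  theta := by rw [reassoc_of% hf.theta, hg.theta]

theorem IsHom.symm {A B : ExtFrobData C} {e : A.X ≅ B.X} (h : IsHom A B e.hom) :
    IsHom B A e.inv where
  mul := by
    rw [Iso.comp_inv_eq, Category.assoc, h.mul, tensorHom_comp_tensorHom_assoc]
    simp
  one := by rw [Iso.comp_inv_eq, h.one]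
  comul := by
    rw [Iso.eq_inv_comp, ← reassoc_of% h.comul, tensorHom_comp_tensorHom]
    simp
  counit := by rw [Iso.inv_comp_eq, h.counit]
  phi := by rw [Iso.comp_inv_eq, Category.assoc, h.phi, Iso.inv_hom_id_assoc]
  theta := by rw [Iso.comp_inv_eq, h.theta]

theorem Isomorphic.symm {A B : ExtFrobData C} : Isomorphic A B → Isomorphic B A
  | ⟨e, h⟩ => ⟨e.symm, h.symm⟩

theorem Isomorphic.trans {A B D : ExtFrobData C} : Isomorphic A B → Isomorphic B D → Isomorphic A D
  | ⟨e, h⟩, ⟨e', h'⟩ => ⟨e ≪≫ e', h.comp h'⟩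

end Axioms

/-! ### Images of extended Frobenius algebras under monoidal functors. -/

section Map

open Functor.LaxMonoidal Functor.OplaxMonoidal

variable {C : Type u} [Category.{v} C] [MonoidalCategory C]
  {D : Type u'} [Category.{v'} D] [MonoidalCategory D]

/-- Once every whiskered map is written between a `μ` and a `δ`, adjacent pairs cancel in a
composite. An identity between composites of whiskered maps is then carried over from the source
category; the Frobenius and Klein relations need this form. -/
theorem map_whiskerRight_eq (F : C ⥤ D) [F.Monoidal] {X Y : C} (f : X ⟶ Y) (Z : C) :
    F.map f ▷ F.obj Z = μ F X Z ≫ F.map (f ▷ Z) ≫ δ F Y Z := by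
  rw [← μ_natural_left_assoc, Functor.Monoidal.μ_δ, Category.comp_id]

theorem whiskerLeft_map_eq (F : C ⥤ D) [F.Monoidal] {X Y : C} (f : X ⟶ Y) (Z : C) :
    F.obj Z ◁ F.map f = μ F Z X ≫ F.map (Z ◁ f) ≫ δ F Z Y := by
  rw [← μ_natural_right_assoc, Functor.Monoidal.μ_δ, Category.comp_id]

theorem IsHom.map {A B : ExtFrobData C} {f : A.X ⟶ B.X} (h : IsHom A B f) (F : C ⥤ D)
    [F.Monoidal] : IsHom (A.map F) (B.map F) (F.map f) := by
  constructor <;> dsimp only [ExtFrobData.map]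
  · rw [Category.assoc, ← F.map_comp, h.mul, μ_natural_assoc, ← F.map_comp]
  · rw [Category.assoc, ← F.map_comp, h.one]
  · rw [Category.assoc, δ_natural, ← F.map_comp_assoc, h.comul, F.map_comp_assoc]
  · rw [← F.map_comp_assoc, h.counit]
  · rw [← F.map_comp, h.phi, F.map_comp]
  · rw [Category.assoc, ← F.map_comp, h.theta]

theorem Isomorphic.map {A B : ExtFrobData C} (F : C ⥤ D) [F.Monoidal] :
    Isomorphic A B → Isomorphic (A.map F) (B.map F)
  | ⟨e, h⟩ => ⟨F.mapIso e, h.map F⟩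

/-- The coherence maps of a composite functor are the composites of the coherence maps, so the two
structures agree on the nose. Images under a composite can therefore be rewritten one functor at a
time. -/
theorem map_comp {E : Type*} [Category* E] [MonoidalCategory E] (A : ExtFrobData C) (F : C ⥤ D)
    [F.Monoidal] (G : D ⥤ E) [G.Monoidal] : A.map (F ⋙ G) = (A.map F).map G := by
  simp [ExtFrobData.map]

theorem map_id (A : ExtFrobData C) : A.map (𝟭 C) = A := by
  simp [ExtFrobData.map]

/-- Monoidality of `τ` is stated for `μ` and `ε`. The comultiplication and the counit of the image
involve `δ` and `η` instead, so these two cases are checked after composing with the invertible maps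
`μ G` and `ε G`. -/
theorem isomorphic_of_natIso (A : ExtFrobData C) {F G : C ⥤ D} [F.Monoidal] [G.Monoidal]
    (τ : F ≅ G) [NatTrans.IsMonoidal τ.hom] : Isomorphic (A.map F) (A.map G) := by
  refine ⟨τ.app A.X, ?_⟩
  constructor <;> dsimp only [ExtFrobData.map, Iso.app_hom]
  · rw [Category.assoc, τ.hom.naturality, NatTrans.IsMonoidal.tensor_assoc]
  · rw [Category.assoc, τ.hom.naturality, NatTrans.IsMonoidal.unit_assoc]
  · rw [← cancel_mono (μ G _ _), Category.assoc, Category.assoc, Category.assoc, Category.assoc,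
      ← NatTrans.IsMonoidal.tensor, Functor.Monoidal.δ_μ_assoc, Functor.Monoidal.δ_μ,
      Category.comp_id, τ.hom.naturality]
  · rw [← cancel_mono (ε G), Category.assoc, Category.assoc, Category.assoc,
      Functor.Monoidal.η_ε, ← NatTrans.IsMonoidal.unit (τ := τ.hom), Functor.Monoidal.η_ε_assoc,
      Category.comp_id, τ.hom.naturality]
  · exact τ.hom.naturality _
  · rw [Category.assoc, τ.hom.naturality, NatTrans.IsMonoidal.unit_assoc]

variable [BraidedCategory C] [BraidedCategory D]

/-- Every axiom is the image under `F` of the same axiom, after naturality has moved `μ`, `δ`, `ε`,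
`η` outwards. That `F` is braided matters only for the commutativity of the product and of the
coproduct. -/
theorem IsExtFrob.map {A : ExtFrobData C} (h : A.IsExtFrob) (F : C ⥤ D) [F.Braided] :
    (A.map F).IsExtFrob := by
  constructor <;> dsimp only [ExtFrobData.map]
  · simp only [comp_whiskerRight, whiskerLeft_comp, Category.assoc, μ_natural_left_assoc,
      μ_natural_right_assoc, ← F.map_comp, h.mul_assoc]
    simp only [F.map_comp, Functor.LaxMonoidal.associativity_assoc]
  · rw [comp_whiskerRight, Category.assoc, μ_natural_left_assoc, ← F.map_comp, h.one_mul,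
      ← Functor.LaxMonoidal.left_unitality]
  · rw [MonoidalCategory.whiskerLeft_comp, Category.assoc, μ_natural_right_assoc, ← F.map_comp,
      h.mul_one, ← Functor.LaxMonoidal.right_unitality]
  · simp only [comp_whiskerRight, whiskerLeft_comp, Category.assoc, δ_natural_left_assoc,
      δ_natural_right_assoc, ← F.map_comp_assoc, ← h.comul_assoc, oplax_associativity]
  · rw [comp_whiskerRight, Category.assoc, Category.assoc, δ_natural_left_assoc,
      ← F.map_comp_assoc, left_unitality_hom, ← F.map_comp, Category.assoc, h.counit_comul,
      F.map_id]
  · rw [MonoidalCategory.whiskerLeft_comp, Category.assoc, Category.assoc, δ_natural_right_assoc,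
      ← F.map_comp_assoc, right_unitality_hom, ← F.map_comp, Category.assoc, h.comul_counit,
      F.map_id]
  · rw [← Functor.LaxBraided.braided_assoc, ← F.map_comp, h.mul_comm]
  · rw [← cancel_mono (μ F _ _), Category.assoc, Category.assoc, ← Functor.LaxBraided.braided,
      Functor.Monoidal.δ_μ_assoc, ← F.map_comp, h.comul_comm, Category.assoc,
      Functor.Monoidal.δ_μ, Category.comp_id]
  · have := h.frobenius_left
    simp only [comp_whiskerRight, whiskerLeft_comp, Category.assoc,
      Functor.Monoidal.map_associator', map_whiskerRight_eq, whiskerLeft_map_eq,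
      Functor.Monoidal.whiskerRight_δ_μ_assoc, Functor.Monoidal.whiskerLeft_δ_μ_assoc,
      Functor.Monoidal.δ_μ_assoc, ← F.map_comp_assoc, this]
  · have := h.frobenius_right
    simp only [comp_whiskerRight, whiskerLeft_comp, Category.assoc,
      Functor.Monoidal.map_associator_inv', map_whiskerRight_eq, whiskerLeft_map_eq,
      Functor.Monoidal.whiskerRight_δ_μ_assoc, Functor.Monoidal.whiskerLeft_δ_μ_assoc,
      Functor.Monoidal.δ_μ_assoc, ← F.map_comp_assoc, this]
  · rw [← F.map_comp, h.phi_phi, F.map_id]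
  · rw [μ_natural_assoc, ← F.map_comp, h.mul_phi, Category.assoc, F.map_comp]
  · rw [Category.assoc, δ_natural, ← F.map_comp_assoc, h.phi_comul, F.map_comp_assoc]
  · rw [Category.assoc, ← F.map_comp, h.one_phi]
  · rw [← F.map_comp_assoc, h.phi_counit]
  · simp only [comp_whiskerRight, Category.assoc, μ_natural_left_assoc, ← F.map_comp, h.theta_phi]
  · simp only [Category.assoc, map_whiskerRight_eq, Functor.Monoidal.δ_μ_assoc, ← F.map_comp,
      h.klein]
    simp only [F.map_comp, Functor.Monoidal.map_leftUnitor_inv, Category.assoc,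
      ← tensorHom_comp_tensorHom, μ_natural_assoc]
    rw [leftUnitor_inv_naturality_assoc, ← tensorHom_def'_assoc]

end Map
end ExtFrobData

namespace ExtFrobData

/-! ### Retracts of extended Frobenius algebras and central idempotents. -/

section Summands

variable {C : Type u} [Category.{v} C] [MonoidalCategory C]

/-- Compatibility of a morphism with all the structure maps but the counit. -/
structure IsProj (A B : ExtFrobData C) (p : A.X ⟶ B.X) : Prop where
  mul : A.mul ≫ p = (p ⊗ₘ p) ≫ B.mul
  one : A.one ≫ p = B.one
  comul : A.comul ≫ (p ⊗ₘ p) = p ≫ B.comul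
  phi : A.phi ≫ p = p ≫ B.phi
  theta : A.theta ≫ p = B.theta

/-- Compatibility of a morphism with all the structure maps but the unit and the crosscap. -/
structure IsIncl (B A : ExtFrobData C) (i : B.X ⟶ A.X) : Prop where
  mul : B.mul ≫ i = (i ⊗ₘ i) ≫ A.mul
  comul : B.comul ≫ (i ⊗ₘ i) = i ≫ A.comul
  counit : i ≫ A.counit = B.counit
  phi : B.phi ≫ i = i ≫ A.phi

namespace IsProj

variable {A B : ExtFrobData C} {p : A.X ⟶ B.X}

/-- A projection can be pushed from the end of an axiom of `A` to the beginning of the same axiom of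
`B`. This is recorded as an equivalence, here and in the lemmas that follow, because both directions
serve. On a retract `p` is epi, and axioms pass from `A` to `B`. On a direct sum the two projections
are jointly monic, and axioms pass from the summands to the sum. -/
theorem mul_assoc_iff (h : IsProj A B p) :
    (A.mul ▷ A.X ≫ A.mul) ≫ p = ((α_ A.X A.X A.X).hom ≫ A.X ◁ A.mul ≫ A.mul) ≫ p ↔
      ((p ⊗ₘ p) ⊗ₘ p) ≫ B.mul ▷ B.X ≫ B.mul =
        ((p ⊗ₘ p) ⊗ₘ p) ≫ (α_ B.X B.X B.X).hom ≫ B.X ◁ B.mul ≫ B.mul := by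
  simp only [Category.assoc, h.mul, whiskerRight_comp_tensorHom_assoc,
    whiskerLeft_comp_tensorHom_assoc, tensorHom_comp_whiskerRight_assoc,
    associator_naturality_assoc, tensorHom_comp_whiskerLeft_assoc]

theorem one_mul_iff (h : IsProj A B p) : (A.one ▷ A.X ≫ A.mul) ≫ p = (λ_ A.X).hom ≫ p ↔
    𝟙_ C ◁ p ≫ B.one ▷ B.X ≫ B.mul = 𝟙_ C ◁ p ≫ (λ_ B.X).hom := by
  rw [Category.assoc, h.mul, whiskerRight_comp_tensorHom_assoc, h.one, leftUnitor_naturality,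
    tensorHom_def'_assoc]

theorem mul_one_iff (h : IsProj A B p) : (A.X ◁ A.one ≫ A.mul) ≫ p = (ρ_ A.X).hom ≫ p ↔
    p ▷ 𝟙_ C ≫ B.X ◁ B.one ≫ B.mul = p ▷ 𝟙_ C ≫ (ρ_ B.X).hom := by
  rw [Category.assoc, h.mul, whiskerLeft_comp_tensorHom_assoc, h.one, rightUnitor_naturality,
    MonoidalCategory.tensorHom_def_assoc]

theorem mul_comm_iff (h : IsProj A B p) [BraidedCategory C] :
    ((β_ A.X A.X).hom ≫ A.mul) ≫ p = A.mul ≫ p ↔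
      (p ⊗ₘ p) ≫ (β_ B.X B.X).hom ≫ B.mul = (p ⊗ₘ p) ≫ B.mul := by
  rw [Category.assoc, h.mul, BraidedCategory.braiding_naturality_assoc]

theorem phi_phi_iff (h : IsProj A B p) :
    (A.phi ≫ A.phi) ≫ p = 𝟙 A.X ≫ p ↔ p ≫ B.phi ≫ B.phi = p ≫ 𝟙 B.X := by
  rw [Category.assoc, h.phi, reassoc_of% h.phi, Category.id_comp, Category.comp_id]

theorem mul_phi_iff (h : IsProj A B p) : ((A.phi ⊗ₘ A.phi) ≫ A.mul) ≫ p = (A.mul ≫ A.phi) ≫ p ↔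
    (p ⊗ₘ p) ≫ (B.phi ⊗ₘ B.phi) ≫ B.mul = (p ⊗ₘ p) ≫ B.mul ≫ B.phi := by
  rw [Category.assoc, Category.assoc, h.mul, h.phi, reassoc_of% h.mul,
    tensorHom_comp_tensorHom_assoc, tensorHom_comp_tensorHom_assoc, h.phi]

theorem one_phi_iff (h : IsProj A B p) :
    (A.one ≫ A.phi) ≫ p = A.one ≫ p ↔ B.one ≫ B.phi = B.one := by
  rw [Category.assoc, h.phi, reassoc_of% h.one, h.one]

theorem theta_phi_iff (h : IsProj A B p) :
    (A.theta ▷ A.X ≫ A.mul ≫ A.phi) ≫ p = (A.theta ▷ A.X ≫ A.mul) ≫ p ↔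
      𝟙_ C ◁ p ≫ B.theta ▷ B.X ≫ B.mul ≫ B.phi = 𝟙_ C ◁ p ≫ B.theta ▷ B.X ≫ B.mul := by
  rw [Category.assoc, Category.assoc, Category.assoc, h.phi, reassoc_of% h.mul, h.mul,
    whiskerRight_comp_tensorHom_assoc, whiskerRight_comp_tensorHom_assoc, h.theta,
    tensorHom_def'_assoc, tensorHom_def'_assoc]

/-- Both sides start at the unit object, so no projection is left over on the side of `B` and
nothing has to be cancelled. Compatibility of `p` with the comultiplication is what brings it back
to `A.one`. -/
theorem klein_iff (h : IsProj A B p) :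
    (A.one ≫ A.comul ≫ A.phi ▷ A.X ≫ A.mul) ≫ p =
        ((λ_ (𝟙_ C)).inv ≫ (A.theta ⊗ₘ A.theta) ≫ A.mul) ≫ p ↔
      B.one ≫ B.comul ≫ B.phi ▷ B.X ≫ B.mul =
        (λ_ (𝟙_ C)).inv ≫ (B.theta ⊗ₘ B.theta) ≫ B.mul := by
  simp only [Category.assoc, h.mul, whiskerRight_comp_tensorHom_assoc, h.phi,
    tensorHom_comp_tensorHom_assoc, h.theta]
  rw [← tensorHom_comp_whiskerRight_assoc, reassoc_of% h.comul, reassoc_of% h.one]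

end IsProj

namespace IsIncl

variable {B A : ExtFrobData C} {i : B.X ⟶ A.X}

/-- Dual to the lemmas on projections: an inclusion is pushed through the axioms that begin with one
copy of the algebra. These go from `A` to a retract because `i` is mono, and from the summands to a
direct sum because the two inclusions are jointly epi. -/
theorem comul_assoc_iff (h : IsIncl B A i) :
    i ≫ A.comul ≫ A.comul ▷ A.X ≫ (α_ A.X A.X A.X).hom = i ≫ A.comul ≫ A.X ◁ A.comul ↔
      (B.comul ≫ B.comul ▷ B.X ≫ (α_ B.X B.X B.X).hom) ≫ (i ⊗ₘ i ⊗ₘ i) =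
        (B.comul ≫ B.X ◁ B.comul) ≫ (i ⊗ₘ i ⊗ₘ i) := by
  simp only [Category.assoc, ← associator_naturality, whiskerRight_comp_tensorHom_assoc,
    whiskerLeft_comp_tensorHom, h.comul]
  simp only [← tensorHom_comp_whiskerRight_assoc, ← tensorHom_comp_whiskerLeft, reassoc_of% h.comul]

theorem counit_comul_iff (h : IsIncl B A i) :
    i ≫ A.comul ≫ A.counit ▷ A.X ≫ (λ_ A.X).hom = i ≫ 𝟙 A.X ↔
      (B.comul ≫ B.counit ▷ B.X ≫ (λ_ B.X).hom) ≫ i = 𝟙 B.X ≫ i := by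
  rw [← reassoc_of% h.comul, tensorHom_comp_whiskerRight_assoc, h.counit,
    MonoidalCategory.tensorHom_def_assoc, leftUnitor_naturality]
  simp

theorem comul_counit_iff (h : IsIncl B A i) :
    i ≫ A.comul ≫ A.X ◁ A.counit ≫ (ρ_ A.X).hom = i ≫ 𝟙 A.X ↔
      (B.comul ≫ B.X ◁ B.counit ≫ (ρ_ B.X).hom) ≫ i = 𝟙 B.X ≫ i := by
  rw [← reassoc_of% h.comul, tensorHom_comp_whiskerLeft_assoc, h.counit,
    tensorHom_def'_assoc, rightUnitor_naturality]
  simp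

theorem comul_comm_iff (h : IsIncl B A i) [BraidedCategory C] :
    i ≫ A.comul ≫ (β_ A.X A.X).hom = i ≫ A.comul ↔
      (B.comul ≫ (β_ B.X B.X).hom) ≫ (i ⊗ₘ i) = B.comul ≫ (i ⊗ₘ i) := by
  rw [← reassoc_of% h.comul, ← h.comul, BraidedCategory.braiding_naturality, Category.assoc]

theorem phi_comul_iff (h : IsIncl B A i) :
    i ≫ A.phi ≫ A.comul = i ≫ A.comul ≫ (A.phi ⊗ₘ A.phi) ↔
      (B.phi ≫ B.comul) ≫ (i ⊗ₘ i) = (B.comul ≫ (B.phi ⊗ₘ B.phi)) ≫ (i ⊗ₘ i) := by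
  rw [← reassoc_of% h.phi, ← h.comul, ← reassoc_of% h.comul, tensorHom_comp_tensorHom, ← h.phi,
    Category.assoc, Category.assoc, tensorHom_comp_tensorHom]

theorem phi_counit_iff (h : IsIncl B A i) :
    i ≫ A.phi ≫ A.counit = i ≫ A.counit ↔ B.phi ≫ B.counit = B.counit := by
  rw [← reassoc_of% h.phi, h.counit]

theorem mul_comul (h : IsIncl B A i) : (i ⊗ₘ i) ≫ A.mul ≫ A.comul = (B.mul ≫ B.comul) ≫
    (i ⊗ₘ i) := by
  rw [← reassoc_of% h.mul, Category.assoc, h.comul]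

/-- The Frobenius relations have two inputs and two outputs. They are restricted along `i ⊗ i`, and
an inclusion passes through both products and coproducts. -/
theorem frobenius_left (h : IsIncl B A i) :
    (i ⊗ₘ i) ≫ A.comul ▷ A.X ≫ (α_ A.X A.X A.X).hom ≫ A.X ◁ A.mul =
      (B.comul ▷ B.X ≫ (α_ B.X B.X B.X).hom ≫ B.X ◁ B.mul) ≫ (i ⊗ₘ i) := by
  simp only [Category.assoc, tensorHom_comp_whiskerRight_assoc, ← h.comul,
    whiskerLeft_comp_tensorHom, h.mul]
  rw [← whiskerRight_comp_tensorHom_assoc, associator_naturality_assoc, tensorHom_comp_whiskerLeft]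

theorem frobenius_right (h : IsIncl B A i) :
    (i ⊗ₘ i) ≫ A.X ◁ A.comul ≫ (α_ A.X A.X A.X).inv ≫ A.mul ▷ A.X =
      (B.X ◁ B.comul ≫ (α_ B.X B.X B.X).inv ≫ B.mul ▷ B.X) ≫ (i ⊗ₘ i) := by
  simp only [Category.assoc, tensorHom_comp_whiskerLeft_assoc, ← h.comul,
    whiskerRight_comp_tensorHom, h.mul]
  rw [← whiskerLeft_comp_tensorHom_assoc, associator_inv_naturality_assoc,
    tensorHom_comp_whiskerRight]

theorem frobenius_left_iff (h : IsIncl B A i) :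
    (i ⊗ₘ i) ≫ A.comul ▷ A.X ≫ (α_ A.X A.X A.X).hom ≫ A.X ◁ A.mul =
        (i ⊗ₘ i) ≫ A.mul ≫ A.comul ↔
      (B.comul ▷ B.X ≫ (α_ B.X B.X B.X).hom ≫ B.X ◁ B.mul) ≫ (i ⊗ₘ i) =
        (B.mul ≫ B.comul) ≫ (i ⊗ₘ i) := by
  rw [h.mul_comul, h.frobenius_left]

theorem frobenius_right_iff (h : IsIncl B A i) :
    (i ⊗ₘ i) ≫ A.X ◁ A.comul ≫ (α_ A.X A.X A.X).inv ≫ A.mul ▷ A.X =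
        (i ⊗ₘ i) ≫ A.mul ≫ A.comul ↔
      (B.X ◁ B.comul ≫ (α_ B.X B.X B.X).inv ≫ B.mul ▷ B.X) ≫ (i ⊗ₘ i) =
        (B.mul ≫ B.comul) ≫ (i ⊗ₘ i) := by
  rw [h.mul_comul, h.frobenius_right]

end IsIncl

/-- A retract of an extended Frobenius algebra is one, if the inclusion and the retraction are
compatible with the structure maps. -/
theorem IsExtFrob.of_retract [BraidedCategory C] {A B : ExtFrobData C} (hA : A.IsExtFrob)
    {i : B.X ⟶ A.X} {p : A.X ⟶ B.X} (hi : IsIncl B A i) (hp : IsProj A B p) (hip : i ≫ p = 𝟙 _) :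
    B.IsExtFrob := by
  -- The tensor powers and whiskerings of `p` and `i` are split as well, so they can be cancelled
  -- from the axioms with several inputs or outputs.
  have : IsSplitEpi p := ⟨⟨i, hip⟩⟩
  have : IsSplitMono i := ⟨⟨p, hip⟩⟩
  have epi₂ : Epi (p ⊗ₘ p) := by
    have : IsSplitEpi (p ⊗ₘ p) := ⟨⟨i ⊗ₘ i, by simp [tensorHom_comp_tensorHom, hip]⟩⟩
    infer_instance
  have epi₃ : Epi ((p ⊗ₘ p) ⊗ₘ p) := by
    have : IsSplitEpi ((p ⊗ₘ p) ⊗ₘ p) :=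
      ⟨⟨(i ⊗ₘ i) ⊗ₘ i, by simp [tensorHom_comp_tensorHom, hip]⟩⟩
    infer_instance
  have mono₂ : Mono (i ⊗ₘ i) := by
    have : IsSplitMono (i ⊗ₘ i) := ⟨⟨p ⊗ₘ p, by simp [tensorHom_comp_tensorHom, hip]⟩⟩
    infer_instance
  have mono₃ : Mono (i ⊗ₘ i ⊗ₘ i) := by
    have : IsSplitMono (i ⊗ₘ i ⊗ₘ i) :=
      ⟨⟨p ⊗ₘ p ⊗ₘ p, by simp [tensorHom_comp_tensorHom, hip]⟩⟩
    infer_instance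
  have epiL : Epi (𝟙_ C ◁ p) := by
    have : IsSplitEpi (𝟙_ C ◁ p) := ⟨⟨𝟙_ C ◁ i, by rw [← whiskerLeft_comp, hip, whiskerLeft_id]⟩⟩
    infer_instance
  have epiR : Epi (p ▷ 𝟙_ C) := by
    have : IsSplitEpi (p ▷ 𝟙_ C) := ⟨⟨i ▷ 𝟙_ C, by rw [← comp_whiskerRight, hip, id_whiskerRight]⟩⟩
    infer_instance
  constructor
  · exact (cancel_epi _).1 (hp.mul_assoc_iff.1 (by rw [hA.mul_assoc]))
  · exact (cancel_epi _).1 (hp.one_mul_iff.1 (by rw [hA.one_mul]))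
  · exact (cancel_epi _).1 (hp.mul_one_iff.1 (by rw [hA.mul_one]))
  · exact (cancel_mono _).1 (hi.comul_assoc_iff.1 (by rw [hA.comul_assoc]))
  · exact (cancel_mono _).1 (hi.counit_comul_iff.1 (by rw [hA.counit_comul]))
  · exact (cancel_mono _).1 (hi.comul_counit_iff.1 (by rw [hA.comul_counit]))
  · exact (cancel_epi _).1 (hp.mul_comm_iff.1 (by rw [hA.mul_comm]))
  · exact (cancel_mono _).1 (hi.comul_comm_iff.1 (by rw [hA.comul_comm]))
  · exact (cancel_mono _).1 (hi.frobenius_left_iff.1 (by rw [hA.frobenius_left]))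
  · exact (cancel_mono _).1 (hi.frobenius_right_iff.1 (by rw [hA.frobenius_right]))
  · exact (cancel_epi _).1 (hp.phi_phi_iff.1 (by rw [hA.phi_phi]))
  · exact (cancel_epi _).1 (hp.mul_phi_iff.1 (by rw [hA.mul_phi]))
  · exact (cancel_mono _).1 (hi.phi_comul_iff.1 (by rw [hA.phi_comul]))
  · exact hp.one_phi_iff.1 (by rw [hA.one_phi])
  · exact hi.phi_counit_iff.1 (by rw [hA.phi_counit])
  · exact (cancel_epi _).1 (hp.theta_phi_iff.1 (by rw [hA.theta_phi]))
  · exact hp.klein_iff.1 (by rw [hA.klein])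

/-- The structure maps induced on a retract. -/
def retract (A : ExtFrobData C) {Y : C} (i : Y ⟶ A.X) (p : A.X ⟶ Y) : ExtFrobData C where
  X := Y
  mul := (i ⊗ₘ i) ≫ A.mul ≫ p
  one := A.one ≫ p
  comul := i ≫ A.comul ≫ (p ⊗ₘ p)
  counit := i ≫ A.counit
  phi := i ≫ A.phi ≫ p
  theta := A.theta ≫ p

/-- Endomorphisms which commute with the multiplication, the comultiplication and the
involution. -/
structure IsCentral (A : ExtFrobData C) (e : A.X ⟶ A.X) : Prop where
  mul_left : e ▷ A.X ≫ A.mul = A.mul ≫ e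
  mul_right : A.X ◁ e ≫ A.mul = A.mul ≫ e
  comul_left : A.comul ≫ e ▷ A.X = e ≫ A.comul
  comul_right : A.comul ≫ A.X ◁ e = e ≫ A.comul
  phi : A.phi ≫ e = e ≫ A.phi

namespace IsCentral

theorem id (A : ExtFrobData C) : A.IsCentral (𝟙 A.X) := by constructor <;> simp

theorem comp {A : ExtFrobData C} {e f : A.X ⟶ A.X} (he : A.IsCentral e) (hf : A.IsCentral f) :
    A.IsCentral (e ≫ f) where
  mul_left := by
    rw [comp_whiskerRight, Category.assoc, hf.mul_left, reassoc_of% he.mul_left]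
  mul_right := by
    rw [whiskerLeft_comp, Category.assoc, hf.mul_right, reassoc_of% he.mul_right]
  comul_left := by
    rw [comp_whiskerRight, reassoc_of% he.comul_left, hf.comul_left, Category.assoc]
  comul_right := by
    rw [whiskerLeft_comp, reassoc_of% he.comul_right, hf.comul_right, Category.assoc]
  phi := by rw [reassoc_of% he.phi, hf.phi, Category.assoc]

variable {A : ExtFrobData C} {Y : C} {i : Y ⟶ A.X} {p : A.X ⟶ Y}

/-- The structure maps of the retract contain copies of the idempotent `p ≫ i`. Centrality moves
them through the structure maps of `A` until they meet `p`, which absorbs them since `p ≫ i ≫ p =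
p`. -/
theorem isProj (hip : i ≫ p = 𝟙 Y) (he : A.IsCentral (p ≫ i)) : IsProj A (A.retract i p) p := by
  have hp : p ≫ i ≫ p = p := by rw [hip, Category.comp_id]
  constructor <;> dsimp only [retract]
  · rw [tensorHom_comp_tensorHom_assoc, MonoidalCategory.tensorHom_def_assoc,
      reassoc_of% he.mul_right, reassoc_of% he.mul_left]
    simp only [hp]
  · rw [← reassoc_of% he.comul_left, whiskerRight_comp_tensorHom, Category.assoc, hp]
  · rw [← reassoc_of% he.phi, hp]

theorem isIncl (hip : i ≫ p = 𝟙 Y) (he : A.IsCentral (p ≫ i)) : IsIncl (A.retract i p) A i := by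
  have hi : i ≫ p ≫ i = i := by rw [← Category.assoc, hip, Category.id_comp]
  constructor <;> dsimp only [retract]
  · rw [Category.assoc, Category.assoc, ← he.mul_left, tensorHom_comp_whiskerRight_assoc, hi]
  · rw [Category.assoc, Category.assoc, tensorHom_comp_tensorHom,
      MonoidalCategory.tensorHom_def, reassoc_of% he.comul_left, he.comul_right]
    simp only [reassoc_of% hi, Category.assoc]
  · rw [Category.assoc, Category.assoc, he.phi]
    simp only [reassoc_of% hi, Category.assoc]

theorem isExtFrob_retract (hip : i ≫ p = 𝟙 Y) (he : A.IsCentral (p ≫ i)) [BraidedCategory C]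
    (hA : A.IsExtFrob) : (A.retract i p).IsExtFrob :=
  hA.of_retract (isIncl hip he) (isProj hip he) hip

end IsCentral

/-- Two retracts with the same idempotent are isomorphic. -/
theorem isomorphic_of_idempotent_eq {A B B' : ExtFrobData C} {i : B.X ⟶ A.X} {p : A.X ⟶ B.X}
    {i' : B'.X ⟶ A.X} {p' : A.X ⟶ B'.X} (hi : IsIncl B A i) (hip : i ≫ p = 𝟙 _)
    (hp : IsProj A B p) (hi' : IsIncl B' A i') (hip' : i' ≫ p' = 𝟙 _) (hp' : IsProj A B' p')
    (h : p ≫ i = p' ≫ i') : Isomorphic B B' := by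
  have hi₁ : i ≫ p' ≫ i' = i := by rw [← h, reassoc_of% hip]
  have hp₁ : p ≫ i ≫ p' = p' := by rw [reassoc_of% h, hip', Category.comp_id]
  -- The isomorphism goes through `A`. The equality of idempotents makes `i` insensitive to `p' ≫
  -- i'`, and `p'` insensitive to `p ≫ i`.
  refine ⟨⟨i ≫ p', i' ≫ p, ?_, ?_⟩, ?_⟩
  · rw [Category.assoc, reassoc_of% hi₁, hip]
  · rw [Category.assoc, hp₁, hip']
  constructor <;> dsimp only
  · rw [reassoc_of% hi.mul, hp'.mul, tensorHom_comp_tensorHom_assoc]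
  · rw [← hp.one, Category.assoc, hp₁, hp'.one]
  · rw [← tensorHom_comp_tensorHom, reassoc_of% hi.comul, hp'.comul, Category.assoc]
  · rw [← hi'.counit, Category.assoc, reassoc_of% hi₁, hi.counit]
  · rw [reassoc_of% hi.phi, hp'.phi, Category.assoc]
  · rw [← hp.theta, Category.assoc, hp₁, hp'.theta]

theorem IsHom.isProj {A B : ExtFrobData C} {f : A.X ⟶ B.X} (h : IsHom A B f) : IsProj A B f :=
  ⟨h.mul, h.one, h.comul, h.phi, h.theta⟩

theorem IsHom.isIncl {A B : ExtFrobData C} {f : A.X ⟶ B.X} (h : IsHom A B f) : IsIncl A B f :=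
  ⟨h.mul, h.comul, h.counit, h.phi⟩

theorem IsProj.comp {A B D : ExtFrobData C} {f : A.X ⟶ B.X} {g : B.X ⟶ D.X} (hf : IsProj A B f)
    (hg : IsProj B D g) : IsProj A D (f ≫ g) where
  mul := by rw [reassoc_of% hf.mul, hg.mul, tensorHom_comp_tensorHom_assoc]
  one := by rw [reassoc_of% hf.one, hg.one]
  comul := by rw [← tensorHom_comp_tensorHom, reassoc_of% hf.comul, hg.comul, Category.assoc]
  phi := by rw [reassoc_of% hf.phi, hg.phi, Category.assoc]
  theta := by rw [reassoc_of% hf.theta, hg.theta]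

theorem IsIncl.comp {A B D : ExtFrobData C} {f : A.X ⟶ B.X} {g : B.X ⟶ D.X} (hf : IsIncl A B f)
    (hg : IsIncl B D g) : IsIncl A D (f ≫ g) where
  mul := by rw [reassoc_of% hf.mul, hg.mul, tensorHom_comp_tensorHom_assoc]
  comul := by rw [← tensorHom_comp_tensorHom, reassoc_of% hf.comul, hg.comul, Category.assoc]
  counit := by rw [Category.assoc, hg.counit, hf.counit]
  phi := by rw [reassoc_of% hf.phi, hg.phi, Category.assoc]

open Functor.LaxMonoidal Functor.OplaxMonoidal in
theorem IsProj.map {D : Type u'} [Category.{v'} D] [MonoidalCategory D] {A B : ExtFrobData C}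
    {f : A.X ⟶ B.X} (h : IsProj A B f) (F : C ⥤ D) [F.Monoidal] :
    IsProj (A.map F) (B.map F) (F.map f) := by
  constructor <;> dsimp only [ExtFrobData.map]
  · rw [Category.assoc, ← F.map_comp, h.mul, μ_natural_assoc, ← F.map_comp]
  · rw [Category.assoc, ← F.map_comp, h.one]
  · rw [Category.assoc, δ_natural, ← F.map_comp_assoc, h.comul, F.map_comp_assoc]
  · rw [← F.map_comp, h.phi, F.map_comp]
  · rw [Category.assoc, ← F.map_comp, h.theta]

open Functor.LaxMonoidal Functor.OplaxMonoidal in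
theorem IsIncl.map {D : Type u'} [Category.{v'} D] [MonoidalCategory D] {A B : ExtFrobData C}
    {f : A.X ⟶ B.X} (h : IsIncl A B f) (F : C ⥤ D) [F.Monoidal] :
    IsIncl (A.map F) (B.map F) (F.map f) := by
  constructor <;> dsimp only [ExtFrobData.map]
  · rw [Category.assoc, ← F.map_comp, h.mul, μ_natural_assoc, ← F.map_comp]
  · rw [Category.assoc, δ_natural, ← F.map_comp_assoc, h.comul, F.map_comp_assoc]
  · rw [← F.map_comp_assoc, h.counit]
  · rw [← F.map_comp, h.phi, F.map_comp]

end Summands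

/-! ### Direct sums of extended Frobenius algebras. -/

section DirectSum

open Limits

variable {C : Type u} [Category.{v} C] [MonoidalCategory C] [Preadditive C]

/-- Direct sum decompositions which are compatible with the structure maps. -/
structure IsDirectSum {A B D : ExtFrobData C} (i : A.X ⟶ D.X) (p : D.X ⟶ A.X) (j : B.X ⟶ D.X)
    (q : D.X ⟶ B.X) : Prop where
  incl_left : IsIncl A D i
  proj_left : IsProj D A p
  incl_right : IsIncl B D j
  proj_right : IsProj D B q
  inl_fst : i ≫ p = 𝟙 A.X
  inr_snd : j ≫ q = 𝟙 B.X
  inl_snd : i ≫ q = 0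
  inr_fst : j ≫ p = 0
  total : p ≫ i + q ≫ j = 𝟙 D.X

namespace IsDirectSum

variable {A B D : ExtFrobData C} {i : A.X ⟶ D.X} {p : D.X ⟶ A.X} {j : B.X ⟶ D.X} {q : D.X ⟶ B.X}

theorem symm (h : IsDirectSum i p j q) : IsDirectSum j q i p where
  incl_left := h.incl_right
  proj_left := h.proj_right
  incl_right := h.incl_left
  proj_right := h.proj_left
  inl_fst := h.inr_snd
  inr_snd := h.inl_fst
  inl_snd := h.inr_fst
  inr_fst := h.inl_snd
  total := (add_comm _ _).trans h.total

theorem hom_ext (h : IsDirectSum i p j q) {Z : C} {f g : Z ⟶ D.X} (h₁ : f ≫ p = g ≫ p)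
    (h₂ : f ≫ q = g ≫ q) : f = g := by
  rw [← Category.comp_id f, ← Category.comp_id g, ← h.total]
  simp only [Preadditive.comp_add, reassoc_of% h₁, reassoc_of% h₂]

theorem hom_ext' (h : IsDirectSum i p j q) {Z : C} {f g : D.X ⟶ Z} (h₁ : i ≫ f = i ≫ g)
    (h₂ : j ≫ f = j ≫ g) : f = g := by
  rw [← Category.id_comp f, ← Category.id_comp g, ← h.total]
  simp only [Preadditive.add_comp, Category.assoc, h₁, h₂]

/-- The comparison map is `p ≫ i' + q ≫ j'`. Its compatibility with product, unit and crosscap is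
tested after the projections of the target, and with coproduct, counit and involution on the
inclusions of the source; in each case the needed compatibility is part of the definition of a
projection or of an inclusion. -/
theorem isomorphic (h : IsDirectSum i p j q) {D' : ExtFrobData C} {i' : A.X ⟶ D'.X}
    {p' : D'.X ⟶ A.X} {j' : B.X ⟶ D'.X}
    {q' : D'.X ⟶ B.X} (h' : IsDirectSum i' p' j' q') : Isomorphic D D' := by
  have hi : i ≫ (p ≫ i' + q ≫ j') = i' := by
    rw [Preadditive.comp_add, reassoc_of% h.inl_fst, reassoc_of% h.inl_snd, zero_comp, add_zero]
  have hj : j ≫ (p ≫ i' + q ≫ j') = j' := by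
    rw [Preadditive.comp_add, reassoc_of% h.inr_fst, reassoc_of% h.inr_snd, zero_comp, zero_add]
  have hi' : i' ≫ (p' ≫ i + q' ≫ j) = i := by
    rw [Preadditive.comp_add, reassoc_of% h'.inl_fst, reassoc_of% h'.inl_snd, zero_comp, add_zero]
  have hj' : j' ≫ (p' ≫ i + q' ≫ j) = j := by
    rw [Preadditive.comp_add, reassoc_of% h'.inr_fst, reassoc_of% h'.inr_snd, zero_comp, zero_add]
  have hp : (p ≫ i' + q ≫ j') ≫ p' = p := by
    simp only [Preadditive.add_comp, Category.assoc, h'.inl_fst, h'.inr_fst, Category.comp_id,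
      comp_zero, add_zero]
  have hq : (p ≫ i' + q ≫ j') ≫ q' = q := by
    simp only [Preadditive.add_comp, Category.assoc, h'.inl_snd, h'.inr_snd, Category.comp_id,
      comp_zero, zero_add]
  have h₁ := h.incl_left
  have h₂ := h.incl_right
  have h₁' := h'.incl_left
  have h₂' := h'.incl_right
  refine ⟨⟨p ≫ i' + q ≫ j', p' ≫ i + q' ≫ j, ?_, ?_⟩, ?_⟩
  · exact h.hom_ext' (by rw [reassoc_of% hi, hi', Category.comp_id])
      (by rw [reassoc_of% hj, hj', Category.comp_id])
  · exact h'.hom_ext' (by rw [reassoc_of% hi', hi, Category.comp_id])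
      (by rw [reassoc_of% hj', hj, Category.comp_id])
  constructor <;> dsimp only
  · refine h'.hom_ext ?_ ?_
    · rw [Category.assoc, hp, h.proj_left.mul, Category.assoc, h'.proj_left.mul,
        tensorHom_comp_tensorHom_assoc, hp]
    · rw [Category.assoc, hq, h.proj_right.mul, Category.assoc, h'.proj_right.mul,
        tensorHom_comp_tensorHom_assoc, hq]
  · refine h'.hom_ext ?_ ?_
    · rw [Category.assoc, hp, h.proj_left.one, h'.proj_left.one]
    · rw [Category.assoc, hq, h.proj_right.one, h'.proj_right.one]
  · refine h.hom_ext' ?_ ?_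
    · rw [← reassoc_of% h₁.comul, tensorHom_comp_tensorHom, reassoc_of% hi, hi, h₁'.comul]
    · rw [← reassoc_of% h₂.comul, tensorHom_comp_tensorHom, reassoc_of% hj, hj, h₂'.comul]
  · refine h.hom_ext' ?_ ?_
    · rw [reassoc_of% hi, h₁'.counit, h₁.counit]
    · rw [reassoc_of% hj, h₂'.counit, h₂.counit]
  · refine h.hom_ext' ?_ ?_
    · rw [← reassoc_of% h₁.phi, reassoc_of% hi, hi, h₁'.phi]
    · rw [← reassoc_of% h₂.phi, reassoc_of% hj, hj, h₂'.phi]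
  · refine h'.hom_ext ?_ ?_
    · rw [Category.assoc, hp, h.proj_left.theta, h'.proj_left.theta]
    · rw [Category.assoc, hq, h.proj_right.theta, h'.proj_right.theta]

theorem of_isomorphic (h : IsDirectSum i p j q) {A' B' : ExtFrobData C} {e : A'.X ≅ A.X}
    {f : B'.X ≅ B.X}
    (he : IsHom A' A e.hom) (hf : IsHom B' B f.hom) :
    IsDirectSum (A := A') (B := B') (e.hom ≫ i) (p ≫ e.inv) (f.hom ≫ j) (q ≫ f.inv) where
  incl_left := he.isIncl.comp h.incl_left
  proj_left := h.proj_left.comp he.symm.isProj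
  incl_right := hf.isIncl.comp h.incl_right
  proj_right := h.proj_right.comp hf.symm.isProj
  inl_fst := by rw [Category.assoc, reassoc_of% h.inl_fst, Iso.hom_inv_id]
  inr_snd := by rw [Category.assoc, reassoc_of% h.inr_snd, Iso.hom_inv_id]
  inl_snd := by rw [Category.assoc, reassoc_of% h.inl_snd, zero_comp, comp_zero]
  inr_fst := by rw [Category.assoc, reassoc_of% h.inr_fst, zero_comp, comp_zero]
  total := by
    simp only [Category.assoc, Iso.inv_hom_id_assoc]
    exact h.total

theorem map (h : IsDirectSum i p j q) {E : Type u'} [Category.{v'} E] [MonoidalCategory E]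
    [Preadditive E] (F : C ⥤ E)
    [F.Monoidal] [F.Additive] :
    IsDirectSum (A := A.map F) (B := B.map F) (D := D.map F)
      (F.map i) (F.map p) (F.map j) (F.map q) where
  incl_left := h.incl_left.map F
  proj_left := h.proj_left.map F
  incl_right := h.incl_right.map F
  proj_right := h.proj_right.map F
  inl_fst := (F.map_comp i p).symm.trans ((congrArg F.map h.inl_fst).trans (F.map_id A.X))
  inr_snd := (F.map_comp j q).symm.trans ((congrArg F.map h.inr_snd).trans (F.map_id B.X))
  inl_snd := (F.map_comp i q).symm.trans ((congrArg F.map h.inl_snd).trans (F.map_zero _ _))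
  inr_fst := (F.map_comp j p).symm.trans ((congrArg F.map h.inr_fst).trans (F.map_zero _ _))
  total := by
    have := congrArg F.map h.total
    rw [F.map_add, F.map_comp, F.map_comp, F.map_id] at this
    exact this

variable [MonoidalPreadditive C]

/-- Expanding `(p ≫ i + q ≫ j) ⊗ (p ≫ i + q ≫ j)` writes the identity of `D ⊗ D` as a sum over four
blocks. This is the test used for the Frobenius relations, whose source is a tensor square. -/
theorem tensor_hom_ext (h : IsDirectSum i p j q) {Z : C} {f g : D.X ⊗ D.X ⟶ Z}
    (h₁ : (i ⊗ₘ i) ≫ f = (i ⊗ₘ i) ≫ g)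
    (h₂ : (i ⊗ₘ j) ≫ f = (i ⊗ₘ j) ≫ g) (h₃ : (j ⊗ₘ i) ≫ f = (j ⊗ₘ i) ≫ g)
    (h₄ : (j ⊗ₘ j) ≫ f = (j ⊗ₘ j) ≫ g) : f = g := by
  have key : 𝟙 (D.X ⊗ D.X) =
      (p ⊗ₘ p) ≫ (i ⊗ₘ i) + (p ⊗ₘ q) ≫ (i ⊗ₘ j) +
        ((q ⊗ₘ p) ≫ (j ⊗ₘ i) + (q ⊗ₘ q) ≫ (j ⊗ₘ j)) := by
    simp only [tensorHom_comp_tensorHom, ← MonoidalPreadditive.tensor_add, h.total,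
      ← MonoidalPreadditive.add_tensor, id_tensorHom_id]
  rw [← Category.id_comp f, ← Category.id_comp g, key]
  simp only [Preadditive.add_comp, Category.assoc, h₁, h₂, h₃, h₄]

/-- The summands are orthogonal ideals: both projections are multiplicative, and each of them kills
one of the two factors. -/
theorem inl_tensor_inr_mul (h : IsDirectSum i p j q) : (i ⊗ₘ j) ≫ D.mul = 0 := by
  refine h.hom_ext ?_ ?_
  · rw [Category.assoc, h.proj_left.mul, tensorHom_comp_tensorHom_assoc, h.inr_fst,
      MonoidalAux.tensor_zero, zero_comp, zero_comp]
  · rw [Category.assoc, h.proj_right.mul, tensorHom_comp_tensorHom_assoc, h.inl_snd,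
      MonoidalAux.zero_tensor, zero_comp, zero_comp]

theorem inr_tensor_inl_mul (h : IsDirectSum i p j q) : (j ⊗ₘ i) ≫ D.mul = 0 := by
  refine h.hom_ext ?_ ?_
  · rw [Category.assoc, h.proj_left.mul, tensorHom_comp_tensorHom_assoc, h.inr_fst,
      MonoidalAux.zero_tensor, zero_comp, zero_comp]
  · rw [Category.assoc, h.proj_right.mul, tensorHom_comp_tensorHom_assoc, h.inl_snd,
      MonoidalAux.tensor_zero, zero_comp, zero_comp]

/-- Axioms that end at `D` are tested after `p` and `q`, and coalgebra axioms before `i` and `j`.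
The Frobenius relations are tested on the four blocks of `D ⊗ D`: the diagonal blocks are the
relations of the summands, and on the mixed blocks both sides vanish. -/
theorem isExtFrob (h : IsDirectSum i p j q) [BraidedCategory C] (hA : A.IsExtFrob)
    (hB : B.IsExtFrob) : D.IsExtFrob := by
  have p₁ := h.proj_left
  have p₂ := h.proj_right
  have i₁ := h.incl_left
  have i₂ := h.incl_right
  have z₁ := h.inl_tensor_inr_mul
  have z₂ := h.inr_tensor_inl_mul
  constructor
  · exact h.hom_ext (p₁.mul_assoc_iff.2 (by rw [hA.mul_assoc]))
      (p₂.mul_assoc_iff.2 (by rw [hB.mul_assoc]))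
  · exact h.hom_ext (p₁.one_mul_iff.2 (by rw [hA.one_mul]))
      (p₂.one_mul_iff.2 (by rw [hB.one_mul]))
  · exact h.hom_ext (p₁.mul_one_iff.2 (by rw [hA.mul_one]))
      (p₂.mul_one_iff.2 (by rw [hB.mul_one]))
  · exact h.hom_ext' (i₁.comul_assoc_iff.2 (by rw [hA.comul_assoc]))
      (i₂.comul_assoc_iff.2 (by rw [hB.comul_assoc]))
  · exact h.hom_ext' (i₁.counit_comul_iff.2 (by rw [hA.counit_comul]))
      (i₂.counit_comul_iff.2 (by rw [hB.counit_comul]))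
  · exact h.hom_ext' (i₁.comul_counit_iff.2 (by rw [hA.comul_counit]))
      (i₂.comul_counit_iff.2 (by rw [hB.comul_counit]))
  · exact h.hom_ext (p₁.mul_comm_iff.2 (by rw [hA.mul_comm]))
      (p₂.mul_comm_iff.2 (by rw [hB.mul_comm]))
  · exact h.hom_ext' (i₁.comul_comm_iff.2 (by rw [hA.comul_comm]))
      (i₂.comul_comm_iff.2 (by rw [hB.comul_comm]))
  · refine h.tensor_hom_ext (i₁.frobenius_left_iff.2 (by rw [hA.frobenius_left])) ?_ ?_
      (i₂.frobenius_left_iff.2 (by rw [hB.frobenius_left]))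
    -- On a mixed block `m ≫ Δ` vanishes at once. On the other side the coproduct of one summand
    -- stays inside that summand, so the product that follows multiplies elements of different
    -- summands.
    · rw [reassoc_of% z₁, zero_comp, tensorHom_comp_whiskerRight_assoc, ← i₁.comul,
        ← whiskerRight_comp_tensorHom_assoc, associator_naturality_assoc,
        tensorHom_comp_whiskerLeft, z₁, MonoidalAux.tensor_zero, comp_zero, comp_zero]
    · rw [reassoc_of% z₂, zero_comp, tensorHom_comp_whiskerRight_assoc, ← i₂.comul,
        ← whiskerRight_comp_tensorHom_assoc, associator_naturality_assoc,
        tensorHom_comp_whiskerLeft, z₂, MonoidalAux.tensor_zero, comp_zero, comp_zero]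
  · refine h.tensor_hom_ext (i₁.frobenius_right_iff.2 (by rw [hA.frobenius_right])) ?_ ?_
      (i₂.frobenius_right_iff.2 (by rw [hB.frobenius_right]))
    · rw [reassoc_of% z₁, zero_comp, tensorHom_comp_whiskerLeft_assoc, ← i₂.comul,
        ← whiskerLeft_comp_tensorHom_assoc, associator_inv_naturality_assoc,
        tensorHom_comp_whiskerRight, z₁, MonoidalAux.zero_tensor, comp_zero, comp_zero]
    · rw [reassoc_of% z₂, zero_comp, tensorHom_comp_whiskerLeft_assoc, ← i₁.comul,
        ← whiskerLeft_comp_tensorHom_assoc, associator_inv_naturality_assoc,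
        tensorHom_comp_whiskerRight, z₂, MonoidalAux.zero_tensor, comp_zero, comp_zero]
  · exact h.hom_ext (p₁.phi_phi_iff.2 (by rw [hA.phi_phi]))
      (p₂.phi_phi_iff.2 (by rw [hB.phi_phi]))
  · exact h.hom_ext (p₁.mul_phi_iff.2 (by rw [hA.mul_phi]))
      (p₂.mul_phi_iff.2 (by rw [hB.mul_phi]))
  · exact h.hom_ext' (i₁.phi_comul_iff.2 (by rw [hA.phi_comul]))
      (i₂.phi_comul_iff.2 (by rw [hB.phi_comul]))
  · exact h.hom_ext (p₁.one_phi_iff.2 (by rw [hA.one_phi]))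
      (p₂.one_phi_iff.2 (by rw [hB.one_phi]))
  · exact h.hom_ext' (i₁.phi_counit_iff.2 (by rw [hA.phi_counit]))
      (i₂.phi_counit_iff.2 (by rw [hB.phi_counit]))
  · exact h.hom_ext (p₁.theta_phi_iff.2 (by rw [hA.theta_phi]))
      (p₂.theta_phi_iff.2 (by rw [hB.theta_phi]))
  · exact h.hom_ext (p₁.klein_iff.2 (by rw [hA.klein]))
      (p₂.klein_iff.2 (by rw [hB.klein]))

end IsDirectSum

variable [MonoidalPreadditive C] [HasBinaryBiproducts C]

theorem isProj_fst (A B : ExtFrobData C) : IsProj (oplus A B) A biprod.fst := by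
  constructor <;> dsimp only [oplus]
  · simp
  · simp
  · simp [tensorHom_comp_tensorHom, MonoidalAux.tensor_zero]
  · simp
  · simp

theorem isProj_snd (A B : ExtFrobData C) : IsProj (oplus A B) B biprod.snd := by
  constructor <;> dsimp only [oplus]
  · simp
  · simp
  · simp [tensorHom_comp_tensorHom, MonoidalAux.tensor_zero]
  · simp
  · simp

theorem isIncl_inl (A B : ExtFrobData C) : IsIncl A (oplus A B) biprod.inl := by
  constructor <;> dsimp only [oplus]
  · simp [tensorHom_comp_tensorHom_assoc, MonoidalAux.tensor_zero]
  · simp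
  · simp
  · simp

theorem isIncl_inr (A B : ExtFrobData C) : IsIncl B (oplus A B) biprod.inr := by
  constructor <;> dsimp only [oplus]
  · simp [tensorHom_comp_tensorHom_assoc, MonoidalAux.tensor_zero]
  · simp
  · simp
  · simp

theorem isDirectSum_oplus (A B : ExtFrobData C) :
    IsDirectSum (D := oplus A B) (biprod.inl : A.X ⟶ A.X ⊞ B.X) (biprod.fst : A.X ⊞ B.X ⟶ A.X)
      (biprod.inr : B.X ⟶ A.X ⊞ B.X) (biprod.snd : A.X ⊞ B.X ⟶ B.X) where
  incl_left := isIncl_inl A B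
  proj_left := isProj_fst A B
  incl_right := isIncl_inr A B
  proj_right := isProj_snd A B
  inl_fst := biprod.inl_fst
  inr_snd := biprod.inr_snd
  inl_snd := biprod.inl_snd
  inr_fst := biprod.inr_fst
  total := biprod.total

end DirectSum

end ExtFrobData

/-! ### Polynomials in the handle endomorphism and linear recurrences. -/

section

open Polynomial

/-- The power of `X` is built up one factor at a time, so a property of all polynomials in the
handle only has to survive sums, scalars and one further handle. -/
theorem Polynomial.induction_mul_X {k : Type*} [Semiring k] {P : k[X] → Prop} (f : k[X])
    (add : ∀ f g, P f → P g → P (f + g)) (smul : ∀ (r : k) (f : k[X]), P f → P (r • f))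
    (one : P 1) (mul_X : ∀ f, P f → P (f * X)) : P f := by
  refine Polynomial.induction_on' f add fun n r => ?_
  rw [← mul_one r, ← smul_eq_mul, ← smul_monomial, monomial_one_right_eq_X_pow]
  refine smul r _ ?_
  induction n with
  | zero => rwa [pow_zero]
  | succ n ih => rw [pow_succ]; exact mul_X _ ih

/-- The linear functional on polynomials with values `a n` at `X ^ n`. -/
def evalSeq {k : Type w} [Field k] (a : ℕ → k) : k[X] →ₗ[k] k :=
  Polynomial.lsum fun n => LinearMap.toSpanSingleton k k (a n)

theorem evalSeq_apply {k : Type w} [Field k] (a : ℕ → k) (f : k[X]) :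
    evalSeq a f = f.sum fun n c => c * a n := by
  simp [evalSeq, Polynomial.lsum_apply]

theorem evalSeq_X_pow {k : Type w} [Field k] (a : ℕ → k) (n : ℕ) : evalSeq a (X ^ n) = a n := by
  simp [evalSeq_apply, ← monomial_one_right_eq_X_pow, Polynomial.sum_monomial_index]

theorem evalSeq_add {k : Type w} [Field k] (a b : ℕ → k) (f : k[X]) :
    evalSeq (a + b) f = evalSeq a f + evalSeq b f := by
  simp [evalSeq_apply, Polynomial.sum_def, mul_add, Finset.sum_add_distrib]

/-- A recurrence for the coefficients of a rational power series. -/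
theorem evalSeq_reflect_mul {k : Type w} [Field k] {a : ℕ → k} {p q : k[X]}
    (h : PowerSeries.mk a * (q : PowerSeries k) = p) {K : ℕ} (hp : p.natDegree < K)
    (hq : q.natDegree ≤ K) (f : k[X]) : evalSeq a (q.reflect K * f) = 0 := by
  induction f using Polynomial.induction_on' with
  | add f g hf hg => rw [mul_add, map_add, hf, hg, add_zero]
  | monomial j r =>
    rw [← C_mul_X_pow_eq_monomial, ← smul_eq_C_mul, mul_smul_comm, map_smul]
    suffices H : evalSeq a (q.reflect K * X ^ j) = 0 by rw [H, smul_zero]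
    -- Compare coefficients at `K + j` in `a(X) q = p`. The right side contributes zero because `deg
    -- p < K`, and the Cauchy product on the left is the recurrence sought.
    have hcoeff := congrArg (PowerSeries.coeff (K + j)) h
    rw [Polynomial.coeff_coe, coeff_eq_zero_of_natDegree_lt (by omega), PowerSeries.coeff_mul,
      Finset.Nat.sum_antidiagonal_eq_sum_range_succ_mk] at hcoeff
    rw [← hcoeff, evalSeq_apply, Polynomial.sum_over_range' _ (by simp) (K + j + 1)]
    · refine Finset.sum_congr rfl fun m hm => ?_
      have hm' : m ≤ K + j := by simpa [Nat.lt_succ_iff] using hm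
      rw [PowerSeries.coeff_mk, Polynomial.coeff_coe, coeff_mul_X_pow', mul_comm]
      congr 1
      split_ifs with hj
      · rw [coeff_reflect, revAt_le (by omega)]
        congr 1
        omega
      -- For `m < j` the factor `X ^ j` makes the coefficient zero. The Cauchy product has no term
      -- there either, since its index `K + j - m` exceeds `K ≥ deg q`.
      · rw [coeff_eq_zero_of_natDegree_lt (by omega)]
    · refine Nat.lt_succ_of_le (natDegree_mul_le.trans (Nat.add_le_add ?_ (natDegree_X_pow_le j)))
      refine natDegree_le_iff_coeff_eq_zero.2 fun m hm => ?_
      rw [coeff_reflect, revAt_eq_self_of_lt hm, coeff_eq_zero_of_natDegree_lt (by omega)]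

namespace SkeinTriple

variable {k : Type w} [Field k] (T : SkeinTriple k)

/-- The recurrence applies with the number `K` that defines the handle polynomial. It exceeds `deg
p_α` because of the `+ 1` in its definition, and the bounds on `deg p_β` and `deg p_γ` make the same
polynomial annihilate the other two sequences. -/
theorem evalSeq_α (f : k[X]) : evalSeq T.α (T.handlePoly * f) = 0 :=
  evalSeq_reflect_mul T.gen_α (lt_max_of_lt_left (Nat.lt_succ_self _)) (le_max_right _ _) f

theorem evalSeq_β (f : k[X]) : evalSeq T.β (T.handlePoly * f) = 0 :=
  evalSeq_reflect_mul T.gen_β T.degree_β (le_max_right _ _) f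

theorem evalSeq_γ (f : k[X]) : evalSeq T.γ (T.handlePoly * f) = 0 :=
  evalSeq_reflect_mul T.gen_γ T.degree_γ (le_max_right _ _) f

end SkeinTriple

namespace ExtFrobData

section Handle

variable {C : Type u} [Category.{v} C] [MonoidalCategory C] {A : ExtFrobData C}

/-- Associativity and a Frobenius relation let a handle slide from one input of a product to its
output; coassociativity and the other Frobenius relation do the same for coproducts. The second
input and output follow by commutativity. The involution commutes with `m Δ` because it is an
automorphism of both structures. -/
theorem IsExtFrob.isCentral_handle [BraidedCategory C] (h : A.IsExtFrob) :
    A.IsCentral (A.comul ≫ A.mul) := by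
  have hl : (A.comul ≫ A.mul) ▷ A.X ≫ A.mul = A.mul ≫ A.comul ≫ A.mul := by
    rw [comp_whiskerRight, Category.assoc, h.mul_assoc, reassoc_of% h.frobenius_left]
  have hc : A.comul ≫ (A.comul ≫ A.mul) ▷ A.X = (A.comul ≫ A.mul) ≫ A.comul := by
    rw [comp_whiskerRight, Category.assoc, ← h.frobenius_right, ← reassoc_of% h.comul_assoc,
      Iso.hom_inv_id_assoc]
  constructor
  · exact hl
  · calc A.X ◁ (A.comul ≫ A.mul) ≫ A.mul
        = A.X ◁ (A.comul ≫ A.mul) ≫ (β_ A.X A.X).hom ≫ A.mul := by rw [h.mul_comm]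
      _ = A.mul ≫ A.comul ≫ A.mul := by
        rw [BraidedCategory.braiding_naturality_right_assoc, hl, reassoc_of% h.mul_comm]
  · exact hc
  · calc A.comul ≫ A.X ◁ (A.comul ≫ A.mul)
        = (A.comul ≫ (β_ A.X A.X).hom) ≫ A.X ◁ (A.comul ≫ A.mul) := by rw [h.comul_comm]
      _ = (A.comul ≫ A.mul) ≫ A.comul := by
        rw [Category.assoc, ← BraidedCategory.braiding_naturality_left, ← Category.assoc, hc,
          Category.assoc, h.comul_comm]
  · rw [← Category.assoc, h.phi_comul, Category.assoc, h.mul_phi, Category.assoc]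

variable {k : Type w} [Field k] [Preadditive C] [Linear k C]

/-- A polynomial in the handle endomorphism. -/
def polyHandle (A : ExtFrobData C) (f : k[X]) : A.X ⟶ A.X := aeval A.handle f

theorem polyHandle_add (f g : k[X]) : A.polyHandle (f + g) = A.polyHandle f + A.polyHandle g :=
  map_add (aeval A.handle) f g

theorem polyHandle_smul (r : k) (f : k[X]) : A.polyHandle (r • f) = r • A.polyHandle f :=
  map_smul (aeval A.handle) r f

theorem polyHandle_one : A.polyHandle (1 : k[X]) = 𝟙 A.X := map_one (aeval A.handle)

theorem polyHandle_mul (f g : k[X]) : A.polyHandle (f * g) = A.polyHandle f ≫ A.polyHandle g := by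
  -- Multiplication in `End` is composition in the reverse order. For polynomials in one
  -- endomorphism this is harmless.
  rw [mul_comm]
  exact map_mul (aeval A.handle) g f

theorem polyHandle_X : A.polyHandle (Polynomial.X : k[X]) = A.comul ≫ A.mul := aeval_X A.handle

theorem polyHandle_X_pow (g : ℕ) : A.polyHandle (Polynomial.X ^ g : k[X]) = A.handlePow g :=
  aeval_X_pow A.handle

/-- The handle is made of the product and the coproduct alone. A map compatible with these two
intertwines the handles, whatever it does to unit and counit, so the same argument serves for
projections and inclusions. -/
theorem IsProj.polyHandle {B : ExtFrobData C} {p : A.X ⟶ B.X} (h : IsProj A B p) (f : k[X]) :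
    A.polyHandle f ≫ p = p ≫ B.polyHandle f := by
  induction f using Polynomial.induction_mul_X with
  | add f g hf hg => simp only [polyHandle_add, Preadditive.add_comp, Preadditive.comp_add, hf, hg]
  | smul r f hf => simp only [polyHandle_smul, Linear.smul_comp, Linear.comp_smul, hf]
  | one => simp only [polyHandle_one, Category.id_comp, Category.comp_id]
  | mul_X f hf =>
    simp only [polyHandle_mul, polyHandle_X, Category.assoc, h.mul, reassoc_of% h.comul,
      reassoc_of% hf]

theorem IsIncl.polyHandle {B : ExtFrobData C} {i : A.X ⟶ B.X} (h : IsIncl A B i) (f : k[X]) :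
    A.polyHandle f ≫ i = i ≫ B.polyHandle f := by
  induction f using Polynomial.induction_mul_X with
  | add f g hf hg => simp only [polyHandle_add, Preadditive.add_comp, Preadditive.comp_add, hf, hg]
  | smul r f hf => simp only [polyHandle_smul, Linear.smul_comp, Linear.comp_smul, hf]
  | one => simp only [polyHandle_one, Category.id_comp, Category.comp_id]
  | mul_X f hf =>
    simp only [polyHandle_mul, polyHandle_X, Category.assoc, h.mul, reassoc_of% h.comul,
      reassoc_of% hf]

theorem polyHandle_map {D : Type u'} [Category.{v'} D] [MonoidalCategory D] [Preadditive D]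
    [Linear k D] (F : C ⥤ D) [F.Monoidal] [F.Additive] [F.Linear k] (f : k[X]) :
    (A.map F).polyHandle f = F.map (A.polyHandle f) := by
  induction f using Polynomial.induction_mul_X with
  | add f g hf hg => rw [polyHandle_add, polyHandle_add, F.map_add, hf, hg]; rfl
  | smul r f hf => rw [polyHandle_smul, polyHandle_smul, F.map_smul, hf]; rfl
  | one => rw [polyHandle_one, polyHandle_one, F.map_id]; rfl
  | mul_X f hf =>
    rw [polyHandle_mul, polyHandle_mul, hf, polyHandle_X, polyHandle_X, F.map_comp, F.map_comp]
    dsimp only [ExtFrobData.map]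
    rw [Category.assoc, Functor.Monoidal.δ_μ_assoc]

/-- Central endomorphisms are closed under sums, scalars and composition, and the handle is one of
them. As a consequence, any idempotent polynomial in the handle that splits cuts out an extended
Frobenius algebra. -/
theorem IsExtFrob.isCentral_polyHandle [BraidedCategory C] [MonoidalPreadditive C]
    [MonoidalLinear k C] (h : A.IsExtFrob) (f : k[X]) : A.IsCentral (A.polyHandle f) := by
  induction f using Polynomial.induction_mul_X with
  | add f g hf hg =>
    rw [polyHandle_add]
    constructor
    · rw [MonoidalPreadditive.add_whiskerRight, Preadditive.add_comp, hf.mul_left, hg.mul_left,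
        Preadditive.comp_add]
    · rw [MonoidalPreadditive.whiskerLeft_add, Preadditive.add_comp, hf.mul_right, hg.mul_right,
        Preadditive.comp_add]
    · rw [MonoidalPreadditive.add_whiskerRight, Preadditive.comp_add, hf.comul_left, hg.comul_left,
        Preadditive.add_comp]
    · rw [MonoidalPreadditive.whiskerLeft_add, Preadditive.comp_add, hf.comul_right,
        hg.comul_right, Preadditive.add_comp]
    · rw [Preadditive.comp_add, hf.phi, hg.phi, Preadditive.add_comp]
  | smul r f hf =>
    rw [polyHandle_smul]
    constructor
    · rw [MonoidalLinear.smul_whiskerRight, Linear.smul_comp, hf.mul_left, Linear.comp_smul]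
    · rw [MonoidalLinear.whiskerLeft_smul, Linear.smul_comp, hf.mul_right, Linear.comp_smul]
    · rw [MonoidalLinear.smul_whiskerRight, Linear.comp_smul, hf.comul_left, Linear.smul_comp]
    · rw [MonoidalLinear.whiskerLeft_smul, Linear.comp_smul, hf.comul_right, Linear.smul_comp]
    · rw [Linear.comp_smul, hf.phi, Linear.smul_comp]
  | one => rw [polyHandle_one]; exact IsCentral.id A
  | mul_X f hf => rw [polyHandle_mul, polyHandle_X]; exact hf.comp h.isCentral_handle

/-- Both sides are linear in `f`, and on powers of `X` this is the hypothesis. It is applied with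
`t` the unit, the crosscap and the product of two crosscaps, which gives the functionals attached to
`α`, `β` and `γ`. -/
theorem comp_polyHandle_counit {t : 𝟙_ C ⟶ A.X} {a : ℕ → k}
    (h : ∀ g, t ≫ A.handlePow g ≫ A.counit = a g • 𝟙 _) (f : k[X]) :
    t ≫ A.polyHandle f ≫ A.counit = evalSeq a f • 𝟙 _ := by
  induction f using Polynomial.induction_on' with
  | add f g hf hg =>
    rw [polyHandle_add, Preadditive.add_comp, Preadditive.comp_add, hf, hg, map_add, add_smul]
  | monomial n r =>
    rw [← C_mul_X_pow_eq_monomial, ← smul_eq_C_mul, polyHandle_smul, polyHandle_X_pow,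
      Linear.smul_comp, Linear.comp_smul, h, map_smul, evalSeq_X_pow, smul_smul,
      smul_eq_mul]

end Handle

end ExtFrobData

/-! ### The evaluation and handle relations under functors, direct sums and retracts. -/

namespace SkeinTriple

variable {k : Type w} [Field k] {C : Type u} [Category.{v} C] [MonoidalCategory C] [Preadditive C]
  [Linear k C]

/-- The relations imposed on the circle: evaluation of closed surfaces, and the handle relation. -/
structure Evaluates (T : SkeinTriple k) (A : ExtFrobData C) : Prop where
  surface (g : ℕ) : A.surface g = T.α g • 𝟙 _
  surfaceOne (g : ℕ) : A.surfaceOne g = T.β g • 𝟙 _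
  surfaceTwo (g : ℕ) : A.surfaceTwo g = T.γ g • 𝟙 _
  handle : A.polyHandle T.handlePoly = 0

namespace Evaluates

theorem map_closed {D : Type u'} [Category.{v'} D] [MonoidalCategory D] [Preadditive D]
    [Linear k D] (F : C ⥤ D) [F.Monoidal] [F.Additive] [F.Linear k] {f : 𝟙_ C ⟶ 𝟙_ C} {r : k}
    (h : f = r • 𝟙 _) :
    Functor.LaxMonoidal.ε F ≫ F.map f ≫ Functor.OplaxMonoidal.η F = r • 𝟙 _ := by
  rw [h, F.map_smul, F.map_id, Linear.smul_comp, Linear.comp_smul, Category.id_comp,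
    Functor.Monoidal.ε_η]

theorem _root_.ExtFrobData.map_surface {D : Type u'} [Category.{v'} D] [MonoidalCategory D]
    [Preadditive D] [Linear k D] (F : C ⥤ D) [F.Monoidal] [F.Additive] [F.Linear k]
    (A : ExtFrobData C) (g : ℕ) : (A.map F).surface g =
      Functor.LaxMonoidal.ε F ≫ F.map (A.surface g) ≫ Functor.OplaxMonoidal.η F := by
  rw [ExtFrobData.surface, ExtFrobData.surface, ← ExtFrobData.polyHandle_X_pow (k := k),
    ExtFrobData.polyHandle_map, ExtFrobData.polyHandle_X_pow, F.map_comp, F.map_comp]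
  simp only [ExtFrobData.map, Category.assoc]

theorem _root_.ExtFrobData.map_surfaceOne {D : Type u'} [Category.{v'} D] [MonoidalCategory D]
    [Preadditive D] [Linear k D] (F : C ⥤ D) [F.Monoidal] [F.Additive] [F.Linear k]
    (A : ExtFrobData C) (g : ℕ) : (A.map F).surfaceOne g =
      Functor.LaxMonoidal.ε F ≫ F.map (A.surfaceOne g) ≫ Functor.OplaxMonoidal.η F := by
  rw [ExtFrobData.surfaceOne, ExtFrobData.surfaceOne, ← ExtFrobData.polyHandle_X_pow (k := k),
    ExtFrobData.polyHandle_map, ExtFrobData.polyHandle_X_pow, F.map_comp, F.map_comp]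
  simp only [ExtFrobData.map, Category.assoc]

theorem _root_.ExtFrobData.map_surfaceTwo {D : Type u'} [Category.{v'} D] [MonoidalCategory D]
    [Preadditive D] [Linear k D] (F : C ⥤ D) [F.Monoidal] [F.Additive] [F.Linear k]
    (A : ExtFrobData C) (g : ℕ) : (A.map F).surfaceTwo g =
      Functor.LaxMonoidal.ε F ≫ F.map (A.surfaceTwo g) ≫ Functor.OplaxMonoidal.η F := by
  rw [ExtFrobData.surfaceTwo, ExtFrobData.surfaceTwo, ← ExtFrobData.polyHandle_X_pow (k := k),
    ExtFrobData.polyHandle_map, ExtFrobData.polyHandle_X_pow]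
  simp only [ExtFrobData.map, Category.assoc, F.map_comp, Functor.Monoidal.map_leftUnitor_inv,
    ← tensorHom_comp_tensorHom, Functor.LaxMonoidal.μ_natural_assoc]
  rw [leftUnitor_inv_naturality_assoc, ← tensorHom_def'_assoc]

theorem map {T : SkeinTriple k} {A : ExtFrobData C} (h : T.Evaluates A) {D : Type u'}
    [Category.{v'} D] [MonoidalCategory D] [Preadditive D] [Linear k D] (F : C ⥤ D) [F.Monoidal]
    [F.Additive] [F.Linear k] : T.Evaluates (A.map F) where
  surface g := (A.map_surface (k := k) F g).trans (map_closed F (h.surface g))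
  surfaceOne g := (A.map_surfaceOne (k := k) F g).trans (map_closed F (h.surfaceOne g))
  surfaceTwo g := (A.map_surfaceTwo (k := k) F g).trans (map_closed F (h.surfaceTwo g))
  handle := by rw [ExtFrobData.polyHandle_map, h.handle, F.map_zero]; rfl

open ExtFrobData

/-- A direct sum satisfies the sum of the evaluation relations. -/
theorem of_isDirectSum {T T' T'' : SkeinTriple k} (hα : T.α = T'.α + T''.α)
    (hβ : T.β = T'.β + T''.β) (hγ : T.γ = T'.γ + T''.γ)
    (hm : T.handlePoly = T'.handlePoly * T''.handlePoly) {A B D : ExtFrobData C} {i : A.X ⟶ D.X}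
    {p : D.X ⟶ A.X} {j : B.X ⟶ D.X} {q : D.X ⟶ B.X} (h : IsDirectSum i p j q)
    (hA : T'.Evaluates A) (hB : T''.Evaluates B) : T.Evaluates D := by
  -- Insert `p ≫ i + q ≫ j` in front of the counit. The counit restricts to the counits of the
  -- summands, and the projections move past the powers of the handle.
  have key : ∀ (t : 𝟙_ C ⟶ D.X) (g : ℕ), t ≫ D.handlePow g ≫ D.counit =
      (t ≫ p) ≫ A.handlePow g ≫ A.counit + (t ≫ q) ≫ B.handlePow g ≫ B.counit := by
    intro t g
    have h₁ := h.proj_left.polyHandle (Polynomial.X ^ g : k[X])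
    have h₂ := h.proj_right.polyHandle (Polynomial.X ^ g : k[X])
    rw [← Category.id_comp D.counit, ← h.total]
    simp only [polyHandle_X_pow] at h₁ h₂
    simp only [Preadditive.add_comp, Preadditive.comp_add, Category.assoc, h.incl_left.counit,
      h.incl_right.counit, reassoc_of% h₁, reassoc_of% h₂]
  constructor
  · intro g
    rw [ExtFrobData.surface, key, h.proj_left.one, h.proj_right.one, hα, Pi.add_apply, add_smul,
      ← hA.surface, ← hB.surface]
    rfl
  · intro g
    rw [ExtFrobData.surfaceOne, key, h.proj_left.theta, h.proj_right.theta, hβ, Pi.add_apply,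
      add_smul, ← hA.surfaceOne, ← hB.surfaceOne]
    rfl
  · intro g
    -- For two crosscaps the state `t` is itself a product. The projections are multiplicative, so
    -- no mixed terms of crosscaps from different summands appear.
    have := key ((λ_ (𝟙_ C)).inv ≫ (D.theta ⊗ₘ D.theta) ≫ D.mul) g
    simp only [Category.assoc, reassoc_of% h.proj_left.mul, reassoc_of% h.proj_right.mul,
      tensorHom_comp_tensorHom_assoc, h.proj_left.theta, h.proj_right.theta] at this
    rw [ExtFrobData.surfaceTwo, this, hγ, Pi.add_apply, add_smul, ← hA.surfaceTwo, ← hB.surfaceTwo]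
    rfl
  · refine h.hom_ext ?_ ?_
    · rw [h.proj_left.polyHandle, hm, polyHandle_mul, hA.handle, Limits.zero_comp,
        Limits.comp_zero, Limits.zero_comp]
    · rw [h.proj_right.polyHandle, hm, polyHandle_mul, hB.handle, Limits.comp_zero,
        Limits.comp_zero, Limits.zero_comp]

/-- The retract defined by a polynomial `f` in the handle endomorphism, where `f` is `1` modulo
`T'.handlePoly` and `0` modulo `T''.handlePoly`. -/
theorem of_retract {T T' T'' : SkeinTriple k} (hα : T.α = T'.α + T''.α)
    (hβ : T.β = T'.β + T''.β) (hγ : T.γ = T'.γ + T''.γ)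
    (hm : T.handlePoly = T'.handlePoly * T''.handlePoly) {f a b : k[X]}
    (h₁ : f = 1 + T'.handlePoly * a) (h₂ : f = T''.handlePoly * b) {A B : ExtFrobData C}
    {i : B.X ⟶ A.X} {p : A.X ⟶ B.X} (hi : IsIncl B A i) (hp : IsProj A B p) (hip : i ≫ p = 𝟙 _)
    (hpi : p ≫ i = A.polyHandle f) (hA : T.Evaluates A) : T'.Evaluates B := by
  -- A closed surface computed in the retract is the closed surface in `A` with one extra factor
  -- `f(x)`, since `p ≫ i` is `f(x)`.
  have key : ∀ (t : 𝟙_ C ⟶ A.X) (g : ℕ), (t ≫ p) ≫ B.handlePow g ≫ B.counit =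
      t ≫ A.polyHandle (f * Polynomial.X ^ g) ≫ A.counit := by
    intro t g
    have h := hi.polyHandle (Polynomial.X ^ g : k[X])
    rw [← hi.counit, ← polyHandle_X_pow (k := k), reassoc_of% h, polyHandle_mul, ← hpi]
    simp only [Category.assoc]
  -- The functional of `c` splits as the sum of those of `c'` and `c''`. The first annihilates
  -- multiples of `m'`, and modulo these `f` is `1`; the second annihilates multiples of `m''`, and
  -- `f` is one of them.
  have red : ∀ (c c' c'' : ℕ → k), c = c' + c'' → (∀ f, evalSeq c' (T'.handlePoly * f) = 0) →
      (∀ f, evalSeq c'' (T''.handlePoly * f) = 0) →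
        ∀ g, evalSeq c (f * Polynomial.X ^ g) = c' g := by
    intro c c' c'' hc hc' hc'' g
    have e₁ : evalSeq c' (f * Polynomial.X ^ g) = c' g := by
      rw [h₁, add_mul, one_mul, mul_assoc, map_add, hc', evalSeq_X_pow, add_zero]
    have e₂ : evalSeq c'' (f * Polynomial.X ^ g) = 0 := by rw [h₂, mul_assoc, hc'']
    rw [hc, evalSeq_add, e₁, e₂, add_zero]
  constructor
  · intro g
    rw [ExtFrobData.surface, ← hp.one, key, comp_polyHandle_counit hA.surface,
      red _ _ _ hα T'.evalSeq_α T''.evalSeq_α]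
  · intro g
    rw [ExtFrobData.surfaceOne, ← hp.theta, key, comp_polyHandle_counit hA.surfaceOne,
      red _ _ _ hβ T'.evalSeq_β T''.evalSeq_β]
  · intro g
    have e := key ((λ_ (𝟙_ C)).inv ≫ (A.theta ⊗ₘ A.theta) ≫ A.mul) g
    rw [comp_polyHandle_counit (a := T.γ) (fun g => by
      simpa only [ExtFrobData.surfaceTwo, Category.assoc] using hA.surfaceTwo g),
      red _ _ _ hγ T'.evalSeq_γ T''.evalSeq_γ] at e
    simpa only [ExtFrobData.surfaceTwo, Category.assoc, reassoc_of% hp.mul,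
      tensorHom_comp_tensorHom_assoc, hp.theta] using e
  -- The product `f m'` is divisible by `m' m''`, which is the handle polynomial of `A`.
  · have e : A.polyHandle (f * T'.handlePoly) = 0 := by
      rw [h₂, mul_right_comm, mul_comm T''.handlePoly, ← hm, polyHandle_mul, hA.handle,
        Limits.zero_comp]
    rw [← Category.comp_id (B.polyHandle _), ← hip, reassoc_of% hi.polyHandle]
    rw [polyHandle_mul, ← hpi] at e
    have e' := congrArg (fun t => i ≫ t ≫ p) e
    simpa only [Category.assoc, reassoc_of% hip, Limits.zero_comp, Limits.comp_zero] using e'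

end Evaluates

end SkeinTriple

end

/-! ### Symmetric monoidal functors on cobordisms from extended Frobenius algebras. -/

theorem ExtFrobData.mk_congr {E : Type u} [Category.{v} E] [MonoidalCategory E] {X : E}
    {mul mul' : X ⊗ X ⟶ X} {one one' : 𝟙_ E ⟶ X} {comul comul' : X ⟶ X ⊗ X}
    {counit counit' : X ⟶ 𝟙_ E} {phi phi' : X ⟶ X} {theta theta' : 𝟙_ E ⟶ X} (h₁ : mul = mul')
    (h₂ : one = one') (h₃ : comul = comul') (h₄ : counit = counit') (h₅ : phi = phi')
    (h₆ : theta = theta') : ExtFrobData.mk X mul one comul counit phi theta =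
      ExtFrobData.mk X mul' one' comul' counit' phi' theta' := by
  subst h₁ h₂ h₃ h₄ h₅ h₆; rfl

/-- An object `obj 1` with structure maps of an extended Frobenius algebra, and a choice of its
tensor powers. -/
structure ExtFrobPowers (E : Type u) [Category.{v} E] [MonoidalCategory E] where
  obj : ℕ → E
  ε : 𝟙_ E ≅ obj 0
  μ (a b : ℕ) : obj a ⊗ obj b ≅ obj (a + b)
  associativity (a b c : ℕ) : (μ a b).hom ▷ obj c ≫ (μ (a + b) c).hom ≫
    eqToHom (congrArg obj (Nat.add_assoc a b c)) =
      (α_ _ _ _).hom ≫ obj a ◁ (μ b c).hom ≫ (μ a (b + c)).hom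
  left_unitality (a : ℕ) : (λ_ (obj a)).hom =
    ε.hom ▷ obj a ≫ (μ 0 a).hom ≫ eqToHom (congrArg obj (Nat.zero_add a))
  right_unitality (a : ℕ) : (ρ_ (obj a)).hom = obj a ◁ ε.hom ≫ (μ a 0).hom
  mul : obj 1 ⊗ obj 1 ⟶ obj 1
  one : 𝟙_ E ⟶ obj 1
  comul : obj 1 ⟶ obj 1 ⊗ obj 1
  counit : obj 1 ⟶ 𝟙_ E
  phi : obj 1 ⟶ obj 1
  theta : 𝟙_ E ⟶ obj 1

namespace ExtFrobPowers

variable {E : Type u} [Category.{v} E] [MonoidalCategory E] (P : ExtFrobPowers E)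

/-- The underlying structure maps. -/
def toExtFrobData : ExtFrobData E := ⟨P.obj 1, P.mul, P.one, P.comul, P.counit, P.phi, P.theta⟩

/-- The coherence of `μ`, solved for the inverses. The value of a tensor word begins with inverses
of `μ` and ends with `μ`, so both forms occur. The transport along `Nat.add_assoc` is the image of
the associator of the strict category of cobordisms. -/
theorem assoc_hom_inv (a b c : ℕ) :
    eqToHom (congrArg P.obj (Nat.add_assoc a b c)) ≫ (P.μ a (b + c)).inv ≫
      P.obj a ◁ (P.μ b c).inv =
        (P.μ (a + b) c).inv ≫ (P.μ a b).inv ▷ P.obj c ≫ (α_ _ _ _).hom := by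
  rw [← cancel_epi ((P.μ a b).hom ▷ P.obj c ≫ (P.μ (a + b) c).hom), Category.assoc, Category.assoc,
    reassoc_of% P.associativity a b c]
  simp

theorem assoc_inv_inv (a b c : ℕ) :
    eqToHom (congrArg P.obj (Nat.add_assoc a b c)).symm ≫ (P.μ (a + b) c).inv ≫
      (P.μ a b).inv ▷ P.obj c =
        (P.μ a (b + c)).inv ≫ P.obj a ◁ (P.μ b c).inv ≫ (α_ _ _ _).inv := by
  rw [← cancel_epi (eqToHom (congrArg P.obj (Nat.add_assoc a b c))), eqToHom_trans_assoc,
    eqToHom_refl, Category.id_comp, reassoc_of% P.assoc_hom_inv a b c]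
  simp

theorem left_unitality_hom (a : ℕ) :
    (P.μ 0 a).hom ≫ eqToHom (congrArg P.obj (Nat.zero_add a)) =
      P.ε.inv ▷ P.obj a ≫ (λ_ (P.obj a)).hom := by
  rw [P.left_unitality]; simp

theorem left_unitality_inv (a : ℕ) :
    eqToHom (congrArg P.obj (Nat.zero_add a)) =
      (P.μ 0 a).inv ≫ P.ε.inv ▷ P.obj a ≫ (λ_ (P.obj a)).hom := by
  rw [← P.left_unitality_hom, Iso.inv_hom_id_assoc]

theorem right_unitality_hom (a : ℕ) :
    (P.μ a 0).hom = P.obj a ◁ P.ε.inv ≫ (ρ_ (P.obj a)).hom := by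
  rw [P.right_unitality]; simp

theorem right_unitality_inv (a : ℕ) :
    (P.μ a 0).inv = (ρ_ (P.obj a)).inv ≫ P.obj a ◁ P.ε.hom := by
  rw [← cancel_epi (P.μ a 0).hom, Iso.hom_inv_id, P.right_unitality_hom]; simp

variable [BraidedCategory E]

open UCob

/-- The morphism defined by a word in the generating cobordisms. -/
def eval : ∀ {a b : ℕ}, Word a b → (P.obj a ⟶ P.obj b)
  | _, _, .id a => 𝟙 (P.obj a)
  | _, _, .comp f g => eval f ≫ eval g
  | _, _, .tensor (a := a) (b := b) (c := c) (d := d) f g =>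
      (P.μ a c).inv ≫ (eval f ⊗ₘ eval g) ≫ (P.μ b d).hom
  | _, _, .braid a b => (P.μ a b).inv ≫ (β_ (P.obj a) (P.obj b)).hom ≫ (P.μ b a).hom
  | _, _, .mul => (P.μ 1 1).inv ≫ P.mul
  | _, _, .one => P.ε.inv ≫ P.one
  | _, _, .comul => P.comul ≫ (P.μ 1 1).hom
  | _, _, .counit => P.counit ≫ P.ε.hom
  | _, _, .phi => P.phi
  | _, _, .theta => P.ε.inv ≫ P.theta

theorem eval_cast {a b : ℕ} (h : a = b) : P.eval (.cast h) = eqToHom (congrArg P.obj h) := by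
  subst h; rfl

/-- The relations of a strict monoidal category hold by coherence of the chosen powers, those of the
generators by the axioms of the algebra. The relation `braid_braid` is where the target has to be
symmetric. -/
theorem eval_eq {E : Type u} [Category.{v} E] [MonoidalCategory E] [SymmetricCategory E]
    {P : ExtFrobPowers E} (hP : P.toExtFrobData.IsExtFrob) {a b : ℕ} {f g : Word a b}
    (h : Word.Rel f g) : P.eval f = P.eval g := by
  induction h with
  | refl => rfl
  | symm _ ih => exact ih.symm
  | trans _ _ ih ih' => exact ih.trans ih'
  | comp_congr _ _ ih ih' => simp only [eval, ih, ih']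
  | tensor_congr _ _ ih ih' => simp only [eval, ih, ih']
  | id_comp f => simp only [eval, Category.id_comp]
  | comp_id f => simp only [eval, Category.comp_id]
  | assoc f g h => simp only [eval, Category.assoc]
  | tensor_id a b =>
    simp only [eval, id_tensorHom_id, Category.id_comp, Iso.inv_hom_id]
  | tensor_comp f f' g g' =>
    simp only [eval, Category.assoc, Iso.hom_inv_id_assoc, tensorHom_comp_tensorHom_assoc]
  | @tensor_assoc a b a' b' a'' b'' f f' f'' =>
    simp only [eval, eval_cast, Category.assoc]
    -- The coherence maps are pulled out of both tensor products, so that what remains is naturality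
    -- of the associator between two instances of the coherence of `μ`.
    have h₁ : ((P.μ a a').inv ≫ (P.eval f ⊗ₘ P.eval f') ≫ (P.μ b b').hom) ⊗ₘ P.eval f'' =
        (P.μ a a').inv ▷ _ ≫ ((P.eval f ⊗ₘ P.eval f') ⊗ₘ P.eval f'') ≫ (P.μ b b').hom ▷ _ := by
      simp only [← tensorHom_id, tensorHom_comp_tensorHom, Category.id_comp, Category.comp_id]
    have h₂ : P.eval f ⊗ₘ ((P.μ a' a'').inv ≫ (P.eval f' ⊗ₘ P.eval f'') ≫ (P.μ b' b'').hom) =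
        _ ◁ (P.μ a' a'').inv ≫ (P.eval f ⊗ₘ P.eval f' ⊗ₘ P.eval f'') ≫ _ ◁ (P.μ b' b'').hom := by
      simp only [← id_tensorHom, tensorHom_comp_tensorHom, Category.id_comp, Category.comp_id]
    rw [h₁, h₂]
    simp only [Category.assoc, P.associativity]
    rw [reassoc_of% P.assoc_hom_inv a a' a'', associator_naturality_assoc]
  | zero_tensor f =>
    simp only [eval, eval_cast, Category.assoc, P.left_unitality_hom]
    simp [P.left_unitality_inv, whisker_exchange_assoc]
  | tensor_zero f =>
    simp only [eval, eval_cast, Category.assoc, eqToHom_refl, Category.comp_id,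
      P.right_unitality_hom, P.right_unitality_inv, Category.id_comp, tensorHom_id]
    rw [whisker_exchange_assoc]
    simp
  | braid_natural f g =>
    simp only [eval, Category.assoc, Iso.hom_inv_id_assoc,
      BraidedCategory.braiding_naturality_assoc]
  | braid_braid a b =>
    simp only [eval, Category.assoc, Iso.hom_inv_id_assoc, SymmetricCategory.symmetry_assoc,
      Iso.inv_hom_id]
  | hexagon a b c =>
    simp only [eval, eval_cast, Category.assoc]
    -- Precomposing with an isomorphism onto the triple power turns the inverses of `μ` into forward
    -- maps; coherence of `μ` then reduces the claim to the hexagon in `E`.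
    rw [← cancel_epi ((P.μ a b).hom ▷ P.obj c ≫ (P.μ (a + b) c).hom), Category.assoc,
      Category.assoc, reassoc_of% P.associativity a b c]
    simp only [Iso.hom_inv_id_assoc, tensorHom_id, id_tensorHom, comp_whiskerRight,
      MonoidalCategory.whiskerLeft_comp, Category.assoc, hom_inv_whiskerRight_assoc,
      reassoc_of% P.assoc_hom_inv b a c, P.associativity,
      BraidedCategory.braiding_naturality_right_assoc]
    rw [reassoc_of% BraidedCategory.hexagon_forward]
  | mul_assoc =>
    have := hP.mul_assoc
    dsimp only [toExtFrobData] at this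
    simp only [eval, eval_cast, Category.assoc, Iso.hom_inv_id_assoc, tensorHom_id, id_tensorHom,
      comp_whiskerRight, MonoidalCategory.whiskerLeft_comp, reassoc_of% P.assoc_hom_inv 1 1 1, this]
  | one_mul =>
    have := hP.one_mul
    dsimp only [toExtFrobData] at this
    simp only [eval, eval_cast, Category.assoc, Iso.hom_inv_id_assoc, tensorHom_id,
      comp_whiskerRight, P.left_unitality_inv, this]
  | mul_one =>
    have := hP.mul_one
    dsimp only [toExtFrobData] at this
    simp only [eval, eval_cast, Category.assoc, Iso.hom_inv_id_assoc, id_tensorHom,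
      MonoidalCategory.whiskerLeft_comp, P.right_unitality_inv, this]
    simp
  | comul_assoc =>
    have := hP.comul_assoc
    dsimp only [toExtFrobData] at this
    simp only [eval, eval_cast, Category.assoc, Iso.hom_inv_id_assoc, tensorHom_id, id_tensorHom,
      comp_whiskerRight, MonoidalCategory.whiskerLeft_comp, P.associativity, reassoc_of% this]
  | counit_comul =>
    have := hP.counit_comul
    dsimp only [toExtFrobData] at this
    simp only [eval, eval_cast, Category.assoc, Iso.hom_inv_id_assoc, tensorHom_id,
      comp_whiskerRight, P.left_unitality_hom, hom_inv_whiskerRight_assoc, this]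
  | comul_counit =>
    have := hP.comul_counit
    dsimp only [toExtFrobData] at this
    simp only [eval, eval_cast, Category.assoc, Iso.hom_inv_id_assoc, id_tensorHom,
      MonoidalCategory.whiskerLeft_comp, P.right_unitality_hom, eqToHom_refl, Category.comp_id,
      whiskerLeft_hom_inv_assoc, this]
  | mul_comm =>
    have := hP.mul_comm
    dsimp only [toExtFrobData] at this
    simp only [eval, Category.assoc, Iso.hom_inv_id_assoc, this]
  | comul_comm =>
    have := hP.comul_comm
    dsimp only [toExtFrobData] at this
    simp only [eval, Category.assoc, Iso.hom_inv_id_assoc, reassoc_of% this]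
  | frobenius_left =>
    have := hP.frobenius_left
    dsimp only [toExtFrobData] at this
    simp only [eval, eval_cast, Category.assoc, Iso.hom_inv_id_assoc, tensorHom_id, id_tensorHom,
      comp_whiskerRight, MonoidalCategory.whiskerLeft_comp, reassoc_of% P.assoc_hom_inv 1 1 1,
      hom_inv_whiskerRight_assoc, reassoc_of% this]
  | frobenius_right =>
    have := hP.frobenius_right
    dsimp only [toExtFrobData] at this
    simp only [eval, eval_cast, Category.assoc, Iso.hom_inv_id_assoc, tensorHom_id, id_tensorHom,
      comp_whiskerRight, MonoidalCategory.whiskerLeft_comp, reassoc_of% P.assoc_inv_inv 1 1 1,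
      whiskerLeft_hom_inv_assoc, reassoc_of% this]
  | phi_phi => exact hP.phi_phi
  | mul_phi =>
    have := hP.mul_phi
    dsimp only [toExtFrobData] at this
    simp only [eval, Category.assoc, Iso.hom_inv_id_assoc, this]
  | phi_comul =>
    have := hP.phi_comul
    dsimp only [toExtFrobData] at this
    simp only [eval, Category.assoc, Iso.hom_inv_id_assoc, reassoc_of% this]
  | one_phi =>
    have := hP.one_phi
    dsimp only [toExtFrobData] at this
    simp only [eval, Category.assoc, this]
  | phi_counit =>
    have := hP.phi_counit
    dsimp only [toExtFrobData] at this
    simp only [eval, reassoc_of% this]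
  | theta_phi =>
    have := hP.theta_phi
    dsimp only [toExtFrobData] at this
    simp only [eval, Category.assoc, Iso.hom_inv_id_assoc, tensorHom_id, comp_whiskerRight, this]
  | klein =>
    have := hP.klein
    dsimp only [toExtFrobData] at this
    simp only [eval, eval_cast, Category.assoc, Iso.hom_inv_id_assoc, tensorHom_id, this]
    have h : eqToHom (congrArg P.obj (Nat.zero_add 0).symm) = 𝟙 (P.obj 0) := rfl
    rw [h, Category.id_comp, P.right_unitality_inv, ← tensorHom_comp_tensorHom,
      MonoidalCategory.tensorHom_def' P.ε.inv]
    simp [unitors_inv_equal]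

/-- The functor on the category of cobordisms defined by an extended Frobenius algebra. -/
def functor {E : Type u} [Category.{v} E] [MonoidalCategory E] [SymmetricCategory E]
    {P : ExtFrobPowers E} (hP : P.toExtFrobData.IsExtFrob) : UCob ⥤ E where
  obj X := P.obj X.circles
  map := Quotient.lift P.eval fun _ _ h => eval_eq hP h
  map_id _ := rfl
  map_comp := by rintro _ _ _ ⟨f⟩ ⟨g⟩; rfl

section Functor

variable {E : Type u} [Category.{v} E] [MonoidalCategory E] [SymmetricCategory E]
  {P : ExtFrobPowers E} (hP : P.toExtFrobData.IsExtFrob)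

theorem functor_map_castIso {a b : ℕ} (h : a = b) :
    (functor hP).map (castIso h).hom = eqToHom (congrArg P.obj h) := P.eval_cast h

instance : (functor hP).Monoidal :=
  Functor.CoreMonoidal.toMonoidal
    { εIso := P.ε
      μIso := fun X Y => P.μ X.circles Y.circles
      μIso_hom_natural_left := by
        rintro X Y ⟨f⟩ Z
        refine Eq.symm ((Iso.hom_inv_id_assoc _ _).trans ?_)
        exact congrArg (· ≫ (P.μ Y.circles Z.circles).hom) (tensorHom_id (P.eval f) _)
      μIso_hom_natural_right := by
        rintro X Y Z ⟨f⟩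
        refine Eq.symm ((Iso.hom_inv_id_assoc _ _).trans ?_)
        exact congrArg (· ≫ (P.μ Z.circles Y.circles).hom) (id_tensorHom _ (P.eval f))
      associativity := fun X Y Z => by
        refine Eq.trans ?_ (P.associativity X.circles Y.circles Z.circles)
        rw [← functor_map_castIso hP]; rfl
      left_unitality := fun X => by
        refine (P.left_unitality X.circles).trans ?_
        rw [← functor_map_castIso hP]; rfl
      right_unitality := fun X => by
        refine (P.right_unitality X.circles).trans ?_
        congr 1
        exact (Category.comp_id _).symm }

instance : (functor hP).Braided where
  braided X Y := Iso.hom_inv_id_assoc (P.μ X.circles Y.circles) _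

theorem circle_map_functor : circle.map (functor hP) = P.toExtFrobData :=
  ExtFrobData.mk_congr (Iso.hom_inv_id_assoc _ _) (Iso.hom_inv_id_assoc _ _)
    ((Category.assoc _ _ _).trans ((congrArg (P.comul ≫ ·) (Iso.hom_inv_id _)).trans
      (Category.comp_id _)))
    ((Category.assoc _ _ _).trans ((congrArg (P.counit ≫ ·) (Iso.hom_inv_id _)).trans
      (Category.comp_id _))) rfl (Iso.hom_inv_id_assoc _ _)

end Functor

/-- Tensor powers of an object. -/
def pow {E : Type u} [Category.{v} E] [MonoidalCategory E] (X : E) : ℕ → E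
  | 0 => 𝟙_ E
  | n + 1 => pow X n ⊗ X

/-- Products of tensor powers. -/
def powMul {E : Type u} [Category.{v} E] [MonoidalCategory E] (X : E) (a : ℕ) :
    ∀ b, pow X a ⊗ pow X b ≅ pow X (a + b)
  | 0 => ρ_ _
  | b + 1 => (α_ _ _ _).symm ≪≫ whiskerRightIso (powMul X a b) X

theorem eqToHom_pow_succ {E : Type u} [Category.{v} E] [MonoidalCategory E] (X : E) {a b : ℕ}
    (h : a = b) (h' : a + 1 = b + 1) :
    eqToHom (congrArg (pow X) h') = eqToHom (congrArg (pow X) h) ▷ X := by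
  subst h
  exact (id_whiskerRight _ _).symm

/-- The induction step for the associativity of products of powers: append one factor `X` on the
right and whisker the given identity with it. It is stated for arbitrary objects, so that what is
left is coherence. -/
theorem whiskerRight_associativity {E : Type u} [Category.{v} E] [MonoidalCategory E] (X : E)
    {P Q R PQ QR S S' : E} (f : P ⊗ Q ⟶ PQ) (g : Q ⊗ R ⟶ QR) (h : PQ ⊗ R ⟶ S) (h' : P ⊗ QR ⟶ S')
    (e : S ⟶ S') (H : f ▷ R ≫ h ≫ e = (α_ P Q R).hom ≫ P ◁ g ≫ h') :
    f ▷ (R ⊗ X) ≫ ((α_ PQ R X).inv ≫ h ▷ X) ≫ e ▷ X =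
      (α_ P Q (R ⊗ X)).hom ≫ P ◁ ((α_ Q R X).inv ≫ g ▷ X) ≫ (α_ P QR X).inv ≫ h' ▷ X := by
  have H' := congrArg (fun t => (α_ _ _ _).inv ≫ t ▷ X) H
  simp only [comp_whiskerRight] at H'
  simp only [Category.assoc, whiskerRight_tensor, Iso.hom_inv_id_assoc]
  rw [H']
  simp

theorem powMul_associativity {E : Type u} [Category.{v} E] [MonoidalCategory E] (X : E)
    (a b c : ℕ) : (powMul X a b).hom ▷ pow X c ≫ (powMul X (a + b) c).hom ≫
    eqToHom (congrArg (pow X) (Nat.add_assoc a b c)) =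
      (α_ _ _ _).hom ≫ pow X a ◁ (powMul X b c).hom ≫ (powMul X a (b + c)).hom := by
  induction c with
  | zero =>
    change (powMul X a b).hom ▷ (𝟙_ E) ≫ (ρ_ _).hom ≫ 𝟙 _ =
      (α_ _ _ (𝟙_ E)).hom ≫ pow X a ◁ (ρ_ _).hom ≫ (powMul X a b).hom
    simp
  | succ c ih =>
    have h : eqToHom (congrArg (pow X) (Nat.add_assoc a b (c + 1))) =
      eqToHom (congrArg (pow X) (Nat.add_assoc a b c)) ▷ X :=
        eqToHom_pow_succ X (Nat.add_assoc a b c) (Nat.add_assoc a b (c + 1))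
    rw [h]
    change (powMul X a b).hom ▷ (pow X c ⊗ X) ≫ ((α_ _ _ _).inv ≫ (powMul X (a + b) c).hom ▷ X) ≫
      eqToHom _ ▷ X = (α_ _ _ (pow X c ⊗ X)).hom ≫ pow X a ◁ ((α_ _ _ _).inv ≫
        (powMul X b c).hom ▷ X) ≫ (α_ _ _ _).inv ≫ (powMul X a (b + c)).hom ▷ X
    exact whiskerRight_associativity X _ _ _ _ _ ih

theorem powMul_left_unitality {E : Type u} [Category.{v} E] [MonoidalCategory E] (X : E)
    (a : ℕ) : (λ_ (pow X a)).hom =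
      (powMul X 0 a).hom ≫ eqToHom (congrArg (pow X) (Nat.zero_add a)) := by
  induction a with
  | zero =>
    change (λ_ (𝟙_ E)).hom = (ρ_ (𝟙_ E)).hom ≫ 𝟙 _
    simp [unitors_equal]
  | succ a ih =>
    have h : eqToHom (congrArg (pow X) (Nat.zero_add (a + 1))) =
      eqToHom (congrArg (pow X) (Nat.zero_add a)) ▷ X :=
        eqToHom_pow_succ X (Nat.zero_add a) (Nat.zero_add (a + 1))
    rw [h]
    change (λ_ (pow X a ⊗ X)).hom = ((α_ _ _ _).inv ≫ (powMul X 0 a).hom ▷ X) ≫ eqToHom _ ▷ X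
    rw [Category.assoc, ← comp_whiskerRight, ← ih]
    exact leftUnitor_tensor_hom _ _

/-- The tensor powers of an extended Frobenius algebra. -/
def ofExtFrobData {E : Type u} [Category.{v} E] [MonoidalCategory E] (A : ExtFrobData E) :
    ExtFrobPowers E where
  obj := pow A.X
  ε := Iso.refl _
  μ := powMul A.X
  associativity := powMul_associativity A.X
  left_unitality a := by
    rw [powMul_left_unitality]
    exact ((congrArg (· ≫ _) (id_whiskerRight _ _)).trans (Category.id_comp _)).symm
  right_unitality a :=
    ((congrArg (· ≫ _) (whiskerLeft_id _ _)).trans (Category.id_comp _)).symm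
  -- The first power is `𝟙_ E ⊗ A.X` and not `A.X`, so the structure maps are transported along the
  -- left unitor. Transport along an isomorphism is a retract whose idempotent is the identity.
  mul := (A.retract (λ_ A.X).hom (λ_ A.X).inv).mul
  one := (A.retract (λ_ A.X).hom (λ_ A.X).inv).one
  comul := (A.retract (λ_ A.X).hom (λ_ A.X).inv).comul
  counit := (A.retract (λ_ A.X).hom (λ_ A.X).inv).counit
  phi := (A.retract (λ_ A.X).hom (λ_ A.X).inv).phi
  theta := (A.retract (λ_ A.X).hom (λ_ A.X).inv).theta

end ExtFrobPowers

/-- An extended Frobenius algebra defines a symmetric monoidal functor on the category of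
cobordisms. -/
theorem ExtFrobData.IsExtFrob.exists_functor {E : Type u} [Category.{v} E] [MonoidalCategory E]
    [SymmetricCategory E] {A : ExtFrobData E} (hA : A.IsExtFrob) :
    ∃ (F : UCob ⥤ E) (_ : F.Braided), Isomorphic (UCob.circle.map F) A := by
  have hc : A.IsCentral ((λ_ A.X).inv ≫ (λ_ A.X).hom) := by
    rw [Iso.inv_hom_id]; exact .id A
  have hP : (ExtFrobPowers.ofExtFrobData A).toExtFrobData.IsExtFrob :=
    hc.isExtFrob_retract (Iso.hom_inv_id _) hA
  refine ⟨ExtFrobPowers.functor hP, inferInstance, ?_⟩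
  rw [ExtFrobPowers.circle_map_functor]
  have hi := hc.isIncl (Iso.hom_inv_id _)
  have hp := hc.isProj (Iso.hom_inv_id _)
  exact isomorphic_of_idempotent_eq hi (Iso.hom_inv_id _) hp (IsHom.id A).isIncl
    (Category.comp_id _) (IsHom.id A).isProj ((Iso.inv_hom_id _).trans (Category.comp_id _).symm)

namespace UCob

theorem isExtFrob_circle : circle.IsExtFrob where
  mul_assoc := ofWord_eq .mul_assoc
  one_mul := ofWord_eq .one_mul
  mul_one := ofWord_eq .mul_one
  comul_assoc := ofWord_eq .comul_assoc
  counit_comul := ofWord_eq .counit_comul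
  comul_counit := ofWord_eq .comul_counit
  mul_comm := ofWord_eq .mul_comm
  comul_comm := ofWord_eq .comul_comm
  frobenius_left := ofWord_eq .frobenius_left
  frobenius_right := ofWord_eq .frobenius_right
  phi_phi := ofWord_eq .phi_phi
  mul_phi := ofWord_eq .mul_phi
  phi_comul := ofWord_eq .phi_comul
  one_phi := ofWord_eq .one_phi
  phi_counit := ofWord_eq .phi_counit
  theta_phi := ofWord_eq .theta_phi
  klein := ofWord_eq .klein

/-! ### Functors on cobordisms are determined by the image of the circle. -/

section Uniqueness

open Functor.LaxMonoidal Functor.OplaxMonoidal Functor.Monoidal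

variable {E : Type u} [Category.{v} E] {F G : UCob ⥤ E}

/-- Casts are identities between equal numbers of circles, so every family of maps is natural for
them. In particular it is natural for associators and unitors, which are all that the next lemmas
use. -/
theorem castIso_naturality {τ : ∀ X, F.obj X ⟶ G.obj X} {a b : ℕ} (h : a = b) :
    F.map (castIso h).hom ≫ τ ⟨b⟩ = τ ⟨a⟩ ≫ G.map (castIso h).hom := by
  subst h
  rw [castIso_refl, F.map_id, G.map_id, Category.id_comp, Category.comp_id]

theorem eq_of_castIso_naturality {τ : ∀ X, F.obj X ⟶ G.obj X} {a b : ℕ} (h : a = b) :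
    τ ⟨a⟩ = F.map (castIso h).hom ≫ τ ⟨b⟩ ≫ G.map (castIso h).inv := by
  rw [reassoc_of% castIso_naturality h, ← G.map_comp, Iso.hom_inv_id, G.map_id, Category.comp_id]

variable [MonoidalCategory E] [F.Monoidal] [G.Monoidal] {τ : ∀ X, F.obj X ⟶ G.obj X}
  {e : F.obj ⟨1⟩ ⟶ G.obj ⟨1⟩}

/-- Compatibility with adding one circle at a time implies compatibility with all disjoint unions,
by induction on the second argument: the last circle is moved across the associator. No naturality
for actual cobordisms is needed, so this can be used to prove it. -/
theorem μ_comp_of_succ (h₀ : ε F ≫ τ (𝟙_ UCob) = ε G)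
    (h₁ : ∀ X, μ F X ⟨1⟩ ≫ τ (X ⊗ ⟨1⟩) = (τ X ⊗ₘ e) ≫ μ G X ⟨1⟩) (X Y : UCob) :
    μ F X Y ≫ τ (X ⊗ Y) = (τ X ⊗ₘ τ Y) ≫ μ G X Y := by
  obtain ⟨n⟩ := Y
  induction n with
  | zero =>
    change μ F X (𝟙_ UCob) ≫ τ (X ⊗ 𝟙_ UCob) = (τ X ⊗ₘ τ (𝟙_ UCob)) ≫ μ G X (𝟙_ UCob)
    have h : τ (X ⊗ 𝟙_ UCob) = F.map (ρ_ X).hom ≫ τ X ≫ G.map (ρ_ X).inv :=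
      eq_of_castIso_naturality (τ := τ) (Nat.add_zero X.circles)
    rw [← cancel_epi (F.obj X ◁ ε F), h, MonoidalCategory.tensorHom_def', Category.assoc,
      ← MonoidalCategory.whiskerLeft_comp_assoc, h₀, whisker_exchange_assoc,
      map_rightUnitor_inv]
    simp
  | succ n ih =>
    generalize hY : (⟨n⟩ : UCob) = Y at ih
    have hY' : (⟨n + 1⟩ : UCob) = Y ⊗ ⟨1⟩ := by subst hY; rfl
    rw [hY']
    have h : τ (X ⊗ Y ⊗ ⟨1⟩) = F.map (α_ X Y ⟨1⟩).inv ≫ τ ((X ⊗ Y) ⊗ ⟨1⟩) ≫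
        G.map (α_ X Y ⟨1⟩).hom :=
      eq_of_castIso_naturality (τ := τ) (Nat.add_assoc X.circles Y.circles 1).symm
    rw [← cancel_epi (F.obj X ◁ μ F Y ⟨1⟩), h, Functor.LaxMonoidal.associativity_inv_assoc,
      reassoc_of% h₁]
    have h₂ : F.obj X ◁ μ F Y ⟨1⟩ ≫ (τ X ⊗ₘ τ (Y ⊗ ⟨1⟩)) =
        (τ X ⊗ₘ τ Y ⊗ₘ e) ≫ G.obj X ◁ μ G Y ⟨1⟩ := by
      simp only [← id_tensorHom, tensorHom_comp_tensorHom, Category.id_comp, Category.comp_id, h₁]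
    have h₃ : μ F X Y ▷ F.obj ⟨1⟩ ≫ (τ (X ⊗ Y) ⊗ₘ e) =
        ((τ X ⊗ₘ τ Y) ⊗ₘ e) ≫ μ G X Y ▷ G.obj ⟨1⟩ := by
      simp only [← tensorHom_id, tensorHom_comp_tensorHom, Category.id_comp, Category.comp_id, ih]
    rw [reassoc_of% h₂, reassoc_of% h₃, Functor.LaxMonoidal.associativity,
      associator_naturality_assoc, Iso.inv_hom_id_assoc]

/-- The recursion starts at the empty union, so one circle appears as `0 + 1`. The unit
normalization and the left unitors bring its component back to `e`. -/
theorem eq_of_succ (h₀ : ε F ≫ τ (𝟙_ UCob) = ε G)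
    (h₁ : ∀ X, μ F X ⟨1⟩ ≫ τ (X ⊗ ⟨1⟩) = (τ X ⊗ₘ e) ≫ μ G X ⟨1⟩) : τ ⟨1⟩ = e := by
  have h := h₁ (𝟙_ UCob)
  have h' : τ (𝟙_ UCob ⊗ ⟨1⟩) = F.map (λ_ ⟨1⟩).hom ≫ τ ⟨1⟩ ≫ G.map (λ_ ⟨1⟩).inv :=
    eq_of_castIso_naturality (τ := τ) (Nat.zero_add 1)
  rw [← cancel_epi (ε F ▷ F.obj ⟨1⟩), h', MonoidalCategory.tensorHom_def, Category.assoc,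
    ← comp_whiskerRight_assoc, h₀, ← whisker_exchange_assoc,
    ← Functor.LaxMonoidal.left_unitality_assoc] at h
  have h₂ := congrArg (· ≫ G.map (λ_ (⟨1⟩ : UCob)).hom) h
  simp only [Category.assoc, ← G.map_comp, Iso.inv_hom_id, G.map_id, Category.comp_id,
    ← Functor.LaxMonoidal.left_unitality, leftUnitor_naturality] at h₂
  rwa [cancel_epi] at h₂

end Uniqueness

section Naturality

open Functor.LaxMonoidal Functor.OplaxMonoidal Functor.Monoidal

variable {E : Type u} [Category.{v} E] [MonoidalCategory E] [BraidedCategory E] {F G : UCob ⥤ E}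
  [F.Braided] [G.Braided] {τ : ∀ X, F.obj X ⟶ G.obj X}

/-- Naturality is checked by induction on words. Disjoint unions use monoidality of the family,
permutations use that both functors are braided, and the six generators are the six conditions on a
homomorphism. -/
theorem naturality_ofWord (h₀ : ε F ≫ τ (𝟙_ UCob) = ε G)
    (h₁ : ∀ X Y, μ F X Y ≫ τ (X ⊗ Y) = (τ X ⊗ₘ τ Y) ≫ μ G X Y)
    (h : ExtFrobData.IsHom (circle.map F) (circle.map G) (τ ⟨1⟩)) {a b : ℕ} (w : Word a b) :
    F.map (ofWord w) ≫ τ ⟨b⟩ = τ ⟨a⟩ ≫ G.map (ofWord w) := by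
  have h₀' : τ (𝟙_ UCob) = η F ≫ ε G := by rw [← h₀, η_ε_assoc]
  have h₁' : ∀ X Y, τ (X ⊗ Y) = δ F X Y ≫ (τ X ⊗ₘ τ Y) ≫ μ G X Y := fun X Y => by
    rw [← h₁, δ_μ_assoc]
  induction w with
  | id a => exact castIso_naturality (τ := τ) (rfl : a = a)
  | @comp a b c f g ihf ihg =>
    change F.map (ofWord f ≫ ofWord g) ≫ τ ⟨c⟩ = τ ⟨a⟩ ≫ G.map (ofWord f ≫ ofWord g)
    rw [F.map_comp, Category.assoc, ihg, reassoc_of% ihf, G.map_comp]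
  | @tensor a b c d f g ihf ihg =>
    change F.map (ofWord f ⊗ₘ ofWord g) ≫ τ (⟨b⟩ ⊗ ⟨d⟩) =
      τ (⟨a⟩ ⊗ ⟨c⟩) ≫ G.map (ofWord f ⊗ₘ ofWord g)
    rw [← cancel_epi (μ F _ _), ← μ_natural_assoc, h₁, reassoc_of% h₁,
      tensorHom_comp_tensorHom_assoc, ihf, ihg, ← μ_natural, tensorHom_comp_tensorHom_assoc]
  | braid a b =>
    change F.map (β_ (⟨a⟩ : UCob) ⟨b⟩).hom ≫ τ (⟨b⟩ ⊗ ⟨a⟩) =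
      τ (⟨a⟩ ⊗ ⟨b⟩) ≫ G.map (β_ (⟨a⟩ : UCob) ⟨b⟩).hom
    rw [← cancel_epi (μ F _ _), Functor.LaxBraided.braided_assoc, h₁, reassoc_of% h₁,
      Functor.LaxBraided.braided, BraidedCategory.braiding_naturality_assoc]
  | mul =>
    have := h.mul
    dsimp only [ExtFrobData.map] at this
    rw [← cancel_epi (μ F ⟨1⟩ ⟨1⟩)]
    refine Eq.trans ?_ (this.trans ?_)
    · exact (Category.assoc _ _ _).symm
    · exact (reassoc_of% h₁ ⟨1⟩ ⟨1⟩) (G.map (ofWord .mul)) |>.symm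
  | one =>
    have := h.one
    dsimp only [ExtFrobData.map] at this
    rw [← cancel_epi (ε F)]
    refine Eq.trans ?_ (this.trans ?_)
    · exact (Category.assoc _ _ _).symm
    · exact ((reassoc_of% h₀) (G.map (ofWord .one))).symm
  | comul =>
    have := h.comul
    dsimp only [ExtFrobData.map] at this
    rw [← cancel_mono (δ G ⟨1⟩ ⟨1⟩)]
    refine Eq.trans ?_ (this.trans (Category.assoc _ _ _).symm)
    rw [Category.assoc, Category.assoc]
    refine congrArg (F.map (ofWord .comul) ≫ ·) ?_
    refine (congrArg (· ≫ δ G ⟨1⟩ ⟨1⟩) (h₁' ⟨1⟩ ⟨1⟩)).trans ?_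
    rw [Category.assoc, Category.assoc, μ_δ, Category.comp_id]
    rfl
  | counit =>
    have := h.counit
    dsimp only [ExtFrobData.map] at this
    rw [← cancel_mono (η G)]
    refine Eq.trans ?_ (this.symm.trans (Category.assoc _ _ _).symm)
    rw [Category.assoc]
    refine congrArg (F.map (ofWord .counit) ≫ ·) ?_
    refine (congrArg (· ≫ η G) h₀').trans ?_
    rw [Category.assoc, ε_η, Category.comp_id]
  | phi => exact h.phi
  | theta =>
    have := h.theta
    dsimp only [ExtFrobData.map] at this
    rw [← cancel_epi (ε F)]
    refine Eq.trans ?_ (this.trans ?_)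
    · exact (Category.assoc _ _ _).symm
    · exact ((reassoc_of% h₀) (G.map (ofWord .theta))).symm

/-- Symmetric monoidal functors on the category of cobordisms are determined by the image of the
circle. -/
theorem nonempty_iso_of_isomorphic
    (h : ExtFrobData.Isomorphic (circle.map F) (circle.map G)) : Nonempty (F ≅ G) := by
  obtain ⟨e, he⟩ := h
  -- The component on `n` circles is forced to be the `n`-th tensor power of `e`, up to the
  -- coherence maps of the two functors.
  let σ : ∀ n : ℕ, F.obj ⟨n⟩ ≅ G.obj ⟨n⟩ := fun n => Nat.rec ((εIso F).symm ≪≫ εIso G)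
    (fun n s => (μIso F ⟨n⟩ ⟨1⟩).symm ≪≫ (s ⊗ᵢ e) ≪≫ μIso G ⟨n⟩ ⟨1⟩) n
  have h₀ : ε F ≫ (σ (𝟙_ UCob).circles).hom = ε G := ε_η_assoc _ _
  have h₁ : ∀ X : UCob, μ F X ⟨1⟩ ≫ (σ (X ⊗ (⟨1⟩ : UCob)).circles).hom =
      ((σ X.circles).hom ⊗ₘ e.hom) ≫ μ G X ⟨1⟩ := fun X => μ_δ_assoc _ _ _ _
  have h₂ := μ_comp_of_succ (τ := fun X => (σ X.circles).hom) h₀ h₁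
  have h₃ := eq_of_succ (τ := fun X => (σ X.circles).hom) h₀ h₁
  refine ⟨NatIso.ofComponents (fun X => σ X.circles) ?_⟩
  rintro X Y ⟨w⟩
  exact naturality_ofWord (τ := fun X => (σ X.circles).hom) h₀ h₂ (h₃ ▸ he) w

end Naturality

end UCob

/-! ### The universal property of the linearization. -/

namespace Lin

open Functor.LaxMonoidal Functor.OplaxMonoidal Functor.Monoidal

variable {k : Type w} [CommRing k] {C : Type u} [Category.{v} C] {E : Type u'} [Category.{v'} E]
  [Preadditive E] [Linear k E]

/-- The linear extension of a functor. -/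
def lift (F : C ⥤ E) : Lin k C ⥤ E where
  obj X := F.obj X.of
  map {X Y} f := Finsupp.linearCombination k (fun g : X.of ⟶ Y.of => F.map g) f
  map_id X := (Finsupp.linearCombination_single k (1 : k) (𝟙 X.of)).trans
    ((one_smul k _).trans (F.map_id X.of))
  map_comp {X Y Z} f g := by
    induction f using hom_induction with
    | zero => rw [Limits.zero_comp]; erw [map_zero, map_zero]; rw [Limits.zero_comp]
    | add a b ha hb =>
      rw [Preadditive.add_comp]; erw [map_add, map_add]; rw [ha, hb, Preadditive.add_comp]
    | smul r a =>
    induction g using hom_induction with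
    | zero => rw [Limits.comp_zero]; erw [map_zero, map_zero]; rw [Limits.comp_zero]
    | add a b ha hb =>
      rw [Preadditive.comp_add]; erw [map_add, map_add]; rw [ha, hb, Preadditive.comp_add]
    | smul s b =>
      rw [Linear.smul_comp, Linear.comp_smul, single_comp]
      erw [map_smul, map_smul, map_smul, map_smul, Finsupp.linearCombination_single,
        Finsupp.linearCombination_single, Finsupp.linearCombination_single]
      simp only [one_smul, F.map_comp, Linear.smul_comp, Linear.comp_smul]
      exact smul_comm r s _

theorem lift_map_single (F : C ⥤ E) {X Y : Lin k C} (f : X.of ⟶ Y.of) :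
    (lift F).map (single f : X ⟶ Y) = F.map f := by
  change Finsupp.linearCombination k (fun g : X.of ⟶ Y.of => F.map g) (Finsupp.single f 1) = _
  rw [Finsupp.linearCombination_single, one_smul]

instance (F : C ⥤ E) : (lift (k := k) F).Additive where
  map_add {X Y f g} := (Finsupp.linearCombination k (fun g : X.of ⟶ Y.of => F.map g)).map_add f g

instance (F : C ⥤ E) : (lift (k := k) F).Linear k where
  map_smul {X Y} f r :=
    (Finsupp.linearCombination k (fun g : X.of ⟶ Y.of => F.map g)).map_smul r f

theorem single_whiskerRight [MonoidalCategory C] {X Y : Lin k C} (f : X.of ⟶ Y.of) (Z : Lin k C) :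
    (single f : X ⟶ Y) ▷ Z = (single (f ▷ Z.of) : X ⊗ Z ⟶ Y ⊗ Z) := by
  rw [← tensorHom_id, ← tensorHom_id, ← single_id, single_tensor]

theorem whiskerLeft_single [MonoidalCategory C] {X Y : Lin k C} (f : X.of ⟶ Y.of) (Z : Lin k C) :
    Z ◁ (single f : X ⟶ Y) = (single (Z.of ◁ f) : Z ⊗ X ⟶ Z ⊗ Y) := by
  rw [← id_tensorHom, ← id_tensorHom, ← single_id, single_tensor]

section Monoidal

variable [MonoidalCategory C] [MonoidalCategory E] [MonoidalPreadditive E] [MonoidalLinear k E]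

instance (F : C ⥤ E) [F.Monoidal] : (lift (k := k) F).Monoidal :=
  Functor.CoreMonoidal.toMonoidal
    { εIso := εIso F
      μIso := fun X Y => μIso F X.of Y.of
      μIso_hom_natural_left := fun {X Y} f Z => by
        induction f using hom_induction with
        | zero =>
          rw [Functor.map_zero, MonoidalPreadditive.zero_whiskerRight, Limits.zero_comp,
            MonoidalPreadditive.zero_whiskerRight, Functor.map_zero, Limits.comp_zero]
        | add a b ha hb =>
          rw [Functor.map_add, MonoidalPreadditive.add_whiskerRight, Preadditive.add_comp, ha, hb,
            MonoidalPreadditive.add_whiskerRight, Functor.map_add, Preadditive.comp_add]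
        | smul r a =>
          rw [Functor.map_smul, MonoidalLinear.smul_whiskerRight, Linear.smul_comp,
            MonoidalLinear.smul_whiskerRight, Functor.map_smul, Linear.comp_smul,
            single_whiskerRight, lift_map_single, lift_map_single]
          exact congrArg (r • ·) (μ_natural_left F a Z.of)
      μIso_hom_natural_right := fun {X Y} Z f => by
        induction f using hom_induction with
        | zero =>
          rw [Functor.map_zero, MonoidalPreadditive.whiskerLeft_zero, Limits.zero_comp,
            MonoidalPreadditive.whiskerLeft_zero, Functor.map_zero, Limits.comp_zero]
        | add a b ha hb =>
          rw [Functor.map_add, MonoidalPreadditive.whiskerLeft_add, Preadditive.add_comp, ha, hb,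
            MonoidalPreadditive.whiskerLeft_add, Functor.map_add, Preadditive.comp_add]
        | smul r a =>
          rw [Functor.map_smul, MonoidalLinear.whiskerLeft_smul, Linear.smul_comp,
            MonoidalLinear.whiskerLeft_smul, Functor.map_smul, Linear.comp_smul,
            whiskerLeft_single, lift_map_single, lift_map_single]
          exact congrArg (r • ·) (μ_natural_right F Z.of a)
      associativity := fun X Y Z => by
        rw [associator_hom, lift_map_single]
        exact Functor.LaxMonoidal.associativity F X.of Y.of Z.of
      left_unitality := fun X => by
        rw [leftUnitor_hom X, lift_map_single]
        exact Functor.LaxMonoidal.left_unitality F X.of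
      right_unitality := fun X => by
        rw [rightUnitor_hom X, lift_map_single]
        exact Functor.LaxMonoidal.right_unitality F X.of }

instance [SymmetricCategory C] [BraidedCategory E] (F : C ⥤ E) [F.Braided] :
    (lift (k := k) F).Braided where
  braided X Y := (congrArg (μ F X.of Y.of ≫ ·) (lift_map_single F (X := X ⊗ Y) (Y := Y ⊗ X)
    (β_ X.of Y.of).hom)).trans (Functor.LaxBraided.braided (F := F) X.of Y.of)

/-- The linear extension restricts to the given functor. -/
def liftIso (F : C ⥤ E) : embedding k C ⋙ lift F ≅ F :=
  NatIso.ofComponents (fun _ => Iso.refl _) fun f =>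
    (Category.comp_id _).trans ((lift_map_single (k := k) F (X := ⟨_⟩) (Y := ⟨_⟩) f).trans
      (Category.id_comp _).symm)

instance (F : C ⥤ E) [F.Monoidal] : NatTrans.IsMonoidal (liftIso (k := k) F).hom where
  unit := (Category.comp_id _).trans ((congrArg (ε F ≫ ·) ((lift F).map_id _)).trans
    (Category.comp_id _))
  tensor X Y := (Category.comp_id _).trans ((congrArg (μ F X Y ≫ ·) ((lift F).map_id _)).trans
    ((Category.comp_id _).trans ((congrArg (· ≫ μ F X Y) (id_tensorHom_id _ _)).trans
      (Category.id_comp _)).symm))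

instance [SymmetricCategory C] : (embedding k C).Braided where
  braided _ _ := (Category.id_comp _).trans (Category.comp_id _).symm

end Monoidal

/-- Linear functors on the linearization are determined by their restrictions. -/
def isoOfRestriction {F G : Lin k C ⥤ E} [F.Additive] [F.Linear k] [G.Additive] [G.Linear k]
    (τ : embedding k C ⋙ F ≅ embedding k C ⋙ G) : F ≅ G :=
  NatIso.ofComponents (fun X => τ.app X.of) fun {X Y} f => by
    induction f using hom_induction with
    | zero => simp only [Functor.map_zero, Limits.zero_comp, Limits.comp_zero]
    | add a b ha hb =>
      simp only [Functor.map_add, Preadditive.add_comp, ha, hb, Preadditive.comp_add]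
    | smul r a =>
      rw [Functor.map_smul, Functor.map_smul, Linear.smul_comp, Linear.comp_smul]
      exact congrArg (r • ·) (τ.hom.naturality a)

end Lin

/-! ### The universal property of the quotient by a tensor ideal. -/

namespace TensorIdeal

open Functor.LaxMonoidal Functor.OplaxMonoidal Functor.Monoidal

variable {k : Type w} [CommRing k] {C : Type u} [Category.{v} C] [Preadditive C] [Linear k C]
  {E : Type u'} [Category.{v'} E] [Preadditive E] [Linear k E] [MonoidalCategory C]

/-- The morphisms which are mapped to zero by a linear monoidal functor. -/
def ker [MonoidalCategory E] [MonoidalPreadditive E] (F : C ⥤ E) [F.Monoidal] [F.Additive]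
    [F.Linear k] : TensorIdeal k C where
  carrier X Y := LinearMap.ker (F.mapLinearMap k (X := X) (Y := Y))
  mem_comp {X Y Z f} hf g := by
    have hf : F.map f = 0 := hf
    change F.map (f ≫ g) = 0
    rw [F.map_comp, hf, Limits.zero_comp]
  comp_mem {X Y Z} f g hg := by
    have hg : F.map g = 0 := hg
    change F.map (f ≫ g) = 0
    rw [F.map_comp, hg, Limits.comp_zero]
  mem_tensor {X Y Z W f} hf g := by
    have hf : F.map f = 0 := hf
    change F.map (f ⊗ₘ g) = 0
    rw [map_tensor, hf, MonoidalAux.zero_tensor, Limits.zero_comp, Limits.comp_zero]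
  tensor_mem {X Y Z W} f g hg := by
    have hg : F.map g = 0 := hg
    change F.map (f ⊗ₘ g) = 0
    rw [map_tensor, hg, MonoidalAux.tensor_zero, Limits.zero_comp, Limits.comp_zero]

/-- The kernel of a linear monoidal functor is a tensor ideal, so it contains the ideal generated by
any family that it contains. -/
theorem map_eq_zero_of_mem_span [MonoidalCategory E] [MonoidalPreadditive E] (F : C ⥤ E)
    [F.Monoidal] [F.Additive] [F.Linear k] {S : ∀ X Y : C, Set (X ⟶ Y)}
    (h : ∀ X Y, ∀ f ∈ S X Y, F.map f = 0) {X Y : C} {f : X ⟶ Y}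
    (hf : f ∈ (span k S).carrier X Y) : F.map f = 0 := by
  simp only [span, Submodule.mem_iInf] at hf
  exact hf (ker F) h

theorem mem_span {S : ∀ X Y : C, Set (X ⟶ Y)} {X Y : C} {f : X ⟶ Y} (hf : f ∈ S X Y) :
    f ∈ (span k S).carrier X Y := by
  simp only [span, Submodule.mem_iInf]
  exact fun J hJ => hJ X Y hf

namespace QuotCat

variable {I : TensorIdeal k C}

theorem mk_eq_zero {X Y : QuotCat I} {f : X.as ⟶ Y.as} (hf : f ∈ I.carrier X.as Y.as) :
    (mk f : X ⟶ Y) = 0 := (Submodule.Quotient.mk_eq_zero _).2 hf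

instance : (functor I).Linear k where
  map_smul _ _ := rfl

/-- The functor on the quotient defined by a functor which vanishes on the tensor ideal. -/
def lift (F : C ⥤ E) [F.Additive] [F.Linear k]
    (h : ∀ {X Y : C} {f : X ⟶ Y}, f ∈ I.carrier X Y → F.map f = 0) : QuotCat I ⥤ E where
  obj X := F.obj X.as
  map {X Y} f := (I.carrier X.as Y.as).liftQ (F.mapLinearMap k) (fun _ hf => h hf) f
  map_id X := F.map_id X.as
  map_comp := by rintro _ _ _ ⟨f⟩ ⟨g⟩; exact F.map_comp f g

section Lift

variable (F : C ⥤ E) [F.Additive] [F.Linear k]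
    (h : ∀ {X Y : C} {f : X ⟶ Y}, f ∈ I.carrier X Y → F.map f = 0)

instance : (lift F h).Additive where
  map_add {X Y f g} := ((I.carrier X.as Y.as).liftQ (F.mapLinearMap k) fun _ hf => h hf).map_add f g

instance : (lift F h).Linear k where
  map_smul {X Y} f r :=
    ((I.carrier X.as Y.as).liftQ (F.mapLinearMap k) fun _ hf => h hf).map_smul r f

variable [MonoidalPreadditive C] [MonoidalCategory E] [F.Monoidal]

instance : (lift F h).Monoidal :=
  Functor.CoreMonoidal.toMonoidal
    { εIso := εIso F
      μIso := fun X Y => μIso F X.as Y.as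
      μIso_hom_natural_left := fun {X Y} f Z => by
        obtain ⟨f, rfl⟩ := mk_surjective f
        rw [mk_whiskerRight]
        exact μ_natural_left F f Z.as
      μIso_hom_natural_right := fun {X Y} Z f => by
        obtain ⟨f, rfl⟩ := mk_surjective f
        rw [whiskerLeft_mk]
        exact μ_natural_right F Z.as f
      associativity := fun X Y Z => Functor.LaxMonoidal.associativity F X.as Y.as Z.as
      left_unitality := fun X => Functor.LaxMonoidal.left_unitality F X.as
      right_unitality := fun X => Functor.LaxMonoidal.right_unitality F X.as }

/-- The functor on the quotient restricts to the given functor. -/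
def liftIso : functor I ⋙ lift F h ≅ F :=
  NatIso.ofComponents (fun _ => Iso.refl _) fun _ =>
    (Category.comp_id _).trans (Category.id_comp _).symm

instance : NatTrans.IsMonoidal (liftIso F h).hom where
  unit := (Category.comp_id _).trans ((congrArg (ε F ≫ ·) ((lift F h).map_id _)).trans
    (Category.comp_id _))
  tensor X Y := (Category.comp_id _).trans ((congrArg (μ F X Y ≫ ·) ((lift F h).map_id _)).trans
    ((Category.comp_id _).trans ((congrArg (· ≫ μ F X Y) (id_tensorHom_id _ _)).trans
      (Category.id_comp _)).symm))

end Lift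

instance [MonoidalPreadditive C] [SymmetricCategory C] [MonoidalCategory E] [BraidedCategory E]
    (F : C ⥤ E) [F.Additive] [F.Linear k] [F.Braided]
    (h : ∀ {X Y : C} {f : X ⟶ Y}, f ∈ I.carrier X Y → F.map f = 0) : (lift F h).Braided where
  braided X Y := Functor.LaxBraided.braided (F := F) X.as Y.as

instance [MonoidalPreadditive C] [SymmetricCategory C] : (functor I).Braided where
  braided _ _ := (Category.id_comp _).trans (Category.comp_id _).symm

/-- Functors on the quotient are determined by their restrictions. -/
def isoOfRestriction {F G : QuotCat I ⥤ E} (τ : functor I ⋙ F ≅ functor I ⋙ G) : F ≅ G :=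
  NatIso.ofComponents (fun X => τ.app X.as) fun {X Y} f => by
    obtain ⟨f, rfl⟩ := mk_surjective f
    exact τ.hom.naturality f

end QuotCat

end TensorIdeal

/-! ### Extension of monoidal functors to additive envelopes. -/

namespace CategoryTheory.Mat_

open Functor.LaxMonoidal Functor.OplaxMonoidal Functor.Monoidal

variable {C : Type u} [Category.{v} C] [Preadditive C] {E : Type u'} [Category.{v} E]
  [Preadditive E] (F : C ⥤ E) [F.Additive]

/-- All coherence maps of the additive envelope are generalized diagonal matrices. Since these are
preserved, the monoidal axioms of `F.mapMat_` reduce entry by entry to those of `F`. -/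
theorem mapMat_diag {M N : Mat_ C} (e : M.ι → N.ι) (φ : ∀ i, M.X i ⟶ N.X (e i)) :
    F.mapMat_.map (diag e φ) = diag (M := F.mapMat_.obj M) (N := F.mapMat_.obj N) e
      fun i => F.map (φ i) := by
  refine hom_ext (M := F.mapMat_.obj M) (N := F.mapMat_.obj N) _ _ fun (i : M.ι) (j : N.ι) => ?_
  change F.map (diag e φ i j) = _
  by_cases h : e i = j
  · subst h
    rw [diag_apply_self]
    exact (diag_apply_self (M := F.mapMat_.obj M) (N := F.mapMat_.obj N) e
      (fun i => F.map (φ i)) i).symm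
  · rw [diag_apply_of_ne _ _ h, F.map_zero]
    exact (diag_apply_of_ne (M := F.mapMat_.obj M) (N := F.mapMat_.obj N) e
      (fun i => F.map (φ i)) h).symm

instance : F.mapMat_.Additive where
  map_add {M N _ _} :=
    hom_ext (M := F.mapMat_.obj M) (N := F.mapMat_.obj N) _ _ fun _ _ => F.map_add

instance {k : Type w} [CommRing k] [Linear k C] [Linear k E] [F.Linear k] : F.mapMat_.Linear k where
  map_smul {M N} f r := hom_ext (M := F.mapMat_.obj M) (N := F.mapMat_.obj N) _ _ fun i j =>
    F.map_smul r (f i j)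

instance {k : Type w} [CommRing k] [Linear k C] : (embedding C).Linear k where
  map_smul _ _ := rfl


theorem mapMat_id_apply (M : Mat_ C) (i j : M.ι) :
    (𝟙 (F.mapMat_.obj M) : F.mapMat_.obj M ⟶ F.mapMat_.obj M) i j =
      F.map ((𝟙 M : M ⟶ M) i j) :=
  (congrFun (congrFun (F.mapMat_.map_id M) i) j).symm

variable [MonoidalCategory C] [MonoidalPreadditive C] [MonoidalCategory E] [MonoidalPreadditive E]

/-- Compatibility of the entrywise application of a monoidal functor with tensor products. -/
def mapMatμ [F.Monoidal] (M N : Mat_ C) :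
    F.mapMat_.obj M ⊗ F.mapMat_.obj N ≅ F.mapMat_.obj (M ⊗ N) where
  hom := diag (M := tensor (F.mapMat_.obj M) (F.mapMat_.obj N)) (N := F.mapMat_.obj (tensor M N))
    (fun p => p) fun p => μ F (M.X p.1) (N.X p.2)
  inv := diag (M := F.mapMat_.obj (tensor M N)) (N := tensor (F.mapMat_.obj M) (F.mapMat_.obj N))
    (fun p => p) fun p => δ F (M.X p.1) (N.X p.2)
  hom_inv_id := (diag_comp_diag _ _ _ _).trans (diag_eq_id _ fun _ => μ_δ _ _ _)
  inv_hom_id := (diag_comp_diag _ _ _ _).trans (diag_eq_id _ fun _ => δ_μ _ _ _)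

/-- Compatibility of the entrywise application of a monoidal functor with unit objects. -/
def mapMatε [F.Monoidal] : 𝟙_ (Mat_ E) ≅ F.mapMat_.obj (𝟙_ (Mat_ C)) where
  hom := diag (M := unit) (N := F.mapMat_.obj unit) (fun p => p) fun _ => ε F
  inv := diag (M := F.mapMat_.obj unit) (N := unit) (fun p => p) fun _ => η F
  hom_inv_id := (diag_comp_diag _ _ _ _).trans (diag_eq_id _ fun _ => ε_η _)
  inv_hom_id := (diag_comp_diag _ _ _ _).trans (diag_eq_id _ fun _ => η_ε _)

instance [F.Monoidal] : F.mapMat_.Monoidal :=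
  Functor.CoreMonoidal.toMonoidal
    { εIso := mapMatε F
      μIso := mapMatμ F
      μIso_hom_natural_left := fun {X Y} f Z =>
        comp_diag_eq (M := tensor (F.mapMat_.obj X) (F.mapMat_.obj Z))
          (N := tensor (F.mapMat_.obj Y) (F.mapMat_.obj Z)) (K := F.mapMat_.obj (tensor X Z))
          (L := F.mapMat_.obj (tensor Y Z)) _ _ _ Function.bijective_id _ _ _ fun p q =>
            (congrArg (fun t => (F.map (f p.1 q.1) ⊗ₘ t) ≫ μ F (Y.X q.1) (Z.X q.2))
              (mapMat_id_apply F Z p.2 q.2)).trans (μ_natural F _ _)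
      μIso_hom_natural_right := fun {X Y} Z f =>
        comp_diag_eq (M := tensor (F.mapMat_.obj Z) (F.mapMat_.obj X))
          (N := tensor (F.mapMat_.obj Z) (F.mapMat_.obj Y)) (K := F.mapMat_.obj (tensor Z X))
          (L := F.mapMat_.obj (tensor Z Y)) _ _ _ Function.bijective_id _ _ _ fun p q =>
            (congrArg (fun t => (t ⊗ₘ F.map (f p.2 q.2)) ≫ μ F (Z.X q.1) (Y.X q.2))
              (mapMat_id_apply F Z p.1 q.1)).trans (μ_natural F _ _)
      associativity := fun X Y Z => by
        rw [← tensorHom_id, ← id_tensorHom, id_eq_diag, id_eq_diag]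
        refine (congrArg₂ (· ≫ ·) (diag_tensor_diag _ _ _ _) ((congrArg₂ (· ≫ ·) rfl
          (mapMat_diag F _ _)).trans (diag_comp_diag _ _ _ _))).trans
            ((diag_comp_diag _ _ _ _).trans (Eq.trans ?_ (congrArg₂ (· ≫ ·) rfl
            ((congrArg₂ (· ≫ ·) (diag_tensor_diag _ _ _ _) rfl).trans
              (diag_comp_diag _ _ _ _))).symm))
        refine Eq.trans ?_ (diag_comp_diag _ _ _ _).symm
        refine diag_congr (M := tensor (tensor (F.mapMat_.obj X) (F.mapMat_.obj Y))
          (F.mapMat_.obj Z)) (N := F.mapMat_.obj (tensor X (tensor Y Z))) _ fun p => ?_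
        refine Eq.trans ?_ ((Functor.LaxMonoidal.associativity F (X.X p.1.1) (Y.X p.1.2)
          (Z.X p.2)).trans ?_)
        · exact congrArg (· ≫ _) (tensorHom_id _ _)
        · exact congrArg ((α_ _ _ _).hom ≫ ·) (congrArg (· ≫ _) (id_tensorHom _ _).symm)
      left_unitality := fun X => by
        rw [← tensorHom_id, id_eq_diag]
        refine Eq.trans ?_ (congrArg₂ (· ≫ ·) (diag_tensor_diag _ _ _ _)
          ((congrArg₂ (· ≫ ·) rfl (mapMat_diag F _ _)).trans (diag_comp_diag _ _ _ _))).symm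
        refine Eq.trans ?_ (diag_comp_diag _ _ _ _).symm
        refine diag_congr (M := tensor unit (F.mapMat_.obj X)) (N := F.mapMat_.obj X) _ fun p => ?_
        exact (Functor.LaxMonoidal.left_unitality F (X.X p.2)).trans
          (congrArg (· ≫ _) (tensorHom_id _ _).symm)
      right_unitality := fun X => by
        rw [← id_tensorHom, id_eq_diag]
        refine Eq.trans ?_ (congrArg₂ (· ≫ ·) (diag_tensor_diag _ _ _ _)
          ((congrArg₂ (· ≫ ·) rfl (mapMat_diag F _ _)).trans (diag_comp_diag _ _ _ _))).symm
        refine Eq.trans ?_ (diag_comp_diag _ _ _ _).symm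
        refine diag_congr (M := tensor (F.mapMat_.obj X) unit) (N := F.mapMat_.obj X) _ fun p => ?_
        exact (Functor.LaxMonoidal.right_unitality F (X.X p.1)).trans
          (congrArg (· ≫ _) (id_tensorHom _ _).symm) }

instance [SymmetricCategory C] [SymmetricCategory E] [F.Braided] : F.mapMat_.Braided where
  braided X Y := by
    refine ((congrArg₂ (· ≫ ·) rfl (mapMat_diag F _ _)).trans (diag_comp_diag _ _ _ _)).trans
      (Eq.trans ?_ (diag_comp_diag _ _ _ _).symm)
    exact diag_congr (M := tensor (F.mapMat_.obj X) (F.mapMat_.obj Y))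
      (N := F.mapMat_.obj (tensor Y X)) _ fun p =>
        Functor.LaxBraided.braided (F := F) (X.X p.1) (Y.X p.2)

instance [SymmetricCategory C] : (embedding C).Braided where
  braided X Y := by
    change (embeddingμ X Y).hom ≫ (embedding C).map (β_ X Y).hom =
      (β_ ((embedding C).obj X) ((embedding C).obj Y)).hom ≫ (embeddingμ Y X).hom
    rw [embedding_map_eq_diag]
    refine (diag_comp_diag _ _ _ _).trans (Eq.trans ?_ (diag_comp_diag _ _ _ _).symm)
    exact diag_congr (M := tensor ((embedding C).obj X) ((embedding C).obj Y))
      (N := (embedding C).obj (Y ⊗ X)) _ fun p =>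
        (Category.id_comp _).trans (Category.comp_id _).symm

/-- The entrywise application of a functor extends it. -/
def embeddingCompMapMat : embedding C ⋙ F.mapMat_ ≅ F ⋙ embedding E :=
  NatIso.ofComponents (fun _ => Iso.refl _) fun _ =>
    (Category.comp_id _).trans (Category.id_comp _).symm

instance [F.Monoidal] : NatTrans.IsMonoidal (embeddingCompMapMat F).hom where
  unit := by
    refine (Category.comp_id _).trans ?_
    change (mapMatε F).hom ≫ F.mapMat_.map (𝟙 (𝟙_ (Mat_ C))) = 𝟙 _ ≫ (embedding E).map (ε F)
    rw [F.mapMat_.map_id]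
    refine (Category.comp_id _).trans ?_
    exact ((Category.id_comp _).trans (embedding_map_eq_diag (ε F))).symm
  tensor X Y := by
    refine (Category.comp_id _).trans (Eq.trans ?_ ((congrArg₂ (· ≫ ·) (id_tensorHom_id _ _)
      rfl).trans (Category.id_comp _)).symm)
    change (mapMatμ F ((embedding C).obj X) ((embedding C).obj Y)).hom ≫
      F.mapMat_.map (embeddingμ X Y).hom =
        (embeddingμ (F.obj X) (F.obj Y)).hom ≫ (embedding E).map (μ F X Y)
    rw [embedding_map_eq_diag]
    refine ((congrArg₂ (· ≫ ·) rfl (mapMat_diag F _ _)).trans (diag_comp_diag _ _ _ _)).trans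
      (Eq.trans ?_ (diag_comp_diag _ _ _ _).symm)
    exact diag_congr (M := tensor (F.mapMat_.obj ((embedding C).obj X))
        (F.mapMat_.obj ((embedding C).obj Y)))
      (N := (embedding E).obj (F.obj (X ⊗ Y))) _ fun p =>
        (congrArg (μ F X Y ≫ ·) (F.map_id _)).trans
          ((Category.comp_id _).trans (Category.id_comp _).symm)

end CategoryTheory.Mat_

/-! ### Extension of monoidal functors to idempotent completions. -/

namespace CategoryTheory.Idempotents.Karoubi

open Functor.LaxMonoidal Functor.OplaxMonoidal Functor.Monoidal

variable {C : Type u} [Category.{v} C] {E : Type u'} [Category.{v'} E] (F : C ⥤ E)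

/-- The functor between idempotent completions defined by a functor. -/
def mapKaroubi : Karoubi C ⥤ Karoubi E where
  obj P := ⟨F.obj P.X, F.map P.p, by rw [← F.map_comp, P.idem]⟩
  map f := ⟨F.map f.f, by dsimp only; rw [← F.map_comp, ← F.map_comp, f.comm]⟩
  map_id _ := rfl
  map_comp f g := hom_ext _ _ (F.map_comp f.f g.f)

/-- The coherence maps of the idempotent completion are all of the form `homOf`, so this reduces the
monoidal axioms of `mapKaroubi F` to those of `F`. -/
theorem mapKaroubi_homOf {P Q : Karoubi C} (φ : Compat P Q) :
    (mapKaroubi F).map (homOf φ) = homOf (P := (mapKaroubi F).obj P) (Q := (mapKaroubi F).obj Q)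
      ⟨F.map φ.1, by
        change F.map P.p ≫ F.map φ.1 = F.map φ.1 ≫ F.map Q.p
        rw [← F.map_comp, φ.2, F.map_comp]⟩ :=
  hom_ext _ _ (F.map_comp _ _)

instance [Preadditive C] [Preadditive E] [F.Additive] : (mapKaroubi F).Additive where
  map_add := hom_ext _ _ F.map_add

instance {k : Type w} [CommRing k] [Preadditive C] [Preadditive E] [Linear k C] [Linear k E]
    [F.Additive] [F.Linear k] : (mapKaroubi F).Linear k where
  map_smul f r := hom_ext _ _ (F.map_smul r f.f)

instance {k : Type w} [CommRing k] [Preadditive C] [Linear k C] : (toKaroubi C).Linear k where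
  map_smul _ _ := rfl

theorem toKaroubi_map_eq_homOf {X Y : C} (f : X ⟶ Y) : (toKaroubi C).map f =
    homOf (P := (toKaroubi C).obj X) (Q := (toKaroubi C).obj Y)
      ⟨f, (Category.id_comp f).trans (Category.comp_id f).symm⟩ :=
  hom_ext _ _ (Category.id_comp f).symm

variable [MonoidalCategory C] [MonoidalCategory E]

instance [F.Monoidal] : (mapKaroubi F).Monoidal :=
  Functor.CoreMonoidal.toMonoidal
    { εIso := isoOf (P := unit) (Q := (mapKaroubi F).obj unit) (εIso F) (by
        change 𝟙 _ ≫ ε F = ε F ≫ F.map (𝟙 _)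
        rw [Category.id_comp, F.map_id, Category.comp_id])
      μIso := fun P Q => isoOf (P := tensor ((mapKaroubi F).obj P) ((mapKaroubi F).obj Q))
        (Q := (mapKaroubi F).obj (tensor P Q)) (μIso F P.X Q.X) (μ_natural F P.p Q.p)
      μIso_hom_natural_left := fun {P Q} f R =>
        comp_homOf_eq (P := tensor ((mapKaroubi F).obj P) ((mapKaroubi F).obj R))
          (Q := tensor ((mapKaroubi F).obj Q) ((mapKaroubi F).obj R))
          (R := (mapKaroubi F).obj (tensor P R)) (S := (mapKaroubi F).obj (tensor Q R)) _ _ _ _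
          (μ_natural F f.f R.p)
      μIso_hom_natural_right := fun {P Q} R f =>
        comp_homOf_eq (P := tensor ((mapKaroubi F).obj R) ((mapKaroubi F).obj P))
          (Q := tensor ((mapKaroubi F).obj R) ((mapKaroubi F).obj Q))
          (R := (mapKaroubi F).obj (tensor R P)) (S := (mapKaroubi F).obj (tensor R Q)) _ _ _ _
          (μ_natural F R.p f.f)
      associativity := fun P Q R => by
        rw [← tensorHom_id, ← id_tensorHom, id_eq_homOf, id_eq_homOf]
        refine (congrArg₂ (· ≫ ·) (homOf_tensor _ _) ((congrArg₂ (· ≫ ·) rfl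
          (mapKaroubi_homOf F _)).trans (homOf_comp _ _))).trans ((homOf_comp _ _).trans
          (Eq.trans ?_ (congrArg₂ (· ≫ ·) rfl
            ((congrArg₂ (· ≫ ·) (homOf_tensor _ _) rfl).trans (homOf_comp _ _))).symm))
        refine Eq.trans ?_ (homOf_comp _ _).symm
        refine homOf_congr (P := tensor (tensor ((mapKaroubi F).obj P) ((mapKaroubi F).obj Q))
          ((mapKaroubi F).obj R)) (Q := (mapKaroubi F).obj (tensor P (tensor Q R))) ?_
        refine Eq.trans ?_ ((Functor.LaxMonoidal.associativity F P.X Q.X R.X).trans ?_)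
        · exact congrArg (· ≫ _) (tensorHom_id _ _)
        · exact congrArg ((α_ _ _ _).hom ≫ ·) (congrArg (· ≫ _) (id_tensorHom _ _).symm)
      left_unitality := fun P => by
        rw [← tensorHom_id, id_eq_homOf]
        refine Eq.trans ?_ (congrArg₂ (· ≫ ·) (homOf_tensor _ _)
          ((congrArg₂ (· ≫ ·) rfl (mapKaroubi_homOf F _)).trans (homOf_comp _ _))).symm
        refine Eq.trans ?_ (homOf_comp _ _).symm
        refine homOf_congr (P := tensor unit ((mapKaroubi F).obj P)) (Q := (mapKaroubi F).obj P) ?_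
        exact (Functor.LaxMonoidal.left_unitality F P.X).trans
          (congrArg (· ≫ _) (tensorHom_id _ _).symm)
      right_unitality := fun P => by
        rw [← id_tensorHom, id_eq_homOf]
        refine Eq.trans ?_ (congrArg₂ (· ≫ ·) (homOf_tensor _ _)
          ((congrArg₂ (· ≫ ·) rfl (mapKaroubi_homOf F _)).trans (homOf_comp _ _))).symm
        refine Eq.trans ?_ (homOf_comp _ _).symm
        refine homOf_congr (P := tensor ((mapKaroubi F).obj P) unit) (Q := (mapKaroubi F).obj P) ?_
        exact (Functor.LaxMonoidal.right_unitality F P.X).trans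
          (congrArg (· ≫ _) (id_tensorHom _ _).symm) }

instance [SymmetricCategory C] [SymmetricCategory E] [F.Braided] : (mapKaroubi F).Braided where
  braided P Q := by
    refine ((congrArg₂ (· ≫ ·) rfl (mapKaroubi_homOf F _)).trans (homOf_comp _ _)).trans
      (Eq.trans ?_ (homOf_comp _ _).symm)
    exact homOf_congr (P := tensor ((mapKaroubi F).obj P) ((mapKaroubi F).obj Q))
      (Q := (mapKaroubi F).obj (tensor Q P)) (Functor.LaxBraided.braided (F := F) P.X Q.X)

instance [SymmetricCategory C] : (toKaroubi C).Braided where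
  braided X Y := by
    change (toKaroubiμ X Y).hom ≫ (toKaroubi C).map (β_ X Y).hom =
      (β_ ((toKaroubi C).obj X) ((toKaroubi C).obj Y)).hom ≫ (toKaroubiμ Y X).hom
    rw [toKaroubi_map_eq_homOf]
    refine (homOf_comp _ _).trans (Eq.trans ?_ (homOf_comp _ _).symm)
    exact homOf_congr (P := tensor ((toKaroubi C).obj X) ((toKaroubi C).obj Y))
      (Q := (toKaroubi C).obj (Y ⊗ X)) ((Category.id_comp _).trans (Category.comp_id _).symm)

/-- The functor between idempotent completions extends the given one. -/
def toKaroubiCompMapKaroubi : toKaroubi C ⋙ mapKaroubi F ≅ F ⋙ toKaroubi E :=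
  NatIso.ofComponents (fun X => isoOf (P := (mapKaroubi F).obj ((toKaroubi C).obj X))
    (Q := (toKaroubi E).obj (F.obj X)) (Iso.refl (F.obj X))
    ((Category.comp_id _).trans ((F.map_id X).trans (Category.comp_id _).symm))) fun {X Y} _ =>
      comp_homOf_eq (P := (mapKaroubi F).obj ((toKaroubi C).obj X))
        (Q := (mapKaroubi F).obj ((toKaroubi C).obj Y)) (R := (toKaroubi E).obj (F.obj X))
        (S := (toKaroubi E).obj (F.obj Y)) _ _ _ _
        ((Category.comp_id _).trans (Category.id_comp _).symm)

instance [F.Monoidal] : NatTrans.IsMonoidal (toKaroubiCompMapKaroubi F).hom where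
  unit := hom_ext _ _ (by
    change ((𝟙 _ ≫ ε F) ≫ F.map (𝟙 _)) ≫ F.map (𝟙 _) ≫ 𝟙 _ = 𝟙 _ ≫ ε F
    simp)
  tensor X Y := hom_ext _ _ (by
    change (((F.map (𝟙 X) ⊗ₘ F.map (𝟙 Y)) ≫ μ F X Y) ≫ F.map ((𝟙 X ⊗ₘ 𝟙 Y) ≫ 𝟙 (X ⊗ Y))) ≫
      F.map (𝟙 (X ⊗ Y)) ≫ 𝟙 _ = ((F.map (𝟙 X) ≫ 𝟙 _) ⊗ₘ (F.map (𝟙 Y) ≫ 𝟙 _)) ≫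
        ((𝟙 (F.obj X) ⊗ₘ 𝟙 (F.obj Y)) ≫ 𝟙 _) ≫ μ F X Y
    simp)

end CategoryTheory.Idempotents.Karoubi

/-! ### Additive functors on dense subcategories, and quasi-inverses of braided equivalences. -/

namespace CategoryTheory

/-- Every object is a direct summand of a finite direct sum of objects in the image of the
functor. -/
def Functor.SummandDense {C : Type u} [Category.{v} C] {D : Type u'} [Category.{v'} D]
    [Preadditive D] (I : C ⥤ D) : Prop :=
  ∀ X : D, ∃ (n : Type) (_ : Fintype n) (Y : n → C) (p : ∀ i, X ⟶ I.obj (Y i))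
    (j : ∀ i, I.obj (Y i) ⟶ X), ∑ i, p i ≫ j i = 𝟙 X

section Dense

variable {C : Type u} [Category.{v} C] {D : Type u'} [Category.{v'} D] [Preadditive D]
  {E : Type w} [Category.{w'} E] [Preadditive E]

/-- Additive functors are determined by their restrictions to a full dense subcategory. -/
theorem Functor.SummandDense.nonempty_iso {I : C ⥤ D} (hI : I.SummandDense) [I.Full]
    {F G : D ⥤ E} [F.Additive] [G.Additive] (α : I ⋙ F ≅ I ⋙ G) : Nonempty (F ≅ G) := by
  choose n hn Y p j total using hI
  -- The candidate component at `X` is the sum of the maps `F(p i) ≫ α ≫ G(j i)`. It can be moved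
  -- past any `f : X ⟶ I.obj Z`: fullness puts `j i ≫ f` in the image of `I`, where `α` is natural,
  -- and the sum of the `p i ≫ j i` is then the identity. Taking `f` to be some `p i` gives
  -- invertibility, and taking `f` to be a morphism followed by some `p i` gives naturality.
  have key : ∀ (F G : D ⥤ E) [F.Additive] [G.Additive] (α : I ⋙ F ⟶ I ⋙ G) (X : D) (Z : C)
      (f : X ⟶ I.obj Z), (∑ i, F.map (p X i) ≫ α.app (Y X i) ≫ G.map (j X i)) ≫ G.map f =
        F.map f ≫ α.app Z := by
    intro F G _ _ α X Z f
    have h : ∀ i, α.app (Y X i) ≫ G.map (j X i) ≫ G.map f = F.map (j X i ≫ f) ≫ α.app Z := by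
      intro i
      obtain ⟨g, hg⟩ := I.map_surjective (j X i ≫ f)
      rw [← G.map_comp, ← hg]
      exact (α.naturality g).symm
    simp only [Preadditive.sum_comp, Category.assoc, h, F.map_comp]
    simp only [← Category.assoc, ← Preadditive.sum_comp, ← F.map_comp, ← F.map_sum, total,
      Category.id_comp]
  have total' : ∀ (F : D ⥤ E) [F.Additive] (X : D), ∑ i, F.map (p X i) ≫ F.map (j X i) = 𝟙 _ := by
    intro F _ X
    simp only [← F.map_comp, ← F.map_sum, total, F.map_id]
  refine ⟨NatIso.ofComponents (fun X =>
    { hom := ∑ i, F.map (p X i) ≫ α.hom.app (Y X i) ≫ G.map (j X i)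
      inv := ∑ i, G.map (p X i) ≫ α.inv.app (Y X i) ≫ F.map (j X i)
      hom_inv_id := ?_
      inv_hom_id := ?_ }) ?_⟩
  · rw [Preadditive.comp_sum]
    simp only [reassoc_of% key F G α.hom X]
    simpa using total' F X
  · rw [Preadditive.comp_sum]
    simp only [reassoc_of% key G F α.inv X]
    simpa using total' G X
  · intro X X' f
    have h := fun i => key F G α.hom X _ (f ≫ p X' i)
    simp only [Preadditive.comp_sum]
    simp only [← Category.assoc, ← F.map_comp]
    simp only [← h, Category.assoc, G.map_comp]
    simp only [← Preadditive.comp_sum, total', Category.comp_id]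

end Dense

section Monoidal

open Functor.LaxMonoidal Functor.OplaxMonoidal Functor.Monoidal

variable {C : Type u} [Category.{v} C] [MonoidalCategory C] {D : Type u'} [Category.{v'} D]
  [MonoidalCategory D] {E : Type w} [Category.{w'} E] [MonoidalCategory E]

/-- Existence of a monoidal natural isomorphism. -/
def Functor.MonIso (F G : C ⥤ D) [F.Monoidal] [G.Monoidal] : Prop :=
  ∃ τ : F ≅ G, NatTrans.IsMonoidal τ.hom

namespace Functor.MonIso

theorem symm {F G : C ⥤ D} [F.Monoidal] [G.Monoidal] : F.MonIso G → G.MonIso F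
  | ⟨τ, _⟩ => ⟨τ.symm, inferInstanceAs (NatTrans.IsMonoidal τ.inv)⟩

theorem trans {F G H : C ⥤ D} [F.Monoidal] [G.Monoidal] [H.Monoidal] :
    F.MonIso G → G.MonIso H → F.MonIso H
  | ⟨τ, _⟩, ⟨σ, _⟩ => ⟨τ ≪≫ σ, inferInstanceAs (NatTrans.IsMonoidal (τ.hom ≫ σ.hom))⟩

theorem whiskerRight {F G : C ⥤ D} [F.Monoidal] [G.Monoidal] (H : D ⥤ E) [H.Monoidal] :
    F.MonIso G → (F ⋙ H).MonIso (G ⋙ H)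
  | ⟨τ, _⟩ => ⟨isoWhiskerRight τ H,
      inferInstanceAs (NatTrans.IsMonoidal (Functor.whiskerRight τ.hom H))⟩

theorem whiskerLeft {F G : D ⥤ E} [F.Monoidal] [G.Monoidal] (H : C ⥤ D) [H.Monoidal] :
    F.MonIso G → (H ⋙ F).MonIso (H ⋙ G)
  | ⟨τ, _⟩ => ⟨isoWhiskerLeft H τ,
      inferInstanceAs (NatTrans.IsMonoidal (Functor.whiskerLeft H τ.hom))⟩

theorem assoc {B : Type*} [Category* B] [MonoidalCategory B] (F : B ⥤ C) [F.Monoidal] (G : C ⥤ D)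
    [G.Monoidal] (H : D ⥤ E) [H.Monoidal] : ((F ⋙ G) ⋙ H).MonIso (F ⋙ G ⋙ H) :=
  ⟨associator F G H, inferInstance⟩

theorem comp_id (F : C ⥤ D) [F.Monoidal] : (F ⋙ 𝟭 D).MonIso F := ⟨F.rightUnitor, inferInstance⟩

theorem isomorphic {F G : C ⥤ D} [F.Monoidal] [G.Monoidal] (A : ExtFrobData C) :
    F.MonIso G → ExtFrobData.Isomorphic (A.map F) (A.map G)
  | ⟨τ, _⟩ => A.isomorphic_of_natIso τ

end Functor.MonIso

variable [BraidedCategory C] [BraidedCategory D]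

/-- The quasi-inverse carries the monoidal structure for which unit and counit are monoidal. Its
compatibility with braidings can be checked after applying the faithful functor `e.functor`; there,
monoidality of the counit turns it into naturality of the braiding. -/
theorem Equivalence.exists_braided_inverse (e : C ≌ D) [e.functor.Braided] :
    ∃ (_ : e.inverse.Braided), (e.functor ⋙ e.inverse).MonIso (𝟭 C) := by
  let := e.inverseMonoidal
  have : e.IsMonoidal :=
    (inferInstance : letI := e.toAdjunction.rightAdjointLaxMonoidal; e.toAdjunction.IsMonoidal)
  have hc : NatTrans.IsMonoidal e.counitIso.hom := inferInstanceAs (NatTrans.IsMonoidal e.counit)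
  have hu : NatTrans.IsMonoidal e.unitIso.hom := inferInstanceAs (NatTrans.IsMonoidal e.unit)
  refine ⟨{ braided := fun X Y => e.functor.map_injective ?_ },
    Functor.MonIso.symm ⟨e.unitIso, hu⟩⟩
  have h : ∀ X Y, (μ e.functor _ _ ≫ e.functor.map (μ e.inverse X Y)) ≫ e.counitIso.hom.app _ =
      (e.counitIso.hom.app X ⊗ₘ e.counitIso.hom.app Y) := fun X Y =>
    (hc.tensor X Y).trans (Category.comp_id _)
  rw [e.functor.map_comp, e.functor.map_comp, ← cancel_epi (μ e.functor _ _),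
    ← cancel_mono (e.counitIso.hom.app _), Functor.LaxBraided.braided_assoc]
  have n := e.counitIso.hom.naturality (β_ X Y).hom
  dsimp only [Functor.comp_map, Functor.id_map] at n
  have h₁ := h X Y
  have h₂ := h Y X
  simp only [Category.assoc] at h₁ h₂ ⊢
  rw [n, h₂, reassoc_of% h₁, BraidedCategory.braiding_naturality]

/-- A quasi-inverse of a linear braided monoidal equivalence is linear and braided monoidal. -/
theorem exists_braided_inverse {k : Type*} [CommRing k] [Preadditive C] [Linear k C]
    [Preadditive D] [Linear k D] (I : C ⥤ D) [I.IsEquivalence] [I.Braided] [I.Additive]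
    [I.Linear k] : ∃ (J : D ⥤ C) (_ : J.Braided), J.Additive ∧ J.Linear k ∧
      (I ⋙ J).MonIso (𝟭 C) := by
  obtain ⟨e, rfl⟩ : ∃ e : C ≌ D, e.functor = I := ⟨I.asEquivalence, rfl⟩
  obtain ⟨h, h'⟩ := e.exists_braided_inverse
  exact ⟨e.inverse, h, inferInstance, inferInstance, h'⟩

end Monoidal

end CategoryTheory

/-! ### The universal property of the pseudo-abelian envelope. -/

namespace PsAb

variable {C : Type u} [Category.{v} C] [Preadditive C]

open Limits

/-- An object of the idempotent completion is a retract of its underlying object of the additive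
envelope, and that object is the biproduct of its entries. Composing the two decompositions gives
the maps. -/
theorem summandDense_embedding : (embedding C).SummandDense := by
  intro P
  obtain ⟨p, j, total⟩ : ∃ (p : ∀ i, P.X ⟶ (Mat_.embedding C).obj (P.X.X i))
      (j : ∀ i, (Mat_.embedding C).obj (P.X.X i) ⟶ P.X), ∑ i, p i ≫ j i = 𝟙 P.X := by
    refine ⟨fun i => P.X.isoBiproductEmbedding.hom ≫
      biproduct.π (fun i => (Mat_.embedding C).obj (P.X.X i)) i, fun i =>
        biproduct.ι (fun i => (Mat_.embedding C).obj (P.X.X i)) i ≫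
          P.X.isoBiproductEmbedding.inv, ?_⟩
    simp only [Category.assoc, ← Preadditive.comp_sum]
    simp only [← Category.assoc, ← Preadditive.sum_comp, biproduct.total, Category.comp_id,
      Iso.hom_inv_id]
  obtain ⟨s, t, hst⟩ : ∃ (s : P ⟶ (Idempotents.toKaroubi _).obj P.X)
      (t : (Idempotents.toKaroubi _).obj P.X ⟶ P), s ≫ t = 𝟙 P :=
    ⟨P.decompId_i, P.decompId_p, P.decompId.symm⟩
  refine ⟨P.X.ι, inferInstance, P.X.X, fun i => s ≫ (Idempotents.toKaroubi _).map (p i),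
    fun i => (Idempotents.toKaroubi _).map (j i) ≫ t, ?_⟩
  have h : ∑ i, (Idempotents.toKaroubi (Mat_ C)).map (p i) ≫
      (Idempotents.toKaroubi (Mat_ C)).map (j i) = 𝟙 _ := by
    simp only [← Functor.map_comp, ← Functor.map_sum, total]
    exact CategoryTheory.Functor.map_id _ _
  calc _ = s ≫ (∑ i, (Idempotents.toKaroubi (Mat_ C)).map (p i) ≫
        (Idempotents.toKaroubi (Mat_ C)).map (j i)) ≫ t := by
        simp only [Preadditive.comp_sum, Preadditive.sum_comp, Category.assoc]
    _ = 𝟙 P := by rw [h, Category.id_comp, hst]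

/-- A category with finite biproducts is equivalent to its additive envelope. If it is also
idempotent complete, it is equivalent to its pseudo-abelian envelope, and values in the envelope can
be brought back to the category itself. -/
instance [HasFiniteBiproducts C] : (Mat_.embedding C).EssSurj where
  mem_essImage M := ⟨⨁ M.X, ⟨(Mat_.embedding C).mapBiproduct M.X ≪≫ M.isoBiproductEmbedding.symm⟩⟩

instance [HasFiniteBiproducts C] : (Mat_.embedding C).IsEquivalence where

instance [HasFiniteBiproducts C] [IsIdempotentComplete C] : IsIdempotentComplete (Mat_ C) :=
  (Idempotents.isIdempotentComplete_iff_of_equivalence (Mat_.embedding C).asEquivalence).1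
    inferInstance

/-- A symmetric monoidal linear functor extends to the pseudo-abelian envelope. -/
theorem exists_extension {k : Type w} [CommRing k] [Linear k C] [MonoidalCategory C]
    [MonoidalPreadditive C] [SymmetricCategory C] {E : Type u'} [Category.{v} E] [Preadditive E]
    [Linear k E] [MonoidalCategory E] [MonoidalPreadditive E] [SymmetricCategory E]
    [HasFiniteBiproducts E] [IsIdempotentComplete E] (F : C ⥤ E) [F.Braided] [F.Additive]
    [F.Linear k] : ∃ (H : PsAb C ⥤ E) (_ : H.Braided), H.Additive ∧ H.Linear k ∧
      (embedding C ⋙ H).MonIso F := by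
  -- The extension applies `F` to entries and idempotents, which lands in the envelope of `E`, and
  -- returns to `E` by a braided quasi-inverse of the embedding.
  obtain ⟨J, _, _, _, hJ⟩ := exists_braided_inverse (k := k) (embedding E)
  refine ⟨Idempotents.Karoubi.mapKaroubi F.mapMat_ ⋙ J, inferInstance, inferInstance,
    inferInstance, ?_⟩
  have h₁ : (Idempotents.toKaroubi (Mat_ C) ⋙ Idempotents.Karoubi.mapKaroubi F.mapMat_).MonIso
    (F.mapMat_ ⋙ Idempotents.toKaroubi (Mat_ E)) :=
      ⟨Idempotents.Karoubi.toKaroubiCompMapKaroubi F.mapMat_, inferInstance⟩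
  have h₂ : (Mat_.embedding C ⋙ F.mapMat_).MonIso (F ⋙ Mat_.embedding E) :=
    ⟨Mat_.embeddingCompMapMat F, inferInstance⟩
  have h₃ : (embedding C ⋙ Idempotents.Karoubi.mapKaroubi F.mapMat_).MonIso (F ⋙ embedding E) :=
    (((Functor.MonIso.assoc _ _ _).trans (h₁.whiskerLeft _)).trans
      (Functor.MonIso.assoc _ _ _).symm).trans ((h₂.whiskerRight _).trans
        (Functor.MonIso.assoc _ _ _))
  exact (Functor.MonIso.assoc _ _ _).symm.trans ((h₃.whiskerRight J).trans
    ((Functor.MonIso.assoc _ _ _).trans ((hJ.whiskerLeft F).trans (Functor.MonIso.comp_id F))))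

end PsAb

/-! ### The universal property of the skein category. -/

namespace SkeinTriple

open ExtFrobData Functor.LaxMonoidal Functor.OplaxMonoidal Functor.Monoidal

variable {k : Type w} [Field k]

section Closed

variable {C : Type u} [Category.{v} C] [MonoidalCategory C] [Preadditive C] [Linear k C]

theorem Evaluates.of_isomorphic {T : SkeinTriple k} {A B : ExtFrobData C} (h : Isomorphic A B)
    (hA : T.Evaluates A) : T.Evaluates B := by
  obtain ⟨e, he⟩ := h
  have key : ∀ (t : 𝟙_ C ⟶ A.X) (g : ℕ), (t ≫ e.hom) ≫ B.handlePow g ≫ B.counit =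
      t ≫ A.handlePow g ≫ A.counit := by
    intro t g
    have h := he.isProj.polyHandle (Polynomial.X ^ g : Polynomial k)
    simp only [polyHandle_X_pow] at h
    rw [Category.assoc, ← reassoc_of% h, he.counit]
  constructor
  · intro g
    rw [ExtFrobData.surface, ← he.one, key]
    exact hA.surface g
  · intro g
    rw [ExtFrobData.surfaceOne, ← he.theta, key]
    exact hA.surfaceOne g
  · intro g
    have := key ((λ_ (𝟙_ C)).inv ≫ (A.theta ⊗ₘ A.theta) ≫ A.mul) g
    simp only [Category.assoc, reassoc_of% he.mul, tensorHom_comp_tensorHom_assoc, he.theta] at this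
    exact this.trans (hA.surfaceTwo g)
  · rw [← cancel_epi e.hom, ← he.isProj.polyHandle, hA.handle, Limits.zero_comp, Limits.comp_zero]

variable {D : Type u'} [Category.{v'} D] [MonoidalCategory D] [Preadditive D] [Linear k D]
  (F : C ⥤ D) [F.Monoidal] [F.Additive] [F.Linear k]

/-- The generators of the evaluation ideal are differences `f - r • 𝟙`, while the relations in a
target category compare an endomorphism of its own unit object with a scalar. This translates
between the two, both to factor functors through the quotient and to evaluate the circle inside it.
-/
theorem map_sub_smul_eq_zero_iff {f : 𝟙_ C ⟶ 𝟙_ C} {r : k} :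
    F.map (f - r • 𝟙 _) = 0 ↔ ε F ≫ F.map f ≫ η F = r • 𝟙 _ := by
  rw [F.map_sub, F.map_smul, F.map_id, sub_eq_zero]
  constructor
  · intro h
    rw [h, Linear.smul_comp, Linear.comp_smul, Category.id_comp, ε_η]
  · intro h
    have h' := congrArg (fun t => η F ≫ t ≫ ε F) h
    simpa only [Category.assoc, η_ε_assoc, η_ε, Category.comp_id, Linear.smul_comp,
      Linear.comp_smul, Category.id_comp] using h'

end Closed

variable (T : SkeinTriple k)

/-- The circle in the linearized category of cobordisms. -/
abbrev circleL (k : Type w) [Field k] : ExtFrobData (Lin k UCob) :=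
  UCob.circle.map (Lin.embedding k UCob)

/-- The circle in the skein category. -/
abbrev circleS : ExtFrobData T.SUCob :=
  T.circleV.map (TensorIdeal.QuotCat.functor T.handleIdeal)

theorem map_evalRel_eq_zero {E : Type u} [Category.{v} E] [MonoidalCategory E] [Preadditive E]
    [Linear k E] (F : Lin k UCob ⥤ E) [F.Monoidal] [F.Additive] [F.Linear k]
    (h : T.Evaluates ((circleL k).map F)) (X Y : Lin k UCob) (f : X ⟶ Y) (hf : T.EvalRel X Y f) :
    F.map f = 0 := by
  cases hf with
  | zero g =>
    exact (map_sub_smul_eq_zero_iff F).2 (((circleL k).map_surface (k := k) F g).symm.trans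
      (h.surface g))
  | one g =>
    exact (map_sub_smul_eq_zero_iff F).2 (((circleL k).map_surfaceOne (k := k) F g).symm.trans
      (h.surfaceOne g))
  | two g =>
    exact (map_sub_smul_eq_zero_iff F).2 (((circleL k).map_surfaceTwo (k := k) F g).symm.trans
      (h.surfaceTwo g))

theorem evaluates_circleS : T.Evaluates T.circleS := by
  have key : ∀ {f : 𝟙_ (Lin k UCob) ⟶ 𝟙_ _} {r : k}, T.EvalRel _ _ (f - r • 𝟙 _) →
      ε (TensorIdeal.QuotCat.functor T.evalIdeal) ≫
        (TensorIdeal.QuotCat.functor T.evalIdeal).map f ≫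
          η (TensorIdeal.QuotCat.functor T.evalIdeal) = r • 𝟙 _ := fun h =>
    (map_sub_smul_eq_zero_iff _).1 (TensorIdeal.QuotCat.mk_eq_zero (TensorIdeal.mem_span h))
  constructor
  · intro g
    exact (T.circleV.map_surface (k := k) _ g).trans (Evaluates.map_closed _
      (((circleL k).map_surface (k := k) _ g).trans (key (.zero g))))
  · intro g
    exact (T.circleV.map_surfaceOne (k := k) _ g).trans (Evaluates.map_closed _
      (((circleL k).map_surfaceOne (k := k) _ g).trans (key (.one g))))
  · intro g
    exact (T.circleV.map_surfaceTwo (k := k) _ g).trans (Evaluates.map_closed _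
      (((circleL k).map_surfaceTwo (k := k) _ g).trans (key (.two g))))
  · rw [polyHandle_map]
    exact TensorIdeal.QuotCat.mk_eq_zero (TensorIdeal.mem_span .handle)

theorem evaluates_circle : T.Evaluates T.circle := T.evaluates_circleS.map _

theorem isExtFrob_circle : T.circle.IsExtFrob :=
  (((UCob.isExtFrob_circle.map _).map _).map _).map _

/-- The universal property of the pseudo-abelian envelope of the skein category. -/
theorem exists_functor {E : Type u} [Category.{w} E] [MonoidalCategory E] [SymmetricCategory E]
    [Preadditive E] [MonoidalPreadditive E] [Linear k E] [MonoidalLinear k E]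
    [Limits.HasFiniteBiproducts E] [IsIdempotentComplete E] {A : ExtFrobData E} (hA : A.IsExtFrob)
    (hT : T.Evaluates A) : ∃ (F : T.PsUCob ⥤ E) (_ : F.Braided), F.Additive ∧ F.Linear k ∧
      Isomorphic (T.circle.map F) A := by
  obtain ⟨F₀, _, h₀⟩ := hA.exists_functor
  -- The functor on cobordisms is extended to the linearization, to the two successive quotients and
  -- to the envelope. At each stage the circle goes to an algebra isomorphic to `A`, and through
  -- this isomorphism the relations of `A` make the next ideal vanish.
  let F₁ : Lin k UCob ⥤ E := Lin.lift F₀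
  have h₁ : Isomorphic ((circleL k).map F₁) A := by
    have h : (Lin.embedding k UCob ⋙ F₁).MonIso F₀ := ⟨Lin.liftIso F₀, inferInstance⟩
    have := h.isomorphic UCob.circle
    rw [map_comp] at this
    exact this.trans h₀
  have hF₁ : ∀ {X Y : Lin k UCob} {f : X ⟶ Y}, f ∈ T.evalIdeal.carrier X Y → F₁.map f = 0 :=
    fun hf => TensorIdeal.map_eq_zero_of_mem_span F₁
      (T.map_evalRel_eq_zero F₁ (hT.of_isomorphic h₁.symm)) hf
  let F₂ : T.VUCob ⥤ E := TensorIdeal.QuotCat.lift F₁ hF₁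
  have h₂ : Isomorphic (T.circleV.map F₂) A := by
    have h : (TensorIdeal.QuotCat.functor T.evalIdeal ⋙ F₂).MonIso F₁ :=
      ⟨TensorIdeal.QuotCat.liftIso F₁ hF₁, inferInstance⟩
    have := h.isomorphic (circleL k)
    rw [map_comp] at this
    exact this.trans h₁
  have hF₂ : ∀ {X Y : T.VUCob} {f : X ⟶ Y}, f ∈ T.handleIdeal.carrier X Y → F₂.map f = 0 := by
    intro X Y f hf
    refine TensorIdeal.map_eq_zero_of_mem_span F₂ ?_ hf
    rintro _ _ _ ⟨⟩
    exact (polyHandle_map F₂ T.handlePoly).symm.trans (hT.of_isomorphic h₂.symm).handle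
  let F₃ : T.SUCob ⥤ E := TensorIdeal.QuotCat.lift F₂ hF₂
  have h₃ : Isomorphic (T.circleS.map F₃) A := by
    have h : (TensorIdeal.QuotCat.functor T.handleIdeal ⋙ F₃).MonIso F₂ :=
      ⟨TensorIdeal.QuotCat.liftIso F₂ hF₂, inferInstance⟩
    have := h.isomorphic T.circleV
    rw [map_comp] at this
    exact this.trans h₂
  obtain ⟨F, hF, hF', hF'', h⟩ := PsAb.exists_extension (k := k) F₃
  refine ⟨F, hF, hF', hF'', ?_⟩
  have := h.isomorphic T.circleS
  rw [map_comp] at this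
  exact this.trans h₃

/-- Linear symmetric monoidal functors on the pseudo-abelian envelope of the skein category are
determined by the image of the circle. -/
theorem nonempty_iso_of_isomorphic {E : Type u} [Category.{v} E] [MonoidalCategory E]
    [BraidedCategory E] [Preadditive E] [Linear k E] {F G : T.PsUCob ⥤ E} [F.Braided] [F.Additive]
    [F.Linear k] [G.Braided] [G.Additive] [G.Linear k]
    (h : Isomorphic (T.circle.map F) (T.circle.map G)) : Nonempty (F ≅ G) := by
  have hJ : ∀ H : T.PsUCob ⥤ E, ∀ [H.Monoidal],
      UCob.circle.map (Lin.embedding k UCob ⋙ TensorIdeal.QuotCat.functor T.evalIdeal ⋙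
        TensorIdeal.QuotCat.functor T.handleIdeal ⋙ PsAb.embedding T.SUCob ⋙ H) =
          T.circle.map H := fun H _ => by
    rw [map_comp, map_comp, map_comp, map_comp]; rfl
  -- Both functors are restricted to the category of cobordisms, compared there, and the isomorphism
  -- is lifted back through linearization, quotients and envelope.
  rw [← hJ, ← hJ] at h
  obtain ⟨τ⟩ := UCob.nonempty_iso_of_isomorphic h
  exact PsAb.summandDense_embedding.nonempty_iso (TensorIdeal.QuotCat.isoOfRestriction
    (TensorIdeal.QuotCat.isoOfRestriction (Lin.isoOfRestriction τ)))

end SkeinTriple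

/-! ### Functors on external tensor products. -/

namespace CategoryTheory

open scoped CategoryTheory.Prod

/-- This says that the tensor product functor is braided for the middle interchange. It relies on
symmetry: the interchange swaps the two inner factors, and this swap has to agree with the inverse
of the opposite one. -/
theorem SymmetricCategory.tensorμ_comp_braiding {C : Type u} [Category.{v} C] [MonoidalCategory C]
    [SymmetricCategory C] (X₁ X₂ Y₁ Y₂ : C) :
    tensorμ X₁ X₂ Y₁ Y₂ ≫ ((β_ X₁ Y₁).hom ⊗ₘ (β_ X₂ Y₂).hom) =
      (β_ (X₁ ⊗ X₂) (Y₁ ⊗ Y₂)).hom ≫ tensorμ Y₁ Y₂ X₁ X₂ := by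
  simp [tensorμ, SymmetricCategory.braiding_swap_eq_inv_braiding X₁ Y₂,
    MonoidalCategory.tensorHom_def]

end CategoryTheory

namespace LinProd

open Functor.LaxMonoidal Functor.OplaxMonoidal Functor.Monoidal
open scoped CategoryTheory.Prod

/-- A functor on a product of linear categories which is linear in each variable. -/
structure IsBilinear (k : Type w) [CommRing k] {C : Type u} [Category.{v} C]
    [Preadditive C] [Linear k C] {D : Type u'} [Category.{v'} D] [Preadditive D] [Linear k D]
    {E : Type*} [Category* E] [Preadditive E] [Linear k E] (H : C × D ⥤ E) : Prop where
  map_add_left {X X' : C} {Y Y' : D} (f f' : X ⟶ X') (g : Y ⟶ Y') :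
    H.map ((f + f') ×ₘ g) = H.map (f ×ₘ g) + H.map (f' ×ₘ g)
  map_smul_left {X X' : C} {Y Y' : D} (r : k) (f : X ⟶ X') (g : Y ⟶ Y') :
    H.map ((r • f) ×ₘ g) = r • H.map (f ×ₘ g)
  map_add_right {X X' : C} {Y Y' : D} (f : X ⟶ X') (g g' : Y ⟶ Y') :
    H.map (f ×ₘ (g + g')) = H.map (f ×ₘ g) + H.map (f ×ₘ g')
  map_smul_right {X X' : C} {Y Y' : D} (r : k) (f : X ⟶ X') (g : Y ⟶ Y') :
    H.map (f ×ₘ (r • g)) = r • H.map (f ×ₘ g)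

variable {k : Type w} [CommRing k] {C : Type u} [Category.{v} C] [Preadditive C] [Linear k C]
  {D : Type u'} [Category.{v'} D] [Preadditive D] [Linear k D]
  {E : Type*} [Category* E] [Preadditive E] [Linear k E]

/-- The linear functor on the tensor product of two linear categories induced by a bilinear
functor. -/
def desc (H : C × D ⥤ E) (hH : IsBilinear k H) : LinProd k C D ⥤ E where
  obj X := H.obj (X.fst, X.snd)
  map {X Y} f := TensorProduct.lift (LinearMap.mk₂ k
    (fun (f : X.fst ⟶ Y.fst) (g : X.snd ⟶ Y.snd) => H.map (f ×ₘ g)) hH.map_add_left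
      hH.map_smul_left hH.map_add_right hH.map_smul_right) f
  map_id X := H.map_id (X.fst, X.snd)
  map_comp {X Y Z} f g := by
    induction f using hom_induction with
    | zero => simp only [Limits.zero_comp, map_zero]
    | add f f' hf hf' => simp only [Preadditive.add_comp, map_add, hf, hf']
    | box f₁ f₂ =>
    induction g using hom_induction with
    | zero => simp only [Limits.comp_zero, map_zero]
    | add f f' hf hf' => simp only [Preadditive.comp_add, map_add, hf, hf']
    | box g₁ g₂ => exact H.map_comp (f₁ ×ₘ f₂) (g₁ ×ₘ g₂)

variable (H : C × D ⥤ E) (hH : IsBilinear k H)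

instance : (desc H hH).Additive where
  map_add := map_add _ _ _

instance : (desc H hH).Linear k where
  map_smul _ r := map_smul _ r _

/-- Additive functors on the tensor product of linear categories are determined by their values
on external products. -/
def isoOfComponents {F G : LinProd k C D ⥤ E} [F.Additive] [G.Additive]
    (e : ∀ X, F.obj X ≅ G.obj X)
    (naturality : ∀ {X Y : LinProd k C D} (f : X.fst ⟶ Y.fst) (g : X.snd ⟶ Y.snd),
      F.map (box f g : X ⟶ Y) ≫ (e Y).hom = (e X).hom ≫ G.map (box f g)) : F ≅ G :=
  NatIso.ofComponents e fun f => by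
    induction f using hom_induction with
    | zero => simp only [F.map_zero, G.map_zero, Limits.comp_zero, Limits.zero_comp]
    | add f g hf hg =>
      simp only [F.map_add, G.map_add, Preadditive.comp_add, Preadditive.add_comp, hf, hg]
    | box f g => exact naturality f g

theorem box_congr {X Y : LinProd k C D} {f f' : X.fst ⟶ Y.fst} {g g' : X.snd ⟶ Y.snd}
    (hf : f = f') (hg : g = g') : (box f g : X ⟶ Y) = box f' g' := by rw [hf, hg]

section Monoidal

variable [MonoidalCategory C] [MonoidalPreadditive C] [MonoidalLinear k C]
  [MonoidalCategory D] [MonoidalPreadditive D] [MonoidalLinear k D] [MonoidalCategory E]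
  [MonoidalPreadditive E]

theorem box_whiskerRight {X Y : LinProd k C D} (f : X.fst ⟶ Y.fst) (g : X.snd ⟶ Y.snd)
    (Z : LinProd k C D) : (box f g : X ⟶ Y) ▷ Z =
      (box (f ▷ Z.fst) (g ▷ Z.snd) : X ⊗ Z ⟶ Y ⊗ Z) := by
  rw [← tensorHom_id, ← box_id, box_tensor]
  simp only [tensorHom_id]

theorem whiskerLeft_box {X Y : LinProd k C D} (Z : LinProd k C D) (f : X.fst ⟶ Y.fst)
    (g : X.snd ⟶ Y.snd) : Z ◁ (box f g : X ⟶ Y) =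
      (box (Z.fst ◁ f) (Z.snd ◁ g) : Z ⊗ X ⟶ Z ⊗ Y) := by
  rw [← id_tensorHom, ← box_id, box_tensor]
  simp only [id_tensorHom]

instance [H.Monoidal] : (desc H hH).Monoidal :=
  Functor.CoreMonoidal.toMonoidal
    { εIso := εIso H
      μIso := fun X Y => μIso H (X.fst, X.snd) (Y.fst, Y.snd)
      μIso_hom_natural_left := fun {X Y} f Z => by
        induction f using hom_induction with
        | zero => simp only [Functor.map_zero, MonoidalPreadditive.zero_whiskerRight,
            Limits.zero_comp, Limits.comp_zero]
        | add f g hf hg => simp only [Functor.map_add, MonoidalPreadditive.add_whiskerRight,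
            Preadditive.add_comp, Preadditive.comp_add, hf, hg]
        | box f g =>
          rw [box_whiskerRight]
          exact μ_natural_left H (f ×ₘ g) (Z.fst, Z.snd)
      μIso_hom_natural_right := fun {X Y} Z f => by
        induction f using hom_induction with
        | zero => simp only [Functor.map_zero, MonoidalPreadditive.whiskerLeft_zero,
            Limits.zero_comp, Limits.comp_zero]
        | add f g hf hg => simp only [Functor.map_add, MonoidalPreadditive.whiskerLeft_add,
            Preadditive.add_comp, Preadditive.comp_add, hf, hg]
        | box f g =>
          rw [whiskerLeft_box]
          exact μ_natural_right H (Z.fst, Z.snd) (f ×ₘ g)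
      associativity := fun X Y Z => Functor.LaxMonoidal.associativity (F := H) (X.fst, X.snd)
        (Y.fst, Y.snd) (Z.fst, Z.snd)
      left_unitality := fun X => Functor.LaxMonoidal.left_unitality (F := H) (X.fst, X.snd)
      right_unitality := fun X => Functor.LaxMonoidal.right_unitality (F := H) (X.fst, X.snd) }

/-- The inclusion of the first factor. -/
def left (k : Type w) [CommRing k] (C : Type u) [Category.{v} C] [Preadditive C] [Linear k C]
    (D : Type u') [Category.{v'} D] [Preadditive D] [Linear k D] [MonoidalCategory D] :
    C ⥤ LinProd k C D where
  obj X := ⟨X, 𝟙_ D⟩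
  map f := box f (𝟙 _)
  map_comp f g := by rw [box_comp, Category.comp_id]

/-- The inclusion of the second factor. -/
def right (k : Type w) [CommRing k] (C : Type u) [Category.{v} C] [Preadditive C] [Linear k C]
    (D : Type u') [Category.{v'} D] [Preadditive D] [Linear k D] [MonoidalCategory C] :
    D ⥤ LinProd k C D where
  obj X := ⟨𝟙_ C, X⟩
  map f := box (𝟙 _) f
  map_comp f g := by rw [box_comp, Category.comp_id]

instance : (left k C D).Additive where
  map_add := TensorProduct.add_tmul _ _ _

instance : (left k C D).Linear k where
  map_smul _ _ := TensorProduct.smul_tmul' _ _ _ |>.symm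

instance : (right k C D).Additive where
  map_add := TensorProduct.tmul_add (𝟙 (𝟙_ C)) _ _

instance : (right k C D).Linear k where
  map_smul f r := TensorProduct.tmul_smul r (𝟙 (𝟙_ C)) f

instance : (left k C D).Monoidal :=
  Functor.CoreMonoidal.toMonoidal
    { εIso := Iso.refl _
      μIso := fun X Y => boxIso (X := ⟨X ⊗ Y, 𝟙_ D ⊗ 𝟙_ D⟩) (Y := ⟨X ⊗ Y, 𝟙_ D⟩) (Iso.refl _)
        (λ_ (𝟙_ D))
      μIso_hom_natural_left := fun {X Y} f Z =>
        box_congr (X := ⟨X ⊗ Z, 𝟙_ D ⊗ 𝟙_ D⟩) (Y := ⟨Y ⊗ Z, 𝟙_ D⟩)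
          (show (f ⊗ₘ 𝟙 Z) ≫ 𝟙 (Y ⊗ Z) = 𝟙 (X ⊗ Z) ≫ f ▷ Z by simp)
          (show (𝟙 (𝟙_ D) ⊗ₘ 𝟙 (𝟙_ D)) ≫ (λ_ (𝟙_ D)).hom = (λ_ (𝟙_ D)).hom ≫ 𝟙 _ by simp)
      μIso_hom_natural_right := fun {X Y} Z f =>
        box_congr (X := ⟨Z ⊗ X, 𝟙_ D ⊗ 𝟙_ D⟩) (Y := ⟨Z ⊗ Y, 𝟙_ D⟩)
          (show (𝟙 Z ⊗ₘ f) ≫ 𝟙 (Z ⊗ Y) = 𝟙 (Z ⊗ X) ≫ Z ◁ f by simp)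
          (show (𝟙 (𝟙_ D) ⊗ₘ 𝟙 (𝟙_ D)) ≫ (λ_ (𝟙_ D)).hom = (λ_ (𝟙_ D)).hom ≫ 𝟙 _ by simp)
      associativity := fun X Y Z =>
        box_congr (X := ⟨(X ⊗ Y) ⊗ Z, (𝟙_ D ⊗ 𝟙_ D) ⊗ 𝟙_ D⟩) (Y := ⟨X ⊗ Y ⊗ Z, 𝟙_ D⟩)
          (show (𝟙 (X ⊗ Y) ⊗ₘ 𝟙 Z) ≫ 𝟙 ((X ⊗ Y) ⊗ Z) ≫ (α_ X Y Z).hom =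
            (α_ X Y Z).hom ≫ (𝟙 X ⊗ₘ 𝟙 (Y ⊗ Z)) ≫ 𝟙 (X ⊗ Y ⊗ Z) by simp)
          (show ((λ_ (𝟙_ D)).hom ⊗ₘ 𝟙 (𝟙_ D)) ≫ (λ_ (𝟙_ D)).hom ≫ 𝟙 _ =
            (α_ _ _ _).hom ≫ (𝟙 (𝟙_ D) ⊗ₘ (λ_ (𝟙_ D)).hom) ≫ (λ_ (𝟙_ D)).hom by monoidal)
      left_unitality := fun X =>
        box_congr (X := ⟨𝟙_ C ⊗ X, 𝟙_ D ⊗ 𝟙_ D⟩) (Y := ⟨X, 𝟙_ D⟩)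
          (show (λ_ X).hom = (𝟙 (𝟙_ C) ⊗ₘ 𝟙 X) ≫ 𝟙 (𝟙_ C ⊗ X) ≫ (λ_ X).hom by simp)
          (show (λ_ (𝟙_ D)).hom = (𝟙 (𝟙_ D) ⊗ₘ 𝟙 (𝟙_ D)) ≫ (λ_ (𝟙_ D)).hom ≫ 𝟙 _ by simp)
      right_unitality := fun X =>
        box_congr (X := ⟨X ⊗ 𝟙_ C, 𝟙_ D ⊗ 𝟙_ D⟩) (Y := ⟨X, 𝟙_ D⟩)
          (show (ρ_ X).hom = (𝟙 X ⊗ₘ 𝟙 (𝟙_ C)) ≫ 𝟙 (X ⊗ 𝟙_ C) ≫ (ρ_ X).hom by simp)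
          (show (ρ_ (𝟙_ D)).hom = (𝟙 (𝟙_ D) ⊗ₘ 𝟙 (𝟙_ D)) ≫ (λ_ (𝟙_ D)).hom ≫ 𝟙 _ by
            simp [unitors_equal]) }

instance : (right k C D).Monoidal :=
  Functor.CoreMonoidal.toMonoidal
    { εIso := Iso.refl _
      μIso := fun X Y => boxIso (X := ⟨𝟙_ C ⊗ 𝟙_ C, X ⊗ Y⟩) (Y := ⟨𝟙_ C, X ⊗ Y⟩) (λ_ (𝟙_ C))
        (Iso.refl _)
      μIso_hom_natural_left := fun {X Y} f Z =>
        box_congr (X := ⟨𝟙_ C ⊗ 𝟙_ C, X ⊗ Z⟩) (Y := ⟨𝟙_ C, Y ⊗ Z⟩)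
          (show (𝟙 (𝟙_ C) ⊗ₘ 𝟙 (𝟙_ C)) ≫ (λ_ (𝟙_ C)).hom = (λ_ (𝟙_ C)).hom ≫ 𝟙 _ by simp)
          (show (f ⊗ₘ 𝟙 Z) ≫ 𝟙 (Y ⊗ Z) = 𝟙 (X ⊗ Z) ≫ f ▷ Z by simp)
      μIso_hom_natural_right := fun {X Y} Z f =>
        box_congr (X := ⟨𝟙_ C ⊗ 𝟙_ C, Z ⊗ X⟩) (Y := ⟨𝟙_ C, Z ⊗ Y⟩)
          (show (𝟙 (𝟙_ C) ⊗ₘ 𝟙 (𝟙_ C)) ≫ (λ_ (𝟙_ C)).hom = (λ_ (𝟙_ C)).hom ≫ 𝟙 _ by simp)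
          (show (𝟙 Z ⊗ₘ f) ≫ 𝟙 (Z ⊗ Y) = 𝟙 (Z ⊗ X) ≫ Z ◁ f by simp)
      associativity := fun X Y Z =>
        box_congr (X := ⟨(𝟙_ C ⊗ 𝟙_ C) ⊗ 𝟙_ C, (X ⊗ Y) ⊗ Z⟩) (Y := ⟨𝟙_ C, X ⊗ Y ⊗ Z⟩)
          (show ((λ_ (𝟙_ C)).hom ⊗ₘ 𝟙 (𝟙_ C)) ≫ (λ_ (𝟙_ C)).hom ≫ 𝟙 _ =
            (α_ _ _ _).hom ≫ (𝟙 (𝟙_ C) ⊗ₘ (λ_ (𝟙_ C)).hom) ≫ (λ_ (𝟙_ C)).hom by monoidal)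
          (show (𝟙 (X ⊗ Y) ⊗ₘ 𝟙 Z) ≫ 𝟙 ((X ⊗ Y) ⊗ Z) ≫ (α_ X Y Z).hom =
            (α_ X Y Z).hom ≫ (𝟙 X ⊗ₘ 𝟙 (Y ⊗ Z)) ≫ 𝟙 (X ⊗ Y ⊗ Z) by simp)
      left_unitality := fun X =>
        box_congr (X := ⟨𝟙_ C ⊗ 𝟙_ C, 𝟙_ D ⊗ X⟩) (Y := ⟨𝟙_ C, X⟩)
          (show (λ_ (𝟙_ C)).hom = (𝟙 (𝟙_ C) ⊗ₘ 𝟙 (𝟙_ C)) ≫ (λ_ (𝟙_ C)).hom ≫ 𝟙 _ by simp)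
          (show (λ_ X).hom = (𝟙 (𝟙_ D) ⊗ₘ 𝟙 X) ≫ 𝟙 (𝟙_ D ⊗ X) ≫ (λ_ X).hom by simp)
      right_unitality := fun X =>
        box_congr (X := ⟨𝟙_ C ⊗ 𝟙_ C, X ⊗ 𝟙_ D⟩) (Y := ⟨𝟙_ C, X⟩)
          (show (ρ_ (𝟙_ C)).hom = (𝟙 (𝟙_ C) ⊗ₘ 𝟙 (𝟙_ C)) ≫ (λ_ (𝟙_ C)).hom ≫ 𝟙 _ by
            simp [unitors_equal])
          (show (ρ_ X).hom = (𝟙 X ⊗ₘ 𝟙 (𝟙_ D)) ≫ 𝟙 (X ⊗ 𝟙_ D) ≫ (ρ_ X).hom by simp) }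

end Monoidal

end LinProd

namespace CategoryTheory

open Functor.LaxMonoidal

section

variable {E : Type u} [Category.{v} E] [MonoidalCategory E] [BraidedCategory E]

/-- The map `e` is a unit-like point that multiplies with itself to itself, so after pulling it out
the interchange permutes only a unit object and is a coherence map. With `e = ε G` this is the
multiplicativity of the comparison `F X ≅ F X ⊗ G 𝟙`. -/
theorem tensorμ_right_unit {A B M N : E} {m : A ⊗ B ⟶ M} {e : 𝟙_ E ⟶ N} {n : N ⊗ N ⟶ N}
    (h : (e ⊗ₘ e) ≫ n = (λ_ _).hom ≫ e) :
    (((ρ_ A).inv ≫ A ◁ e) ⊗ₘ ((ρ_ B).inv ≫ B ◁ e)) ≫ tensorμ A N B N ≫ (m ⊗ₘ n) =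
      m ≫ (ρ_ M).inv ≫ M ◁ e := by
  have h₁ : ((ρ_ A).inv ⊗ₘ (ρ_ B).inv) ≫ tensorμ A (𝟙_ E) B (𝟙_ E) =
      (ρ_ (A ⊗ B)).inv ≫ (A ⊗ B) ◁ (λ_ (𝟙_ E)).inv := by
    rw [← cancel_mono ((A ⊗ B) ◁ (λ_ (𝟙_ E)).hom ≫ (ρ_ (A ⊗ B)).hom), Category.assoc,
      ← rightUnitor_monoidal, tensorHom_comp_tensorHom]
    simp
  rw [← tensorHom_comp_tensorHom, ← id_tensorHom, ← id_tensorHom, Category.assoc,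
    tensorμ_natural_assoc, reassoc_of% h₁, tensorHom_comp_tensorHom, h, id_tensorHom_id,
    Category.id_comp, ← id_tensorHom, tensorHom_comp_tensorHom, Iso.inv_hom_id_assoc,
    Category.id_comp, MonoidalCategory.tensorHom_def, rightUnitor_inv_naturality_assoc]

theorem tensorμ_left_unit {A B M N : E} {m : A ⊗ B ⟶ M} {e : 𝟙_ E ⟶ N} {n : N ⊗ N ⟶ N}
    (h : (e ⊗ₘ e) ≫ n = (λ_ _).hom ≫ e) :
    (((λ_ A).inv ≫ e ▷ A) ⊗ₘ ((λ_ B).inv ≫ e ▷ B)) ≫ tensorμ N A N B ≫ (n ⊗ₘ m) =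
      m ≫ (λ_ M).inv ≫ e ▷ M := by
  have h₁ : ((λ_ A).inv ⊗ₘ (λ_ B).inv) ≫ tensorμ (𝟙_ E) A (𝟙_ E) B =
      (λ_ (A ⊗ B)).inv ≫ (λ_ (𝟙_ E)).inv ▷ (A ⊗ B) := by
    rw [← cancel_mono ((λ_ (𝟙_ E)).hom ▷ (A ⊗ B) ≫ (λ_ (A ⊗ B)).hom), Category.assoc,
      ← leftUnitor_monoidal, tensorHom_comp_tensorHom]
    simp only [Iso.inv_hom_id, id_tensorHom_id, Category.assoc, inv_hom_whiskerRight_assoc]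
  rw [← tensorHom_comp_tensorHom, ← tensorHom_id, ← tensorHom_id, Category.assoc,
    tensorμ_natural_assoc, reassoc_of% h₁, tensorHom_comp_tensorHom, h, id_tensorHom_id,
    Category.id_comp, ← tensorHom_id, tensorHom_comp_tensorHom, Iso.inv_hom_id_assoc,
    Category.id_comp, MonoidalCategory.tensorHom_def', leftUnitor_inv_naturality_assoc]

end

/-- Supplies the hypothesis of the two preceding lemmas for `e = ε F`; it is the left unitality of
`F`. -/
theorem Functor.tensorHom_ε_comp_μ {C : Type u} [Category.{v} C] [MonoidalCategory C]
    {D : Type u'} [Category.{v'} D] [MonoidalCategory D] (F : C ⥤ D) [F.LaxMonoidal] :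
    (ε F ⊗ₘ ε F) ≫ μ F (𝟙_ C) (𝟙_ C) ≫ F.map (λ_ (𝟙_ C)).hom = (λ_ (𝟙_ D)).hom ≫ ε F := by
  rw [MonoidalCategory.tensorHom_def', Category.assoc,
    ← Functor.LaxMonoidal.left_unitality (F := F), leftUnitor_naturality]

end CategoryTheory

/-! ### The two factors of an external tensor product, and the pairing of two functors. -/

namespace LinProd

open Functor.LaxMonoidal Functor.OplaxMonoidal Functor.Monoidal
open scoped CategoryTheory.Prod

variable {k : Type w} [CommRing k] {C : Type u} [Category.{v} C] [Preadditive C] [Linear k C]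
  {D : Type u'} [Category.{v'} D] [Preadditive D] [Linear k D]

section Monoidal

variable [MonoidalCategory C] [MonoidalPreadditive C] [MonoidalLinear k C]
  [MonoidalCategory D] [MonoidalPreadditive D] [MonoidalLinear k D]

/-- The componentwise structure on `A ⊠ 𝟙` agrees with the image of `A` under the monoidal functor
`X ↦ X ⊠ 𝟙`. General facts about images under functors therefore apply to the summands of the target
algebra. -/
theorem box_unit_eq_map (A : ExtFrobData C) :
    ExtFrobData.box k A (ExtFrobData.unit D) = A.map (left k C D) := by
  refine ExtFrobData.mk_congr ?_ ?_ ?_ ?_ ?_ ?_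
  · exact box_congr (X := ⟨A.X ⊗ A.X, 𝟙_ D ⊗ 𝟙_ D⟩) (Y := ⟨A.X, 𝟙_ D⟩)
      (show A.mul = 𝟙 _ ≫ A.mul by simp) (show (λ_ (𝟙_ D)).hom = (λ_ (𝟙_ D)).hom ≫ 𝟙 _ by simp)
  · exact (Category.id_comp ((left k C D).map A.one)).symm
  · exact box_congr (X := ⟨A.X, 𝟙_ D⟩) (Y := ⟨A.X ⊗ A.X, 𝟙_ D ⊗ 𝟙_ D⟩)
      (show A.comul = A.comul ≫ 𝟙 _ by simp)
      (show (λ_ (𝟙_ D)).inv = 𝟙 _ ≫ (λ_ (𝟙_ D)).inv by simp)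
  · exact (Category.comp_id ((left k C D).map A.counit)).symm
  · rfl
  · exact (Category.id_comp ((left k C D).map A.theta)).symm

theorem unit_box_eq_map (B : ExtFrobData D) :
    ExtFrobData.box k (ExtFrobData.unit C) B = B.map (right k C D) := by
  refine ExtFrobData.mk_congr ?_ ?_ ?_ ?_ ?_ ?_
  · exact box_congr (X := ⟨𝟙_ C ⊗ 𝟙_ C, B.X ⊗ B.X⟩) (Y := ⟨𝟙_ C, B.X⟩)
      (show (λ_ (𝟙_ C)).hom = (λ_ (𝟙_ C)).hom ≫ 𝟙 _ by simp) (show B.mul = 𝟙 _ ≫ B.mul by simp)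
  · exact (Category.id_comp ((right k C D).map B.one)).symm
  · exact box_congr (X := ⟨𝟙_ C, B.X⟩) (Y := ⟨𝟙_ C ⊗ 𝟙_ C, B.X ⊗ B.X⟩)
      (show (λ_ (𝟙_ C)).inv = 𝟙 _ ≫ (λ_ (𝟙_ C)).inv by simp)
      (show B.comul = B.comul ≫ 𝟙 _ by simp)
  · exact (Category.comp_id ((right k C D).map B.counit)).symm
  · rfl
  · exact (Category.id_comp ((right k C D).map B.theta)).symm

instance [SymmetricCategory C] [SymmetricCategory D] : (left k C D).Braided where
  braided X Y := box_congr (X := ⟨X ⊗ Y, 𝟙_ D ⊗ 𝟙_ D⟩) (Y := ⟨Y ⊗ X, 𝟙_ D⟩)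
    (show 𝟙 _ ≫ (β_ X Y).hom = (β_ X Y).hom ≫ 𝟙 _ by simp)
    (show (λ_ (𝟙_ D)).hom ≫ 𝟙 _ = (β_ _ _).hom ≫ (λ_ (𝟙_ D)).hom by
      rw [braiding_leftUnitor, Category.comp_id, unitors_equal])

instance [SymmetricCategory C] [SymmetricCategory D] : (right k C D).Braided where
  braided X Y := box_congr (X := ⟨𝟙_ C ⊗ 𝟙_ C, X ⊗ Y⟩) (Y := ⟨𝟙_ C, Y ⊗ X⟩)
    (show (λ_ (𝟙_ C)).hom ≫ 𝟙 _ = (β_ _ _).hom ≫ (λ_ (𝟙_ C)).hom by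
      rw [braiding_leftUnitor, Category.comp_id, unitors_equal])
    (show 𝟙 _ ≫ (β_ X Y).hom = (β_ X Y).hom ≫ 𝟙 _ by simp)

/-- The tensor product of the two inclusions. -/
def leftTensorRight (X : LinProd k C D) :
    (left k C D).obj X.fst ⊗ (right k C D).obj X.snd ≅ X :=
  boxIso (X := ⟨X.fst ⊗ 𝟙_ C, 𝟙_ D ⊗ X.snd⟩) (ρ_ X.fst) (λ_ X.snd)

theorem leftTensorRight_naturality {X Y : LinProd k C D} (f : X.fst ⟶ Y.fst)
    (g : X.snd ⟶ Y.snd) : ((left k C D).map f ⊗ₘ (right k C D).map g) ≫ (leftTensorRight Y).hom =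
      (leftTensorRight X).hom ≫ box f g :=
  box_congr (X := ⟨X.fst ⊗ 𝟙_ C, 𝟙_ D ⊗ X.snd⟩)
    (show (f ⊗ₘ 𝟙 _) ≫ (ρ_ _).hom = (ρ_ _).hom ≫ f by simp)
    (show (𝟙 _ ⊗ₘ g) ≫ (λ_ _).hom = (λ_ _).hom ≫ g by simp)

end Monoidal

section Pairing

variable {E : Type*} [Category* E] [Preadditive E] [Linear k E] [MonoidalCategory E]
  [MonoidalPreadditive E] [MonoidalLinear k E] (F : C ⥤ E) [F.Additive] [F.Linear k]
  (G : D ⥤ E) [G.Additive] [G.Linear k]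

theorem isBilinear_prod_tensor : IsBilinear k (F.prod G ⋙ tensor E) where
  map_add_left f f' g := by
    change F.map (f + f') ⊗ₘ G.map g = _
    rw [F.map_add, MonoidalPreadditive.add_tensor]
    rfl
  map_smul_left r f g := by
    change F.map (r • f) ⊗ₘ G.map g = _
    rw [F.map_smul]
    exact (tensorBilin (k := k) _ _ _ _).map_smul₂ r (F.map f) (G.map g)
  map_add_right f g g' := by
    change F.map f ⊗ₘ G.map (g + g') = _
    rw [G.map_add, MonoidalPreadditive.tensor_add]
    rfl
  map_smul_right r f g := by
    change F.map f ⊗ₘ G.map (r • g) = _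
    rw [G.map_smul]
    exact (tensorBilin (k := k) _ _ _ _ (F.map f)).map_smul r (G.map g)

variable (k)

/-- The functor `(X, Y) ↦ F X ⊗ G Y`. -/
abbrev pairing : LinProd k C D ⥤ E := desc (F.prod G ⋙ tensor E) (isBilinear_prod_tensor F G)

variable [SymmetricCategory E] [MonoidalCategory C] [MonoidalPreadditive C] [MonoidalLinear k C]
  [MonoidalCategory D] [MonoidalPreadditive D] [MonoidalLinear k D]

instance [SymmetricCategory C] [SymmetricCategory D] [F.Braided] [G.Braided] :
    (pairing k F G).Braided where
  braided X Y := by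
    change (tensorμ (F.obj X.fst) (G.obj X.snd) (F.obj Y.fst) (G.obj Y.snd) ≫
      (μ F X.fst Y.fst ⊗ₘ μ G X.snd Y.snd)) ≫
        (F.map (β_ X.fst Y.fst).hom ⊗ₘ G.map (β_ X.snd Y.snd).hom) =
      (β_ (F.obj X.fst ⊗ G.obj X.snd) (F.obj Y.fst ⊗ G.obj Y.snd)).hom ≫
        tensorμ (F.obj Y.fst) (G.obj Y.snd) (F.obj X.fst) (G.obj X.snd) ≫
          (μ F Y.fst X.fst ⊗ₘ μ G Y.snd X.snd)
    rw [Category.assoc, tensorHom_comp_tensorHom, Functor.LaxBraided.braided,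
      Functor.LaxBraided.braided, ← tensorHom_comp_tensorHom,
      reassoc_of% SymmetricCategory.tensorμ_comp_braiding]

/-- The pairing restricts to `F` on the first factor. -/
theorem monIso_left [F.Monoidal] [G.Monoidal] : F.MonIso (left k C D ⋙ pairing k F G) := by
  refine ⟨NatIso.ofComponents (fun X => (ρ_ (F.obj X)).symm ≪≫ whiskerLeftIso _ (εIso G))
    (fun {X Y} f => ?_), ⟨?_, fun X Y => ?_⟩⟩
  · change F.map f ≫ (ρ_ (F.obj Y)).inv ≫ F.obj Y ◁ ε G =
      ((ρ_ (F.obj X)).inv ≫ F.obj X ◁ ε G) ≫ (F.map f ⊗ₘ G.map (𝟙 _))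
    simp [MonoidalCategory.tensorHom_def, whisker_exchange]
  · change ε F ≫ (ρ_ _).inv ≫ F.obj (𝟙_ C) ◁ ε G =
      ((λ_ (𝟙_ E)).inv ≫ (ε F ⊗ₘ ε G)) ≫ (F.map (𝟙 _) ⊗ₘ G.map (𝟙 _))
    simp [MonoidalCategory.tensorHom_def, unitors_inv_equal]
  · change μ F X Y ≫ (ρ_ (F.obj (X ⊗ Y))).inv ≫ F.obj (X ⊗ Y) ◁ ε G =
      (((ρ_ (F.obj X)).inv ≫ F.obj X ◁ ε G) ⊗ₘ ((ρ_ (F.obj Y)).inv ≫ F.obj Y ◁ ε G)) ≫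
        (tensorμ (F.obj X) (G.obj (𝟙_ D)) (F.obj Y) (G.obj (𝟙_ D)) ≫
          (μ F X Y ⊗ₘ μ G (𝟙_ D) (𝟙_ D))) ≫ (F.map (𝟙 _) ⊗ₘ G.map (λ_ (𝟙_ D)).hom)
    simp only [CategoryTheory.Functor.map_id, Category.assoc, tensorHom_comp_tensorHom,
      Category.comp_id]
    exact (tensorμ_right_unit G.tensorHom_ε_comp_μ).symm

theorem monIso_right [F.Monoidal] [G.Monoidal] : G.MonIso (right k C D ⋙ pairing k F G) := by
  refine ⟨NatIso.ofComponents (fun X => (λ_ (G.obj X)).symm ≪≫ whiskerRightIso (εIso F) _)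
    (fun {X Y} f => ?_), ⟨?_, fun X Y => ?_⟩⟩
  · change G.map f ≫ (λ_ (G.obj Y)).inv ≫ ε F ▷ G.obj Y =
      ((λ_ (G.obj X)).inv ≫ ε F ▷ G.obj X) ≫ (F.map (𝟙 _) ⊗ₘ G.map f)
    simp only [CategoryTheory.Functor.map_id, id_tensorHom, Category.assoc, ← whisker_exchange,
      leftUnitor_inv_naturality_assoc]
  · change ε G ≫ (λ_ _).inv ≫ ε F ▷ G.obj (𝟙_ D) =
      ((λ_ (𝟙_ E)).inv ≫ (ε F ⊗ₘ ε G)) ≫ (F.map (𝟙 _) ⊗ₘ G.map (𝟙 _))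
    rw [CategoryTheory.Functor.map_id, CategoryTheory.Functor.map_id, id_tensorHom_id,
      Category.comp_id, MonoidalCategory.tensorHom_def', leftUnitor_inv_naturality_assoc]
  · change μ G X Y ≫ (λ_ (G.obj (X ⊗ Y))).inv ≫ ε F ▷ G.obj (X ⊗ Y) =
      (((λ_ (G.obj X)).inv ≫ ε F ▷ G.obj X) ⊗ₘ ((λ_ (G.obj Y)).inv ≫ ε F ▷ G.obj Y)) ≫
        (tensorμ (F.obj (𝟙_ C)) (G.obj X) (F.obj (𝟙_ C)) (G.obj Y) ≫
          (μ F (𝟙_ C) (𝟙_ C) ⊗ₘ μ G X Y)) ≫ (F.map (λ_ (𝟙_ C)).hom ⊗ₘ G.map (𝟙 _))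
    simp only [CategoryTheory.Functor.map_id, Category.assoc, tensorHom_comp_tensorHom,
      Category.comp_id]
    exact (tensorμ_left_unit F.tensorHom_ε_comp_μ).symm

end Pairing

end LinProd

namespace LinProd

open Functor.LaxMonoidal Functor.OplaxMonoidal Functor.Monoidal

variable {k : Type w} [CommRing k] {C : Type u} [Category.{v} C] [Preadditive C] [Linear k C]
  [MonoidalCategory C] [MonoidalPreadditive C] [MonoidalLinear k C]
  {D : Type u'} [Category.{v'} D] [Preadditive D] [Linear k D]
  [MonoidalCategory D] [MonoidalPreadditive D] [MonoidalLinear k D]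

/-- A monoidal functor on the tensor product of linear categories is determined by its
restrictions to the two factors. -/
def pairingCompIso {E : Type*} [Category* E] [Preadditive E] [Linear k E] [MonoidalCategory E]
    [MonoidalPreadditive E] [MonoidalLinear k E] {P : Type*} [Category* P] [Preadditive P]
    [Linear k P] [MonoidalCategory P] (G₁ : C ⥤ E) [G₁.Additive] [G₁.Linear k] (G₂ : D ⥤ E)
    [G₂.Additive] [G₂.Linear k] (F : E ⥤ P) [F.Monoidal] [F.Additive] (I : LinProd k C D ⥤ P)
    [I.Monoidal] [I.Additive] (τ₁ : G₁ ⋙ F ≅ left k C D ⋙ I) (τ₂ : G₂ ⋙ F ≅ right k C D ⋙ I) :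
    pairing k G₁ G₂ ⋙ F ≅ I :=
  -- Every object `X ⊠ Y` is the tensor product of `X ⊠ 𝟙` and `𝟙 ⊠ Y`, and both `F` and `I` are
  -- monoidal, so the component is `τ₁ ⊗ τ₂` between coherence maps. Only naturality of `τ₁` and
  -- `τ₂` enters.
  isoOfComponents (fun X => (μIso F (G₁.obj X.fst) (G₂.obj X.snd)).symm ≪≫
    (τ₁.app X.fst ⊗ᵢ τ₂.app X.snd) ≪≫ μIso I _ _ ≪≫ I.mapIso (leftTensorRight X))
    (fun {X Y} f g => by
      have h₁ := τ₁.hom.naturality f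
      have h₂ := τ₂.hom.naturality g
      dsimp only [Functor.comp_map] at h₁ h₂
      change F.map (G₁.map f ⊗ₘ G₂.map g) ≫ δ F _ _ ≫
          (τ₁.hom.app Y.fst ⊗ₘ τ₂.hom.app Y.snd) ≫ μ I _ _ ≫ I.map (leftTensorRight Y).hom =
        (δ F _ _ ≫ (τ₁.hom.app X.fst ⊗ₘ τ₂.hom.app X.snd) ≫ μ I _ _ ≫
          I.map (leftTensorRight X).hom) ≫ I.map (box f g)
      rw [← δ_natural_assoc, tensorHom_comp_tensorHom_assoc, h₁, h₂,
        ← tensorHom_comp_tensorHom_assoc, μ_natural_assoc, ← I.map_comp,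
        leftTensorRight_naturality, I.map_comp]
      simp only [Category.assoc])

end LinProd

/-! ### Splitting the circle, and the equivalence. -/

namespace ExtFrobData

theorem exists_isDirectSum_extSum (k : Type w) [CommRing k] {C : Type u} [Category.{v} C]
    [Preadditive C] [Linear k C] [MonoidalCategory C] [MonoidalPreadditive C] [MonoidalLinear k C]
    {D : Type u'} [Category.{v'} D] [Preadditive D] [Linear k D] [MonoidalCategory D]
    [MonoidalPreadditive D] [MonoidalLinear k D] (A : ExtFrobData C) (B : ExtFrobData D) :
    ∃ i p j q, IsDirectSum (A := (A.map (LinProd.left k C D)).map (PsAb.embedding _))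
      (B := (B.map (LinProd.right k C D)).map (PsAb.embedding _)) (D := extSum k A B) i p j q := by
  rw [← LinProd.box_unit_eq_map, ← LinProd.unit_box_eq_map]
  exact ⟨_, _, _, _, isDirectSum_oplus _ _⟩

end ExtFrobData

namespace SkeinTriple

open ExtFrobData Polynomial

variable {k : Type w} [Field k] {T T' T'' : SkeinTriple k}

section Splitting

variable {C : Type u} [Category.{v} C] [MonoidalCategory C] [Preadditive C] [Linear k C]

/-- An algebra subject to the sum of two coprime triples of evaluation relations splits. -/
theorem Evaluates.exists_isDirectSum [BraidedCategory C] [MonoidalPreadditive C]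
    [MonoidalLinear k C] [IsIdempotentComplete C] (hα : T.α = T'.α + T''.α)
    (hβ : T.β = T'.β + T''.β) (hγ : T.γ = T'.γ + T''.γ)
    (hcoprime : IsCoprime T'.handlePoly T''.handlePoly)
    (hm : T.handlePoly = T'.handlePoly * T''.handlePoly) {D : ExtFrobData C} (hD : D.IsExtFrob)
    (hT : T.Evaluates D) : ∃ (A B : ExtFrobData C) (i : A.X ⟶ D.X) (p : D.X ⟶ A.X)
      (j : B.X ⟶ D.X) (q : D.X ⟶ B.X), IsDirectSum i p j q ∧ A.IsExtFrob ∧ B.IsExtFrob ∧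
        T'.Evaluates A ∧ T''.Evaluates B := by
  -- The Bezout identity supplies the two polynomials: `b m''` is `1` modulo `m'` and `0` modulo
  -- `m''`, and `a m'` is its complement. Their product is a multiple of `m' m''`, which kills the
  -- handle.
  obtain ⟨a, b, hab⟩ := hcoprime
  have h₁ : b * T''.handlePoly = 1 + T'.handlePoly * (-a) := by linear_combination hab
  have h₂ : a * T'.handlePoly = 1 + T''.handlePoly * (-b) := by linear_combination hab
  have zero : D.polyHandle (b * T''.handlePoly * (a * T'.handlePoly)) = 0 := by
    rw [show b * T''.handlePoly * (a * T'.handlePoly) = T.handlePoly * (a * b) by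
      rw [hm]; ring, polyHandle_mul, hT.handle, Limits.zero_comp]
  have split : ∀ f g : k[X], f + g = 1 → D.polyHandle (f * g) = 0 → ∃ (Y : C) (i : Y ⟶ D.X)
      (p : D.X ⟶ Y), i ≫ p = 𝟙 Y ∧ p ≫ i = D.polyHandle f := by
    intro f g hfg h
    refine IsIdempotentComplete.idempotents_split _ _ ?_
    -- Since `f + g = 1`, the polynomial `f` differs from its square by `f g`, which acts as zero;
    -- so `f(x)` is idempotent and splits.
    have : f * f + f * g = f := by rw [← mul_add, hfg, mul_one]
    rw [← polyHandle_mul]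
    conv_rhs => rw [← this, polyHandle_add, h, add_zero]
  obtain ⟨Y, i, p, hip, hpi⟩ := split _ _ (by rw [add_comm, hab]) zero
  obtain ⟨Z, j, q, hjq, hqj⟩ := split _ _ hab (by rw [mul_comm]; exact zero)
  have hc := hD.isCentral_polyHandle (b * T''.handlePoly)
  have hc' := hD.isCentral_polyHandle (a * T'.handlePoly)
  rw [← hpi] at hc
  rw [← hqj] at hc'
  have z : p ≫ (i ≫ q) ≫ j = 0 := by
    have := zero
    rw [polyHandle_mul, ← hpi, ← hqj] at this
    simpa only [Category.assoc] using this
  have z' : q ≫ (j ≫ p) ≫ i = 0 := by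
    have := zero
    rw [mul_comm, polyHandle_mul, ← hpi, ← hqj] at this
    simpa only [Category.assoc] using this
  -- The product of the idempotents vanishes. Composing with the section `i` and the retraction `q`
  -- strips it to the mixed component.
  have hiq : i ≫ q = 0 := by
    have := congrArg (fun t => i ≫ t ≫ q) z
    simpa only [Category.assoc, reassoc_of% hip, hjq, Category.comp_id, Limits.zero_comp,
      Limits.comp_zero] using this
  have hjp : j ≫ p = 0 := by
    have := congrArg (fun t => j ≫ t ≫ p) z'
    simpa only [Category.assoc, reassoc_of% hjq, hip, Category.comp_id, Limits.zero_comp,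
      Limits.comp_zero] using this
  have total : p ≫ i + q ≫ j = 𝟙 D.X := by
    rw [hpi, hqj, ← polyHandle_add, add_comm, hab, polyHandle_one]
  exact ⟨D.retract i p, D.retract j q, i, p, j, q,
    { incl_left := IsCentral.isIncl hip hc
      proj_left := IsCentral.isProj hip hc
      incl_right := IsCentral.isIncl hjq hc'
      proj_right := IsCentral.isProj hjq hc'
      inl_fst := hip
      inr_snd := hjq
      inl_snd := hiq
      inr_fst := hjp
      total := total }, IsCentral.isExtFrob_retract hip hc hD,
    IsCentral.isExtFrob_retract hjq hc' hD,
    Evaluates.of_retract hα hβ hγ hm h₁ (mul_comm _ _) (IsCentral.isIncl hip hc)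
      (IsCentral.isProj hip hc) hip hpi hT,
    Evaluates.of_retract (hα.trans (add_comm _ _)) (hβ.trans (add_comm _ _))
      (hγ.trans (add_comm _ _)) (hm.trans (mul_comm _ _)) h₂ (mul_comm _ _)
        (IsCentral.isIncl hjq hc') (IsCentral.isProj hjq hc') hjq hqj hT⟩

/-- The first summand is cut out by a polynomial in the handle endomorphism. -/
theorem Evaluates.proj_comp_incl {f a b : k[X]} (h₁ : f = 1 + T'.handlePoly * a)
    (h₂ : f = T''.handlePoly * b) {A B D : ExtFrobData C} {i : A.X ⟶ D.X} {p : D.X ⟶ A.X}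
    {j : B.X ⟶ D.X} {q : D.X ⟶ B.X} (h : IsDirectSum i p j q) (hA : T'.Evaluates A)
    (hB : T''.Evaluates B) : p ≫ i = D.polyHandle f := by
  refine h.hom_ext ?_ ?_
  · rw [Category.assoc, h.inl_fst, h.proj_left.polyHandle, h₁, polyHandle_add, polyHandle_mul,
      hA.handle, Limits.zero_comp, add_zero, polyHandle_one]
  · rw [Category.assoc, h.inl_snd, h.proj_right.polyHandle, h₂, polyHandle_mul, hB.handle,
      Limits.zero_comp, Limits.comp_zero, Limits.comp_zero]

/-- The summand is intrinsic to the sum: its idempotent is a polynomial in the handle that depends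
only on the two handle polynomials. An isomorphism of the sums commutes with handles, so it matches
the idempotents. -/
theorem Evaluates.isomorphic_left (hcoprime : IsCoprime T'.handlePoly T''.handlePoly)
    {A B D A' B' D' : ExtFrobData C} {i : A.X ⟶ D.X} {p : D.X ⟶ A.X} {j : B.X ⟶ D.X}
    {q : D.X ⟶ B.X} {i' : A'.X ⟶ D'.X} {p' : D'.X ⟶ A'.X} {j' : B'.X ⟶ D'.X} {q' : D'.X ⟶ B'.X}
    (h : IsDirectSum i p j q) (h' : IsDirectSum i' p' j' q') (hD : Isomorphic D D')
    (hA : T'.Evaluates A) (hB : T''.Evaluates B) (hA' : T'.Evaluates A')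
    (hB' : T''.Evaluates B') : Isomorphic A A' := by
  obtain ⟨a, b, hab⟩ := hcoprime
  have h₁ : b * T''.handlePoly = 1 + T'.handlePoly * (-a) := by linear_combination hab
  obtain ⟨e, he⟩ := hD
  refine isomorphic_of_idempotent_eq (h.incl_left.comp he.isIncl) (p := e.inv ≫ p) ?_
    (he.symm.isProj.comp h.proj_left) h'.incl_left h'.inl_fst h'.proj_left ?_
  · rw [Category.assoc, e.hom_inv_id_assoc, h.inl_fst]
  · rw [proj_comp_incl h₁ (mul_comm _ _) h' hA' hB', Category.assoc, Iso.inv_comp_eq,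
      ← Category.assoc, proj_comp_incl h₁ (mul_comm _ _) h hA hB]
    exact he.isProj.polyHandle _

theorem Evaluates.isomorphic_right (hcoprime : IsCoprime T'.handlePoly T''.handlePoly)
    {A B D A' B' D' : ExtFrobData C} {i : A.X ⟶ D.X} {p : D.X ⟶ A.X} {j : B.X ⟶ D.X}
    {q : D.X ⟶ B.X} {i' : A'.X ⟶ D'.X} {p' : D'.X ⟶ A'.X} {j' : B'.X ⟶ D'.X} {q' : D'.X ⟶ B'.X}
    (h : IsDirectSum i p j q) (h' : IsDirectSum i' p' j' q') (hD : Isomorphic D D')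
    (hA : T'.Evaluates A) (hB : T''.Evaluates B) (hA' : T'.Evaluates A')
    (hB' : T''.Evaluates B') : Isomorphic B B' :=
  isomorphic_left hcoprime.symm h.symm h'.symm hD hB hA hB' hA'

end Splitting

end SkeinTriple

open ExtFrobData SkeinTriple

theorem mainTheorem5 {k : Type*} [Field k] (T T' T'' : SkeinTriple k)
    (hα : T.α = T'.α + T''.α) (hβ : T.β = T'.β + T''.β) (hγ : T.γ = T'.γ + T''.γ)
    (hcoprime : IsCoprime T'.handlePoly T''.handlePoly)
    (hm : T.handlePoly = T'.handlePoly * T''.handlePoly) :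
    ∃ (F : T.PsUCob ⥤ ExtProd k T'.PsUCob T''.PsUCob) (_ : F.Braided),
      F.IsEquivalence ∧ F.Additive ∧ F.Linear k ∧
        ∃ e : (T.circle.map F).X ≅ (ExtFrobData.extSum k T'.circle T''.circle).X,
          ExtFrobData.IsHom (T.circle.map F) (ExtFrobData.extSum k T'.circle T''.circle) e.hom := by
  obtain ⟨i, p, j, q, hS⟩ := exists_isDirectSum_extSum k T'.circle T''.circle
  have hS' := (T'.evaluates_circle.map (LinProd.left k T'.PsUCob T''.PsUCob)).map (PsAb.embedding _)
  have hS'' :=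
    (T''.evaluates_circle.map (LinProd.right k T'.PsUCob T''.PsUCob)).map (PsAb.embedding _)
  -- The direct sum is an algebra satisfying the relations of `T`, so the universal property of
  -- `T.PsUCob` applies to it.
  obtain ⟨F, _, _, _, hF⟩ := T.exists_functor
    (hS.isExtFrob ((T'.isExtFrob_circle.map _).map _) ((T''.isExtFrob_circle.map _).map _))
    (Evaluates.of_isDirectSum hα hβ hγ hm hS hS' hS'')
  refine ⟨F, inferInstance, ?_, inferInstance, inferInstance, hF⟩
  obtain ⟨A, B, i₀, p₀, j₀, q₀, hD, hA, hB, hA', hB'⟩ :=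
    T.evaluates_circle.exists_isDirectSum hα hβ hγ hcoprime hm T.isExtFrob_circle
  -- The two pieces of the circle of `T` satisfy the relations of `T'` and `T''`, so each of them
  -- receives a functor; the pairing combines these into a functor on external products.
  obtain ⟨G₁, _, _, _, hG₁⟩ := T'.exists_functor hA hA'
  obtain ⟨G₂, _, _, _, hG₂⟩ := T''.exists_functor hB hB'
  obtain ⟨G, _, _, _, hG⟩ := PsAb.exists_extension (k := k) (LinProd.pairing k G₁ G₂)
  -- It suffices to compare images of the circle. `F` sends it to the direct sum of `A'` and `A''`,
  -- and `G` sends these back to the two pieces into which the circle splits.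
  have hFG : Nonempty (F ⋙ G ≅ 𝟭 _) := by
    refine T.nonempty_iso_of_isomorphic ?_
    rw [map_comp, map_id]
    have hl := (LinProd.monIso_left k G₁ G₂).symm.isomorphic T'.circle
    have hr := (LinProd.monIso_right k G₁ G₂).symm.isomorphic T''.circle
    rw [map_comp] at hl hr
    have hl' := (hG.isomorphic (T'.circle.map (LinProd.left k _ _))).trans (hl.trans hG₁)
    have hr' := (hG.isomorphic (T''.circle.map (LinProd.right k _ _))).trans (hr.trans hG₂)
    rw [map_comp] at hl' hr'
    obtain ⟨e, he⟩ := hl'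
    obtain ⟨f, hf⟩ := hr'
    exact (hF.map G).trans ((hS.map G).isomorphic (hD.of_isomorphic he hf))
  -- The objects `X ⊠ Y` are dense in the envelope, and on them a monoidal functor is determined by
  -- its restrictions to the two factors. Each restriction is determined by a circle: `G₁` followed
  -- by `F` sends `A'` to the first piece of `F` of the circle, which is the first summand of the
  -- target algebra because summands are intrinsic.
  have hGF : Nonempty (G ⋙ F ≅ 𝟭 _) := by
    obtain ⟨τ, _⟩ := hG
    have h₁ : Nonempty (G₁ ⋙ F ≅ LinProd.left k _ _ ⋙ PsAb.embedding _) := by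
      refine T'.nonempty_iso_of_isomorphic ?_
      rw [map_comp, map_comp]
      exact (hG₁.map F).trans (Evaluates.isomorphic_left hcoprime (hD.map F) hS hF (hA'.map F)
        (hB'.map F) hS' hS'')
    have h₂ : Nonempty (G₂ ⋙ F ≅ LinProd.right k _ _ ⋙ PsAb.embedding _) := by
      refine T''.nonempty_iso_of_isomorphic ?_
      rw [map_comp, map_comp]
      exact (hG₂.map F).trans (Evaluates.isomorphic_right hcoprime (hD.map F) hS hF (hA'.map F)
        (hB'.map F) hS' hS'')
    obtain ⟨τ₁⟩ := h₁
    obtain ⟨τ₂⟩ := h₂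
    exact PsAb.summandDense_embedding.nonempty_iso ((Functor.associator _ _ _).symm ≪≫
      Functor.isoWhiskerRight τ F ≪≫ LinProd.pairingCompIso G₁ G₂ F (PsAb.embedding _) τ₁ τ₂ ≪≫
        (Functor.rightUnitor _).symm)
  -- Plain natural isomorphisms are enough here, since linearity and the symmetric monoidal
  -- structure of `F` are already part of its construction.
  exact (CategoryTheory.Equivalence.mk F G hFG.some.symm hGF.some).isEquivalence_functor
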